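/- Let $k$ be an algebraically closed field, $V$ a finite dimensional $k$-vector space, $R\subseteq V\otimes V$ a subspace, and let $A=TV/(R)$ be Koszul (the trivial left module $k$ has a linear resolution by graded free left $A$-modules) and Artin–Schelter regular of dimension $d$ ($A$ has global dimension $d$, $\operatorname{Ext}^i_A(k,A)=0$ for $i\neq d$, and $\operatorname{Ext}^d_A(k,A)\cong k(l)$ for some $l\in\mathbb Z$). Put $R_0=k$, $R_1=V$ and $R_a=\bigcap_{i+j+2=a}V^{\otimes i}\otimes R\otimes V^{\otimes j}$ for $a\ge 2$. Then $\dim R_d=1$, and for $a+b=d$ the inclusion $R_d\subseteq R_a\otimes R_b$ is a perfect pairing, i.e. it induces an isomorphism $R_a^*\cong \operatorname{Hom}(R_d,R_b)=R_d^{-1}\otimes R_b$, where $R_d^{-1}=R_d^*$. Let $\Lambda=\langle r_1,\dots,r_{d-1},r_d^{\pm1}\rangle$ be the free monoid on $r_1,\dots,r_d$ with an inverse of $r_d$ adjoined, $r_0=1$. Order $\Lambda$ by the minimal left and right invariant ordering with $r_{a+b}<r_ar_b$ ($a,b\ge1$, $a+b\le d$) and $1<r_ar_d^{-1}r_{d-a}$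 ($1\le a\le d-1$). Let $\mathcal U$ be the strict monoidal category with object monoid $\Lambda$ generated by morphisms $\phi_{a,b}:r_{a+b}\to r_ar_b$ ($a+b\le d$) and $\theta_{a,b}:r_ar_d^{-1}r_b\to r_{a+b-d}$ ($a,b\le d\le a+b$), with $\phi_{0,a},\phi_{a,0},\theta_{d,a},\theta_{a,d}$ identities, subject to $$(r_a\phi_{b,c})\phi_{a,b+c}=(\phi_{a,b}r_c)\phi_{a+b,c},\qquad \theta_{a+b-d,c}(\theta_{a,b}r_d^{-1}r_c)=\theta_{a,b+c-d}(r_ar_d^{-1}\theta_{b,c}),$$ $$(r_a\theta_{b,c})(\phi_{a,b}r_d^{-1}r_c)=\phi_{a,b+c-d}\,\theta_{a+b,c},\qquad (\theta_{a,b}r_c)(r_ar_d^{-1}\phi_{b,c})=\phi_{a+b-d,c}\,\theta_{a,b+c}$$ whenever all terms are defined. Let $M:\mathcal U\to\mathrm{Vect}$ be the monoidal functor with $M(r_a)=R_a$ and $M(r_d^{-1})=R_d^{-1}$ which sends $\phi_{a,b}$ to the inclusion $R_{a+b}\subseteq R_a\otimes R_b$ and $\theta_{a,b}$ to the composition $R_a\otimes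 R_d^{-1}\otimes R_b\subseteq R_a\otimes R_d^{-1}\otimes R_{d-a}\otimes R_{a+b-d}\to R_{a+b-d}$, the last map being given by the inverse of the isomorphism $R_{d-a}^*\cong R_d^{-1}\otimes R_a$. For $\lambda\in\Lambda$ put $$\nabla(\lambda)=\operatorname{coker}\Big(\bigoplus_{\mu\to\lambda \text{ in }\mathcal U,\ \mu<\lambda}M(\mu)\to M(\lambda)\Big),\qquad \Delta(\lambda)=\ker\Big(M(\lambda)\to\bigoplus_{\lambda\to\mu\text{ in }\mathcal U,\ \mu<\lambda}M(\mu)\Big),$$ and let $L(\lambda)$ be the image of the composition $\Delta(\lambda)\hookrightarrow M(\lambda)\twoheadrightarrow\nabla(\lambda)$. For every $\lambda\in\Lambda$ the composition $\Delta(\lambda)\hookrightarrow M(\lambda)\twoheadrightarrow\nabla(\lambda)$ is nonzero. In particular $\Delta(\lambda)$, $\nabla(\lambda)$ and $L(\lambda)$ are all nonzero. -/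

import Mathlib

open CategoryTheory
open scoped TensorProduct

universe u

noncomputable section

namespace KoszulASRegular

variable {k : Type u} [Field k] {V : Type u} [AddCommGroup V] [Module k V]

/-- `V^{⊗ n}`, as the degree `n` part of the tensor algebra `T(V)`. -/
def tensorPow (k : Type u) [Field k] (V : Type u) [AddCommGroup V] [Module k V] (n : ℕ) :
    Submodule k (TensorAlgebra k V) :=
  LinearMap.range (TensorAlgebra.ι k (M := V)) ^ n

/-- The space of relations `R ⊆ V ⊗ V`, regarded as a subspace of `T(V)`. -/
def relations (R : Submodule k (V ⊗[k] V)) : Submodule k (TensorAlgebra k V) :=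
  R.map (LinearMap.mul' k (TensorAlgebra k V) ∘ₗ
    TensorProduct.map (TensorAlgebra.ι k) (TensorAlgebra.ι k))

/-! ### The quadratic algebra `A = T(V)/(R)` -/

/-- The relation `x ∼ 0` for `x ∈ R`. -/
def AlgRel (R : Submodule k (V ⊗[k] V)) (x y : TensorAlgebra k V) : Prop :=
  x ∈ relations R ∧ y = 0

/-- The quadratic algebra `A = T(V)/(R)`. -/
abbrev QuadAlg (R : Submodule k (V ⊗[k] V)) : Type u := RingQuot (AlgRel R)

/-- The canonical map `V → A`, whose range is the degree one part `A₁`. -/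
def QuadAlg.ι (R : Submodule k (V ⊗[k] V)) : V →ₗ[k] QuadAlg R :=
  (RingQuot.mkAlgHom k (AlgRel R)).toLinearMap ∘ₗ TensorAlgebra.ι k

/-- The augmentation `A → A₀ = k`, which kills `A₁`. -/
def QuadAlg.aug (R : Submodule k (V ⊗[k] V)) : QuadAlg R →ₐ[k] k :=
  RingQuot.liftAlgHom k ⟨TensorAlgebra.algebraMapInv, by
    rintro x y ⟨hx, rfl⟩
    obtain ⟨t, -, rfl⟩ := hx
    rw [map_zero]
    induction t using TensorProduct.induction_on with
    | zero => simp
    | tmul v w => simp [TensorAlgebra.algebraMapInv]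
    | add s t hs ht => rw [map_add, map_add, hs, ht, add_zero]⟩

/-- The left `A`-module `k = A / A_{≥ 1}`. -/
def QuadAlg.trivialModule (R : Submodule k (V ⊗[k] V)) : ModuleCat.{u} (QuadAlg R) :=
  (ModuleCat.restrictScalars (QuadAlg.aug R).toRingHom).obj (ModuleCat.of k k)

/-- `A` is Koszul: the trivial left module `k` has a linear resolution by graded free modules,
`⋯ → ⨁_{I₂} A(-2) → ⨁_{I₁} A(-1) → A → k → 0`.
Here `I n` is the index set in homological degree `n + 1`; a morphism
`⨁ A(-n-1) → ⨁ A(-n)` has degree zero exactly if the image of every basis vector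
has all its coordinates in `A₁`. -/
def IsKoszul (R : Submodule k (V ⊗[k] V)) : Prop :=
  ∃ (I : ℕ → Type u)
    (δ₀ : (I 0 →₀ QuadAlg R) →ₗ[QuadAlg R] QuadAlg R)
    (δ : ∀ n, (I (n + 1) →₀ QuadAlg R) →ₗ[QuadAlg R] (I n →₀ QuadAlg R)),
    (∀ i, δ₀ (Finsupp.single i 1) ∈ LinearMap.range (QuadAlg.ι R)) ∧
    (∀ n i j, δ n (Finsupp.single i 1) j ∈ LinearMap.range (QuadAlg.ι R)) ∧
    Function.Exact δ₀ (QuadAlg.aug R) ∧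
    Function.Exact (δ 0) δ₀ ∧
    ∀ n, Function.Exact (δ (n + 1)) (δ n)

/-- The (left) global dimension of a ring. -/
def globalDimension (A : Type u) [Ring A] : WithBot ℕ∞ :=
  ⨆ M : ModuleCat.{u} A, projectiveDimension M

/-- `A` is Artin-Schelter regular of dimension `d`: it has global dimension `d`,
`Ext^i_A(k, A) = 0` for `i ≠ d`, and `Ext^d_A(k, A)` is a one-dimensional vector space
(so, being a graded right module, it is `k(l)` for some `l`). -/
structure IsASRegular (R : Submodule k (V ⊗[k] V)) (d : ℕ) : Prop where
  globalDimension_eq : globalDimension (QuadAlg R) = d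
  ext_eq_zero : ∀ i : ℕ, i ≠ d → Subsingleton
    (Abelian.Ext (QuadAlg.trivialModule R) (ModuleCat.of (QuadAlg R) (QuadAlg R)) i)
  finrank_ext : Module.finrank k
    (Abelian.Ext (QuadAlg.trivialModule R) (ModuleCat.of (QuadAlg R) (QuadAlg R)) d) = 1

/-! ### The spaces `R_a` and the inclusions `R_{a+b} ⊆ R_a ⊗ R_b` -/

/-- `R_a = ⋂_{i+j+2=a} V^{⊗ i} ⊗ R ⊗ V^{⊗ j}` inside `V^{⊗ a}`; in particular
`R_0 = k`, `R_1 = V` and `R_2 = R`. -/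
def Rpow (R : Submodule k (V ⊗[k] V)) (a : ℕ) : Submodule k (TensorAlgebra k V) :=
  tensorPow k V a ⊓ ⨅ (i : ℕ) (j : ℕ) (_ : i + j + 2 = a),
    tensorPow k V i * relations R * tensorPow k V j

theorem Rpow_le (R : Submodule k (V ⊗[k] V)) (a : ℕ) : Rpow R a ≤ tensorPow k V a := inf_le_left

theorem tensorPow_le_range (n : ℕ) : tensorPow k V n ≤
    LinearMap.range (TensorPower.toTensorAlgebra (R := k) (M := V) (n := n)) := by
  induction n with
  | zero =>
    rw [tensorPow, pow_zero, Submodule.one_le]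
    exact ⟨_, TensorPower.toTensorAlgebra_gOne⟩
  | succ n ih =>
    rw [tensorPow, pow_succ, Submodule.mul_le]
    rintro x hx _ ⟨v, rfl⟩
    obtain ⟨t, rfl⟩ := ih hx
    let s : ⨂[k]^1 V := PiTensorProduct.tprod k (fun _ : Fin 1 => v)
    refine ⟨GradedMonoid.GMul.mul (A := fun n => ⨂[k]^n V) t s, ?_⟩
    rw [TensorPower.toTensorAlgebra_gMul]
    simp [s]

theorem toTensorAlgebra_injective (n : ℕ) :
    Function.Injective (TensorPower.toTensorAlgebra (R := k) (M := V) (n := n)) := by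
  intro x y h
  have h2 : TensorAlgebra.ofDirectSum (DirectSum.of (fun n => ⨂[k]^n V) n x) =
      TensorAlgebra.ofDirectSum (DirectSum.of (fun n => ⨂[k]^n V) n y) := by
    exact (DirectSum.toAddMonoid_of (fun n =>
      (TensorPower.toTensorAlgebra (R := k) (M := V) (n := n)).toAddMonoidHom) n x).trans (h.trans
        (DirectSum.toAddMonoid_of (fun n =>
          (TensorPower.toTensorAlgebra (R := k) (M := V) (n := n)).toAddMonoidHom) n y).symm)
  have h3 := congrArg TensorAlgebra.toDirectSum h2
  rw [TensorAlgebra.toDirectSum_ofDirectSum, TensorAlgebra.toDirectSum_ofDirectSum] at h3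
  exact DirectSum.of_injective n h3

/-- Multiplication `V^{⊗ a} ⊗ V^{⊗ b} → T(V)` is injective. -/
theorem mulMap_tensorPow_injective (a b : ℕ) :
    Function.Injective (Submodule.mulMap (tensorPow k V a) (tensorPow k V b)) := by
  have hf : ∀ n, ∃ g : tensorPow k V n →ₗ[k] ⨂[k]^n V,
      ∀ x, TensorPower.toTensorAlgebra (g x) = (x : TensorAlgebra k V) := by
    intro n
    let e := LinearEquiv.ofInjective _ (toTensorAlgebra_injective (k := k) (V := V) n)
    refine ⟨e.symm.toLinearMap ∘ₗ Submodule.inclusion (tensorPow_le_range n), fun x => ?_⟩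
    exact congrArg Subtype.val (e.apply_symm_apply (Submodule.inclusion (tensorPow_le_range n) x))
  obtain ⟨f, hf'⟩ := hf a
  obtain ⟨g, hg'⟩ := hf b
  have hfi : Function.Injective f := fun x y h => Subtype.ext (by rw [← hf', ← hf', h])
  have hgi : Function.Injective g := fun x y h => Subtype.ext (by rw [← hg', ← hg', h])
  have key : Submodule.mulMap (tensorPow k V a) (tensorPow k V b) =
      TensorPower.toTensorAlgebra ∘ₗ
        (TensorPower.mulEquiv (R := k) (M := V) (n := a) (m := b)).toLinearMap ∘ₗ
          TensorProduct.map f g := by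
    ext x y
    simp only [TensorProduct.AlgebraTensorModule.curry_apply, LinearMap.restrictScalars_self,
      TensorProduct.curry_apply, Submodule.mulMap_tmul, LinearMap.comp_apply,
      TensorProduct.map_tmul, LinearEquiv.coe_coe]
    rw [← TensorPower.gMul_def, TensorPower.toTensorAlgebra_gMul, hf', hg']
  rw [key]
  simp only [LinearMap.coe_comp, LinearEquiv.coe_coe]
  exact (toTensorAlgebra_injective _).comp
    ((LinearEquiv.injective _).comp (TensorProduct.map_injective_of_flat_flat f g hfi hgi))

/-- Contraction `f ⊗ id : P ⊗ Q → Q` of the left factor with a functional `f` on `P`. -/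
def contractL {P : Type u} [AddCommMonoid P] [Module k P] (Q : Type u) [AddCommMonoid Q]
    [Module k Q] : Module.Dual k P →ₗ[k] (P ⊗[k] Q →ₗ[k] Q) :=
  (TensorProduct.lid k Q).toLinearMap.compRight k (M := P ⊗[k] Q) ∘ₗ LinearMap.rTensorHom Q

@[simp]
theorem contractL_tmul {P : Type u} [AddCommMonoid P] [Module k P] {Q : Type u} [AddCommMonoid Q]
    [Module k Q] (f : Module.Dual k P) (p : P) (q : Q) :
    contractL Q f (p ⊗ₜ q) = f p • q := by
  simp [contractL]

theorem mem_range_lTensor {P Q : Type u} [AddCommGroup P] [Module k P] [AddCommGroup Q]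
    [Module k Q] (Y : Submodule k Q) (t : P ⊗[k] Q) (h : ∀ f, contractL Q f t ∈ Y) :
    t ∈ LinearMap.range (Y.subtype.lTensor P) := by
  classical
  let b := Module.Basis.ofVectorSpace k P
  have hb : ∀ (s : P ⊗[k] Q) i,
      TensorProduct.equivFinsuppOfBasisLeft b s i = contractL Q (b.coord i) s := by
    intro s i
    induction s using TensorProduct.induction_on with
    | zero => simp
    | tmul p q => simp [TensorProduct.equivFinsuppOfBasisLeft_apply_tmul]
    | add s t hs ht => simp [hs, ht]
  rw [← (TensorProduct.equivFinsuppOfBasisLeft b).symm_apply_apply t,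
    TensorProduct.equivFinsuppOfBasisLeft_symm_apply]
  refine Submodule.sum_mem _ fun i _ => ⟨b i ⊗ₜ ⟨_, h (b.coord i)⟩, ?_⟩
  simp [hb]

theorem mem_range_rTensor {P Q : Type u} [AddCommGroup P] [Module k P] [AddCommGroup Q]
    [Module k Q] (X : Submodule k P) (t : P ⊗[k] Q)
    (h : ∀ f, contractL P f (TensorProduct.comm k P Q t) ∈ X) :
    t ∈ LinearMap.range (X.subtype.rTensor Q) := by
  obtain ⟨s, hs⟩ := mem_range_lTensor X (TensorProduct.comm k P Q t) h
  refine ⟨TensorProduct.comm k Q X s, ?_⟩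
  apply (TensorProduct.comm k P Q).injective
  rw [← hs]
  simp only [LinearMap.rTensor, LinearMap.lTensor, TensorProduct.map_comm]
  simp

theorem mulMap_injective {a b : ℕ} {X Y : Submodule k (TensorAlgebra k V)}
    (hX : X ≤ tensorPow k V a) (hY : Y ≤ tensorPow k V b) :
    Function.Injective (Submodule.mulMap X Y) := by
  rw [← Submodule.mulMap_comp_map_inclusion hX hY, LinearMap.coe_comp]
  exact (mulMap_tensorPow_injective a b).comp (TensorProduct.map_injective_of_flat_flat _ _
    (Submodule.inclusion_injective _) (Submodule.inclusion_injective _))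

theorem contract_mem {a b : ℕ} {X Y : Submodule k (TensorAlgebra k V)}
    (hX : X ≤ tensorPow k V a) (hY : Y ≤ tensorPow k V b)
    (t : tensorPow k V a ⊗[k] tensorPow k V b)
    (ht : Submodule.mulMap _ _ t ∈ X * Y) :
    (∀ f, (contractL (tensorPow k V b) f t : TensorAlgebra k V) ∈ Y) ∧
    (∀ f, (contractL (tensorPow k V a) f (TensorProduct.comm k _ _ t) : TensorAlgebra k V) ∈ X) := by
  rw [← Submodule.mulMap_range] at ht
  obtain ⟨s, hs⟩ := ht
  rw [← Submodule.mulMap_comp_map_inclusion hX hY] at hs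
  obtain rfl := mulMap_tensorPow_injective a b hs
  clear hs
  constructor
  · intro f
    induction s using TensorProduct.induction_on with
    | zero => simp
    | tmul x y => simpa using Y.smul_mem _ y.2
    | add s t hs ht => simpa using Y.add_mem hs ht
  · intro f
    induction s using TensorProduct.induction_on with
    | zero => simp
    | tmul x y => simpa using X.smul_mem _ x.2
    | add s t hs ht => simpa using X.add_mem hs ht

/-- `R_{a+b} ⊆ R_a ⊗ R_b` inside `V^{⊗ (a+b)}`. -/
theorem Rpow_le_mul (R : Submodule k (V ⊗[k] V)) {n a b : ℕ} (h : n = a + b) :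
    Rpow R n ≤ Rpow R a * Rpow R b := by
  subst h
  intro z hz
  have hz0 : z ∈ tensorPow k V a * tensorPow k V b := by
    rw [tensorPow, tensorPow, ← pow_add]; exact hz.1
  rw [← Submodule.mulMap_range] at hz0
  obtain ⟨t, rfl⟩ := hz0
  have hz2 : ∀ i j, i + j + 2 = a + b → Submodule.mulMap _ _ t ∈
      tensorPow k V i * relations R * tensorPow k V j := by
    have := hz.2
    simpa only [SetLike.mem_coe, Submodule.mem_iInf] using this
  have hR : relations R ≤ tensorPow k V 2 := by
    rintro _ ⟨t, -, rfl⟩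
    rw [tensorPow, pow_two]
    induction t using TensorProduct.induction_on with
    | zero => simp
    | tmul x y => exact Submodule.mul_mem_mul ⟨x, rfl⟩ ⟨y, rfl⟩
    | add s t hs ht => rw [map_add]; exact Submodule.add_mem _ hs ht
  have hle : ∀ i j n, i + j + 2 = n →
      tensorPow k V i * relations R * tensorPow k V j ≤ tensorPow k V n := by
    rintro i j n rfl
    refine (mul_le_mul' (mul_le_mul' le_rfl hR) le_rfl).trans (le_of_eq ?_)
    rw [tensorPow, tensorPow, tensorPow, tensorPow, ← pow_add, ← pow_add]
    congr 1; omega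
  have hleft : ∀ f, contractL _ f (TensorProduct.comm k _ _ t) ∈
      (Rpow R a).comap (tensorPow k V a).subtype := by
    intro f
    refine ⟨Subtype.property _, ?_⟩
    simp only [SetLike.mem_coe, Submodule.mem_iInf]
    intro i j hij
    refine (contract_mem (hle i j a hij) le_rfl t ?_).2 f
    have := hz2 i (j + b) (by omega)
    rwa [show tensorPow k V (j + b) = tensorPow k V j * tensorPow k V b from pow_add _ _ _,
      ← mul_assoc] at this
  have hright : ∀ f, contractL _ f t ∈ (Rpow R b).comap (tensorPow k V b).subtype := by
    intro f
    refine ⟨Subtype.property _, ?_⟩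
    simp only [SetLike.mem_coe, Submodule.mem_iInf]
    intro i j hij
    refine (contract_mem le_rfl (hle i j b hij) t ?_).1 f
    have := hz2 (a + i) j (by omega)
    rwa [show tensorPow k V (a + i) = tensorPow k V a * tensorPow k V i from pow_add _ _ _,
      mul_assoc, mul_assoc, ← mul_assoc (tensorPow k V i)] at this
  obtain ⟨s, rfl⟩ := mem_range_lTensor _ t hright
  have hs : ∀ f, contractL _ f (TensorProduct.comm k _ _ s) ∈
      (Rpow R a).comap (tensorPow k V a).subtype := by
    intro f
    obtain ⟨g, hg⟩ := f.exists_extend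
    have := hleft g
    convert this using 1
    rw [← hg]
    generalize s = s
    induction s using TensorProduct.induction_on with
    | zero => simp
    | tmul x y => simp
    | add s t hs ht => simp only [map_add, hs, ht]
  obtain ⟨r, rfl⟩ := mem_range_rTensor (P := tensorPow k V a)
    (Q := (Rpow R b).comap (tensorPow k V b).subtype) _ s hs
  clear hs hleft hright hz hz2
  induction r using TensorProduct.induction_on with
  | zero => simp
  | tmul x y => exact Submodule.mul_mem_mul x.2 y.2
  | add s t hs ht => rw [map_add, map_add, map_add]; exact Submodule.add_mem _ hs ht

/-- The inclusion `R_n ⊆ R_a ⊗ R_b`, for `n = a + b`. -/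
def comul (R : Submodule k (V ⊗[k] V)) {n a b : ℕ} (h : n = a + b) :
    Rpow R n →ₗ[k] Rpow R a ⊗[k] Rpow R b :=
  (LinearEquiv.ofInjective _ (mulMap_injective (Rpow_le R a) (Rpow_le R b))).symm.toLinearMap ∘ₗ
    Submodule.inclusion ((Rpow_le_mul R h).trans (Submodule.mulMap_range _ _).ge)

/-- `comul` is characterised by the fact that multiplication in `T(V)` inverts it. -/
theorem mulMap_comul (R : Submodule k (V ⊗[k] V)) {n a b : ℕ} (h : n = a + b) (x : Rpow R n) :
    Submodule.mulMap (Rpow R a) (Rpow R b) (comul R h x) = x :=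
  congrArg Subtype.val ((LinearEquiv.ofInjective _
    (mulMap_injective (Rpow_le R a) (Rpow_le R b))).apply_symm_apply _)

/-- For `n = a + b`, the map `R_a^* → Hom(R_n, R_b)` that contracts the left tensor factor of
`R_n ⊆ R_a ⊗ R_b` with a functional. -/
def slice (R : Submodule k (V ⊗[k] V)) {n a b : ℕ} (h : n = a + b) :
    Module.Dual k (Rpow R a) →ₗ[k] (Rpow R n →ₗ[k] Rpow R b) :=
  LinearMap.lcomp k (Rpow R b) (comul R h) ∘ₗ contractL (Rpow R b)

/-- `R_d` is one-dimensional, and for `a + b = d` the inclusion `R_d ⊆ R_a ⊗ R_b` is a perfect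
pairing, that is, it induces an isomorphism `R_a^* → Hom(R_d, R_b) = R_d^{-1} ⊗ R_b`. -/
structure IsPerfect (R : Submodule k (V ⊗[k] V)) (d : ℕ) : Prop where
  finrank_eq_one : Module.finrank k (Rpow R d) = 1
  bijective : ∀ {a b : ℕ} (h : d = a + b), Function.Bijective (slice R h)

/-- For `a + b = d`, the map `R_b ⊗ R_d^{-1} ⊗ R_a → k` obtained from the inverse of the
isomorphism `R_a^* → Hom(R_d, R_b)`. -/
def eps {R : Submodule k (V ⊗[k] V)} {d : ℕ} (hp : IsPerfect R d) {a b : ℕ} (h : d = a + b) :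
    Rpow R b →ₗ[k] Module.Dual k (Rpow R d) →ₗ[k] Module.Dual k (Rpow R a) :=
  (LinearMap.smulRightₗ (R := k) (M₂ := Rpow R d) (M := Rpow R b)).flip.compr₂
    (LinearEquiv.ofBijective (slice R h) (hp.bijective h)).symm.toLinearMap

/-- For `a + b = d + c`, the map `θ_{a,b} : R_a ⊗ R_d^{-1} ⊗ R_b → R_c`: use
`R_b ⊆ R_{d-a} ⊗ R_c` and contract `R_a ⊗ R_d^{-1} ⊗ R_{d-a}` with `eps`. -/
def thetaLin {R : Submodule k (V ⊗[k] V)} {d : ℕ} (hp : IsPerfect R d) {a b c : ℕ} (ha : a ≤ d)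
    (h : a + b = d + c) :
    Rpow R a →ₗ[k] Module.Dual k (Rpow R d) →ₗ[k] Rpow R b →ₗ[k] Rpow R c :=
  (eps hp (show d = (d - a) + a by omega)).compr₂ (slice R (show b = (d - a) + c by omega))

theorem mulMap_left_injective {R : Submodule k (V ⊗[k] V)} (a b c : ℕ) :
    Function.Injective (Submodule.mulMap (Rpow R a) (tensorPow k V (b + c)) ∘ₗ
      LinearMap.lTensor (Rpow R a) ((Submodule.mulMap (Rpow R b) (Rpow R c)).codRestrict
        (tensorPow k V (b + c)) (fun t => by
          have := LinearMap.mem_range_self (Submodule.mulMap (Rpow R b) (Rpow R c)) t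
          rw [Submodule.mulMap_range] at this
          rw [tensorPow, pow_add]
          exact mul_le_mul' (Rpow_le R b) (Rpow_le R c) this))) := by
  rw [LinearMap.coe_comp]
  refine (mulMap_injective (Rpow_le R a) le_rfl).comp
    (Module.Flat.lTensor_preserves_injective_linearMap _ ?_)
  intro s t h
  exact mulMap_injective (Rpow_le R b) (Rpow_le R c) (congrArg Subtype.val h)

theorem comul_coassoc (R : Submodule k (V ⊗[k] V)) {n a b c p q : ℕ} (h₁ : n = a + q)
    (h₂ : q = b + c) (h₃ : n = p + c) (h₄ : p = a + b) (x : Rpow R n) :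
    TensorProduct.assoc k _ _ _ ((comul R h₄).rTensor _ (comul R h₃ x)) =
      (comul R h₂).lTensor _ (comul R h₁ x) := by
  apply mulMap_left_injective a b c
  have e₁ : ∀ t : Rpow R a ⊗[k] Rpow R q, (Submodule.mulMap (Rpow R a) (tensorPow k V (b + c)) ∘ₗ
      LinearMap.lTensor (Rpow R a) ((Submodule.mulMap (Rpow R b) (Rpow R c)).codRestrict
        (tensorPow k V (b + c)) (fun t => by
          have := LinearMap.mem_range_self (Submodule.mulMap (Rpow R b) (Rpow R c)) t
          rw [Submodule.mulMap_range] at this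
          rw [tensorPow, pow_add]
          exact mul_le_mul' (Rpow_le R b) (Rpow_le R c) this)))
        ((comul R h₂).lTensor _ t) = Submodule.mulMap _ _ t := by
    intro t
    induction t using TensorProduct.induction_on with
    | zero => simp
    | tmul x y => simp [mulMap_comul]
    | add s t hs ht => rw [map_add, map_add, map_add, hs, ht]
  have e₂ : ∀ t : (Rpow R a ⊗[k] Rpow R b) ⊗[k] Rpow R c,
      (Submodule.mulMap (Rpow R a) (tensorPow k V (b + c)) ∘ₗ
      LinearMap.lTensor (Rpow R a) ((Submodule.mulMap (Rpow R b) (Rpow R c)).codRestrict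
        (tensorPow k V (b + c)) (fun t => by
          have := LinearMap.mem_range_self (Submodule.mulMap (Rpow R b) (Rpow R c)) t
          rw [Submodule.mulMap_range] at this
          rw [tensorPow, pow_add]
          exact mul_le_mul' (Rpow_le R b) (Rpow_le R c) this)))
        (TensorProduct.assoc k _ _ _ t) =
      LinearMap.mul' k _ (TensorProduct.map (Submodule.mulMap (Rpow R a) (Rpow R b))
        (Rpow R c).subtype t) := by
    intro t
    induction t using TensorProduct.induction_on with
    | zero => simp
    | tmul x y =>
      induction x using TensorProduct.induction_on with
      | zero => simp
      | tmul x y => simp [mul_assoc]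
      | add s t hs ht => rw [TensorProduct.add_tmul, map_add, map_add, map_add, map_add, hs, ht]
    | add s t hs ht => rw [map_add, map_add, map_add, map_add, hs, ht]
  have e₃ : ∀ t : Rpow R p ⊗[k] Rpow R c,
      LinearMap.mul' k _ (TensorProduct.map (Submodule.mulMap (Rpow R a) (Rpow R b))
        (Rpow R c).subtype ((comul R h₄).rTensor _ t)) = Submodule.mulMap _ _ t := by
    intro t
    induction t using TensorProduct.induction_on with
    | zero => simp
    | tmul x y => simp [mulMap_comul]
    | add s t hs ht => rw [map_add, map_add, map_add, map_add, hs, ht]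
  rw [e₁, e₂, e₃, mulMap_comul, mulMap_comul]

theorem slice_apply (R : Submodule k (V ⊗[k] V)) {n a b : ℕ} (h : n = a + b) (f) (x : Rpow R n) :
    slice R h f x = contractL _ f (comul R h x) := rfl

theorem comul_slice (R : Submodule k (V ⊗[k] V)) {n a b c p q : ℕ} (h₁ : n = a + q)
    (h₂ : q = b + c) (h₃ : n = p + c) (h₄ : p = a + b) (f) (x : Rpow R n) :
    comul R h₂ (slice R h₁ f x) = (slice R h₄ f).rTensor _ (comul R h₃ x) := by
  have e₁ : ∀ t, comul R h₂ (contractL _ f t) = contractL _ f ((comul R h₂).lTensor _ t) := by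
    intro t
    induction t using TensorProduct.induction_on with
    | zero => simp
    | tmul x y => simp
    | add s t hs ht => simp only [map_add, hs, ht]
  have e₂ : ∀ t : (Rpow R a ⊗[k] Rpow R b) ⊗[k] Rpow R c,
      contractL _ f (TensorProduct.assoc k _ _ _ t) = (contractL _ f).rTensor _ t := by
    intro t
    induction t using TensorProduct.induction_on with
    | zero => simp
    | tmul x y =>
      induction x using TensorProduct.induction_on with
      | zero => simp
      | tmul x y => simp [TensorProduct.smul_tmul']
      | add s t hs ht => simp only [TensorProduct.add_tmul, map_add, hs, ht]
    | add s t hs ht => simp only [map_add, hs, ht]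
  rw [slice_apply, e₁, ← comul_coassoc R h₁ h₂ h₃ h₄, e₂, ← LinearMap.comp_apply,
    ← LinearMap.rTensor_comp]
  rfl

section
variable {R : Submodule k (V ⊗[k] V)} {d : ℕ} (hp : IsPerfect R d)

theorem slice_eps {a b : ℕ} (h : d = a + b) (x : Rpow R b) (ψ) (ω : Rpow R d) :
    slice R h (eps hp h x ψ) ω = ψ ω • x := by
  have := (LinearEquiv.ofBijective (slice R h) (hp.bijective h)).apply_symm_apply (ψ.smulRight x)
  exact LinearMap.congr_fun this ω

theorem smul_comm_of_perfect (hp : IsPerfect R d) {W : Type u} [AddCommGroup W] [Module k W]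
    (ψ : Module.Dual k (Rpow R d)) (g : Rpow R d →ₗ[k] W) (x y : Rpow R d) :
    ψ x • g y = ψ y • g x := by
  obtain ⟨ω, -, hω⟩ := finrank_eq_one_iff'.1 hp.finrank_eq_one
  obtain ⟨r, rfl⟩ := hω x
  obtain ⟨s, rfl⟩ := hω y
  simp only [map_smul, smul_eq_mul, smul_smul]
  congr 1; ring

theorem zigzag {a b : ℕ} (h : d = a + b) (ψ) (y : Rpow R a) (ω : Rpow R d) :
    contractL _ ((eps hp h).flip ψ |>.flip y) (TensorProduct.comm k _ _ (comul R h ω)) =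
      ψ ω • y := by
  rw [← sub_eq_zero, ← Module.forall_dual_apply_eq_zero_iff k]
  intro f
  have e : ∀ (g) (t : Rpow R a ⊗[k] Rpow R b),
      f (contractL _ g (TensorProduct.comm k _ _ t)) = g (contractL _ f t) := by
    intro g t
    induction t using TensorProduct.induction_on with
    | zero => simp
    | tmul x y => simp [mul_comm]
    | add s t hs ht => simp only [map_add, hs, ht]
  rw [map_sub, sub_eq_zero, e, ← slice_apply, map_smul]
  have : eps hp h (slice R h f ω) ψ = ψ ω • f := by
    apply (hp.bijective h).1
    ext ω'
    rw [slice_eps, map_smul, LinearMap.smul_apply, smul_comm_of_perfect hp ψ]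
  rw [LinearMap.flip_apply, LinearMap.flip_apply, this, LinearMap.smul_apply]

theorem theta_apply {a b c : ℕ} (ha : a ≤ d) (h : a + b = d + c) (x : Rpow R a) (ψ) (y : Rpow R b) :
    thetaLin hp ha h x ψ y = slice R (show b = (d - a) + c by omega)
      (eps hp (show d = (d - a) + a by omega) x ψ) y := rfl

/-- Compatibility of `θ` with `φ` on the right. -/
theorem comul_theta_right {a b b' c p : ℕ} (ha : a ≤ d) (h : a + b = d + c) (q : ℕ)
    (hb : b = b' + q) (hc : c = p + q) (h' : a + b' = d + p)
    (x : Rpow R a) (ψ) (z : Rpow R b) :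
    comul R hc (thetaLin hp ha h x ψ z) = (thetaLin hp ha h' x ψ).rTensor _ (comul R hb z) := by
  rw [theta_apply, comul_slice R _ hc hb (by omega)]
  rfl

/-- Compatibility of `θ` with `φ` on the left. -/
theorem comul_theta_left {n a b c e f : ℕ} (hn : n ≤ d) (hab : n = a + b) (hbd : b ≤ d)
    (h : b + c = d + e) (h' : n + c = d + f) (hf : f = a + e)
    (x : Rpow R n) (ψ) (z : Rpow R c) :
    ((thetaLin hp hbd h).flip ψ |>.flip z).lTensor _ (comul R hab x) =
      comul R hf (thetaLin hp hn h' x ψ z) := by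
  by_cases hψ : ψ = 0
  · subst hψ
    have : ((thetaLin hp hbd h).flip 0).flip z = 0 := by ext; simp
    rw [this]; simp
  obtain ⟨ω, hω⟩ : ∃ ω, ψ ω = 1 := by
    obtain ⟨ω, hω⟩ := LinearMap.surjective hψ 1
    exact ⟨ω, hω⟩
  have hd : d = (d - n) + n := by omega
  have hx : x = slice R hd (eps hp hd x ψ) ω := by rw [slice_eps, hω, one_smul]
  have e₁ : ∀ t : Rpow R (d - b) ⊗[k] Rpow R e, ∀ u : Rpow R (d - b) ⊗[k] Rpow R b,
      ((contractL (Rpow R e)).flip t ∘ₗ (eps hp (show d = (d - b) + b by omega)).flip ψ).lTensor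
        (Rpow R (d - b)) u = LinearMap.rTensor (Rpow R e)
        (LinearMap.flip ((contractL (Rpow R (d - b))) ∘ₗ
          ((eps hp (show d = (d - b) + b by omega)).flip ψ).flip)
          (TensorProduct.comm k _ _ u)) t := by
    intro t u
    induction t using TensorProduct.induction_on with
    | zero =>
      have : (contractL (Rpow R e)).flip (0 : Rpow R (d - b) ⊗[k] Rpow R e) = 0 := map_zero _
      simp [this]
    | tmul y w =>
      induction u using TensorProduct.induction_on with
      | zero => simp
      | tmul p q => simp [TensorProduct.smul_tmul]
      | add s t hs ht => 
        simp only [map_add, hs, ht, LinearMap.rTensor_add, LinearMap.add_apply]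
    | add s t hs ht =>
      have : (contractL (Rpow R e)).flip (s + t) =
        (contractL (Rpow R e)).flip s + (contractL (Rpow R e)).flip t := map_add _ _ _
      rw [this, LinearMap.add_comp, LinearMap.lTensor_add, LinearMap.add_apply, hs, ht, map_add]
  have e₂ : ((thetaLin hp hbd h).flip ψ).flip z =
      (contractL (Rpow R e)).flip (comul R (show c = (d - b) + e by omega) z) ∘ₗ
        (eps hp (show d = (d - b) + b by omega)).flip ψ := rfl
  have e₃ : LinearMap.flip ((contractL (Rpow R (d - b))) ∘ₗ
          ((eps hp (show d = (d - b) + b by omega)).flip ψ).flip)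
          (TensorProduct.comm k _ _ (comul R (show d = (d - b) + b by omega) ω)) =
        LinearMap.id := by
    ext1 y
    exact (zigzag hp _ ψ y ω).trans (by rw [hω, one_smul]; rfl)
  rw [theta_apply, comul_slice R _ hf (show c = (d - b) + e by omega)
    (show d - b = (d - n) + a by omega)]
  conv_lhs => rw [hx]
  rw [comul_slice R hd hab (show d = (d - b) + b by omega)
    (show d - b = (d - n) + a by omega), ← LinearMap.comp_apply, LinearMap.lTensor_comp_rTensor,
    ← LinearMap.rTensor_comp_lTensor, LinearMap.comp_apply, e₂, e₁, e₃]
  simp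

/-- Associativity of `θ`. -/
theorem theta_theta {a b c e m q : ℕ} (ha : a ≤ d) (hb : b ≤ d) (he : e ≤ d)
    (h₁ : a + b = d + e) (h₂ : e + c = d + m) (h₃ : b + c = d + q) (h₄ : a + q = d + m)
    (x : Rpow R a) (ψ) (y : Rpow R b) (χ) (z : Rpow R c) :
    thetaLin hp he h₂ (thetaLin hp ha h₁ x ψ y) χ z = thetaLin hp ha h₄ x ψ (thetaLin hp hb h₃ y χ z) := by
  have e₁ : ∀ (g) (F : Rpow R e →ₗ[k] Rpow R m) (t : Rpow R (d - a) ⊗[k] Rpow R e),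
      contractL _ g (F.lTensor _ t) = F (contractL _ g t) := by
    intro g F t
    induction t using TensorProduct.induction_on with
    | zero => simp
    | tmul x y => simp
    | add s t hs ht => simp only [map_add, hs, ht]
  rw [theta_apply hp ha h₄, slice_apply,
    ← comul_theta_left hp hb (show b = (d - a) + e by omega) he h₂ h₃ _ y χ z, e₁]
  rfl

end

/-- The identification `R_0 = k`. -/
def rZero (R : Submodule k (V ⊗[k] V)) : k ≃ₗ[k] Rpow R 0 :=
  LinearEquiv.ofBijective
    ((Algebra.linearMap k (TensorAlgebra k V)).codRestrict (Rpow R 0) (fun c => by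
      refine ⟨?_, ?_⟩
      · rw [tensorPow, pow_zero]; exact Submodule.algebraMap_mem c
      · simp)) (by
    constructor
    · intro c c' h
      exact TensorAlgebra.algebraMap_leftInverse (R := k) V |>.injective (congrArg Subtype.val h)
    · rintro ⟨x, hx⟩
      have h1 := hx.1
      rw [tensorPow, pow_zero] at h1
      obtain ⟨c, hc⟩ := Submodule.mem_one.1 h1
      exact ⟨c, Subtype.ext hc⟩)

theorem coe_rZero (R : Submodule k (V ⊗[k] V)) (c : k) :
    (rZero R c : TensorAlgebra k V) = algebraMap k _ c := rfl

theorem comul_zero_left (R : Submodule k (V ⊗[k] V)) {a : ℕ} (h : a = 0 + a) (x : Rpow R a) :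
    comul R h x = rZero R 1 ⊗ₜ x := by
  apply mulMap_injective (Rpow_le R 0) (Rpow_le R a)
  rw [mulMap_comul, Submodule.mulMap_tmul, coe_rZero, map_one, one_mul]

theorem comul_zero_right (R : Submodule k (V ⊗[k] V)) {a : ℕ} (h : a = a + 0) (x : Rpow R a) :
    comul R h x = x ⊗ₜ rZero R 1 := by
  apply mulMap_injective (Rpow_le R a) (Rpow_le R 0)
  rw [mulMap_comul, Submodule.mulMap_tmul, coe_rZero, map_one, mul_one]

theorem theta_left_top {R : Submodule k (V ⊗[k] V)} {d : ℕ} (hp : IsPerfect R d) {b : ℕ}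
    (h : d + b = d + b) (x : Rpow R d) (ψ) (y : Rpow R b) :
    thetaLin hp le_rfl h x ψ y = ψ x • y := by
  have key : ∀ z (hz : z = 0) (h₁ : d = z + d) (h₂ : b = z + b),
      contractL _ (eps hp h₁ x ψ) (comul R h₂ y) = ψ x • y := by
    rintro z rfl h₁ h₂
    obtain ⟨ω, hω, -⟩ := finrank_eq_one_iff'.1 hp.finrank_eq_one
    rw [comul_zero_left, contractL_tmul]
    congr 1
    have := slice_eps hp h₁ x ψ ω
    have h2 := smul_comm_of_perfect hp ψ LinearMap.id ω x
    simp only [LinearMap.id_apply] at h2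
    rw [h2, slice_apply, comul_zero_left, contractL_tmul] at this
    exact smul_left_injective k hω this
  exact key _ (Nat.sub_self d) _ _

theorem theta_right_top {R : Submodule k (V ⊗[k] V)} {d : ℕ} (hp : IsPerfect R d) {a : ℕ}
    (ha : a ≤ d) (h : a + d = d + a) (x : Rpow R a) (ψ) (y : Rpow R d) :
    thetaLin hp ha h x ψ y = ψ y • x :=
  slice_eps hp _ x ψ y

theorem contractLeft_bijective {R : Submodule k (V ⊗[k] V)} {d : ℕ} (hp : IsPerfect R d) :
    Function.Bijective (contractLeft k (Rpow R d)) := by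
  obtain ⟨ω₀, hω₀, -⟩ := finrank_eq_one_iff'.1 hp.finrank_eq_one
  obtain ⟨ψ₀, hψ₀⟩ : ∃ ψ : Module.Dual k (Rpow R d), ψ ω₀ = 1 := by
    obtain ⟨f, hf⟩ : ∃ f : Module.Dual k (Rpow R d), f ω₀ ≠ 0 := by
      by_contra! h
      exact hω₀ ((Module.forall_dual_apply_eq_zero_iff k _).1 h)
    exact ⟨(f ω₀)⁻¹ • f, by simp [hf]⟩
  have key : ∀ t, t = contractLeft k (Rpow R d) t • (ψ₀ ⊗ₜ[k] ω₀) := by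
    intro t
    induction t using TensorProduct.induction_on with
    | zero => simp
    | tmul ψ ω =>
      have h₁ : ω = ψ₀ ω • ω₀ := by
        have := smul_comm_of_perfect hp ψ₀ LinearMap.id ω₀ ω
        rwa [hψ₀, one_smul] at this
      have h₂ : ψ = ψ ω₀ • ψ₀ := by
        ext x
        have := smul_comm_of_perfect hp ψ₀ ψ ω₀ x
        rw [hψ₀, one_smul] at this
        rw [this, LinearMap.smul_apply, smul_eq_mul, smul_eq_mul, mul_comm]
      rw [contractLeft_apply]
      conv_lhs => rw [h₁, h₂]
      conv_rhs => rw [h₁]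
      rw [TensorProduct.tmul_smul, TensorProduct.smul_tmul', smul_smul, map_smul, smul_eq_mul,
        TensorProduct.smul_tmul']
    | add s t hs ht =>
      conv_lhs => rw [hs, ht]
      rw [map_add, add_smul]
  constructor
  · intro s t h
    rw [key s, key t, h]
  · intro c
    exact ⟨c • (ψ₀ ⊗ₜ[k] ω₀), by rw [map_smul, contractLeft_apply, hψ₀, smul_eq_mul, mul_one]⟩

/-- The canonical isomorphism `R_d^{-1} ⊗ R_d ≅ k`, where `R_d^{-1} = R_d^*`. -/
def evalEquiv {R : Submodule k (V ⊗[k] V)} {d : ℕ} (hp : IsPerfect R d) :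
    Module.Dual k (Rpow R d) ⊗[k] Rpow R d ≃ₗ[k] k :=
  LinearEquiv.ofBijective (contractLeft k (Rpow R d)) (contractLeft_bijective hp)

/-! ### The monoid `Λ` and its order -/

/-- The generators `r_0, r_1, …, r_d` and `r_d^{-1}`. (With the convention `r_0 = 1`.) -/
inductive Letter (d : ℕ) : Type
  | r (a : ℕ) (ha : a ≤ d)
  | inv

/-- Expressions: words in the generators. -/
abbrev Word (d : ℕ) : Type := List (Letter d)

/-- The defining relations `r_0 = 1` and `r_d r_d^{-1} = 1 = r_d^{-1} r_d` of `Λ`. -/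
inductive MonoidRel (d : ℕ) : FreeMonoid (Letter d) → FreeMonoid (Letter d) → Prop
  | unit : MonoidRel d (FreeMonoid.of (.r 0 d.zero_le)) 1
  | mul_inv : MonoidRel d (FreeMonoid.of (.r d le_rfl) * FreeMonoid.of .inv) 1
  | inv_mul : MonoidRel d (FreeMonoid.of .inv * FreeMonoid.of (.r d le_rfl)) 1

/-- The monoid `Λ = ⟨r_1, …, r_{d-1}, r_d^{±1}⟩`. -/
abbrev Lam (d : ℕ) : Type := PresentedMonoid (MonoidRel d)

/-- The generator `r_a` of `Λ`. -/
def Lam.r {d : ℕ} (a : ℕ) (ha : a ≤ d) : Lam d := PresentedMonoid.of _ (.r a ha)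

/-- The element `r_d^{-1}` of `Λ`. -/
def Lam.inv (d : ℕ) : Lam d := PresentedMonoid.of _ .inv

/-- The element of `Λ` that is given by an expression. -/
def Word.toLam {d : ℕ} (w : Word d) : Lam d := PresentedMonoid.mk _ (FreeMonoid.ofList w)

/-- The translates of the generating relations `r_{a+b} < r_a r_b` (for `a, b ≥ 1`,
`a + b ≤ d`) and `1 < r_a r_d^{-1} r_{d-a}` (for `1 ≤ a ≤ d - 1`) of the order on `Λ`. -/
inductive Lam.Basic (d : ℕ) : Lam d → Lam d → Prop
  | split (u v : Lam d) (a b : ℕ) (ha : 1 ≤ a) (hb : 1 ≤ b) (h : a + b ≤ d) :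
      Lam.Basic d (u * Lam.r (a + b) h * v)
        (u * (Lam.r a (by omega) * Lam.r b (by omega)) * v)
  | pair (u v : Lam d) (a b : ℕ) (ha : 1 ≤ a) (hb : 1 ≤ b) (h : a + b = d) :
      Lam.Basic d (u * v)
        (u * (Lam.r a (by omega) * Lam.inv d * Lam.r b (by omega)) * v)

/-- The minimal left and right invariant strict order on `Λ` with
`r_{a+b} < r_a r_b` and `1 < r_a r_d^{-1} r_{d-a}`. -/
def Lam.Lt {d : ℕ} (x y : Lam d) : Prop := Relation.TransGen (Lam.Basic d) x y

/-! ### The category `𝒰` -/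

/-- The generating morphisms of `𝒰`: the morphisms `φ_{a,b} : r_{a+b} → r_a r_b` and
`θ_{a,b} : r_a r_d^{-1} r_b → r_{a+b-d}`, and the canonical isomorphisms between different
expressions of the same element of `Λ`. Each of them may be tensored with an arbitrary word
`w` on the right, and (through `cons`) with arbitrary letters on the left. -/
inductive Step (d : ℕ) : Word d → Word d → Type
  | phi {n a b : ℕ} (hn : n ≤ d) (ha : a ≤ d) (hb : b ≤ d) (h : n = a + b) (w : Word d) :
      Step d (.r n hn :: w) (.r a ha :: .r b hb :: w)
  | theta {a b c : ℕ} (ha : a ≤ d) (hb : b ≤ d) (hc : c ≤ d) (h : a + b = d + c) (w : Word d) :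
      Step d (.r a ha :: .inv :: .r b hb :: w) (.r c hc :: w)
  | unit (w : Word d) : Step d (.r 0 d.zero_le :: w) w
  | unitInv (w : Word d) : Step d w (.r 0 d.zero_le :: w)
  | mulInv (w : Word d) : Step d (.r d le_rfl :: .inv :: w) w
  | mulInvInv (w : Word d) : Step d w (.r d le_rfl :: .inv :: w)
  | invMul (w : Word d) : Step d (.inv :: .r d le_rfl :: w) w
  | invMulInv (w : Word d) : Step d w (.inv :: .r d le_rfl :: w)
  | cons (x : Letter d) {u v : Word d} (s : Step d u v) : Step d (x :: u) (x :: v)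

instance (d : ℕ) : Quiver (Word d) := ⟨Step d⟩

/-- A generating morphism, as a morphism of the free category. -/
def Step.hom {d : ℕ} {u v : Word d} (s : Step d u v) :
    (Paths.of (Word d)).obj u ⟶ (Paths.of (Word d)).obj v :=
  (Paths.of (Word d)).map s

/-- Tensoring with a letter on the left, on the free category. -/
def consFunctor {d : ℕ} (x : Letter d) : Paths (Word d) ⥤ Paths (Word d) :=
  Paths.lift { obj := fun w => (Paths.of (Word d)).obj (x :: w)
               map := fun s => (Step.cons x s).hom }

open Step in
/-- The defining relations of `𝒰`. -/
inductive URel (d : ℕ) : HomRel (Paths (Word d))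
  -- coassociativity of `φ`
  | phi_phi {n a b c p q : ℕ} (hn : n ≤ d) (ha : a ≤ d) (hb : b ≤ d) (hc : c ≤ d) (hp : p ≤ d)
      (hq : q ≤ d) (h₁ : n = a + q) (h₂ : q = b + c) (h₃ : n = p + c) (h₄ : p = a + b)
      (w : Word d) :
      URel d ((phi hn ha hq h₁ w).hom ≫ (cons (.r a ha) (phi hq hb hc h₂ w)).hom)
        ((phi hn hp hc h₃ w).hom ≫ (phi hp ha hb h₄ (.r c hc :: w)).hom)
  -- associativity of `θ`
  | theta_theta {a b c e m q : ℕ} (ha : a ≤ d) (hb : b ≤ d) (hc : c ≤ d) (he : e ≤ d)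
      (hm : m ≤ d) (hq : q ≤ d) (h₁ : a + b = d + e) (h₂ : e + c = d + m) (h₃ : b + c = d + q)
      (h₄ : a + q = d + m) (w : Word d) :
      URel d ((theta ha hb he h₁ (.inv :: .r c hc :: w)).hom ≫ (theta he hc hm h₂ w).hom)
        ((cons (.r a ha) (cons .inv (theta hb hc hq h₃ w))).hom ≫ (theta ha hq hm h₄ w).hom)
  -- compatibility of `φ` and `θ`, on the left
  | phi_theta {n a b c e f : ℕ} (hn : n ≤ d) (ha : a ≤ d) (hb : b ≤ d) (hc : c ≤ d) (he : e ≤ d)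
      (hf : f ≤ d) (h₁ : n = a + b) (h₂ : b + c = d + e) (h₃ : n + c = d + f) (h₄ : f = a + e)
      (w : Word d) :
      URel d ((phi hn ha hb h₁ (.inv :: .r c hc :: w)).hom ≫
          (cons (.r a ha) (theta hb hc he h₂ w)).hom)
        ((theta hn hc hf h₃ w).hom ≫ (phi hf ha he h₄ w).hom)
  -- compatibility of `φ` and `θ`, on the right
  | theta_phi {n a b c e f : ℕ} (hn : n ≤ d) (ha : a ≤ d) (hb : b ≤ d) (hc : c ≤ d) (he : e ≤ d)
      (hf : f ≤ d) (h₁ : n = b + c) (h₂ : a + b = d + e) (h₃ : a + n = d + f) (h₄ : f = e + c)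
      (w : Word d) :
      URel d ((cons (.r a ha) (cons .inv (phi hn hb hc h₁ w))).hom ≫
          (theta ha hb he h₂ (.r c hc :: w)).hom)
        ((theta ha hn hf h₃ w).hom ≫ (phi hf he hc h₄ w).hom)
  -- the degenerate cases of `φ` and `θ` are the canonical isomorphisms
  | phi_zero_left {a : ℕ} (ha : a ≤ d) (h : a = 0 + a) (w : Word d) :
      URel d (phi ha d.zero_le ha h w).hom (unitInv (.r a ha :: w)).hom
  | phi_zero_right {a : ℕ} (ha : a ≤ d) (h : a = a + 0) (w : Word d) :
      URel d (phi ha ha d.zero_le h w).hom (cons (.r a ha) (unitInv w)).hom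
  | theta_top_left {a : ℕ} (ha : a ≤ d) (h : d + a = d + a) (w : Word d) :
      URel d (theta le_rfl ha ha h w).hom (mulInv (.r a ha :: w)).hom
  | theta_top_right {a : ℕ} (ha : a ≤ d) (h : a + d = d + a) (w : Word d) :
      URel d (theta ha le_rfl ha h w).hom (cons (.r a ha) (invMul w)).hom
  -- the canonical isomorphisms are mutually inverse
  | unit_hom_inv (w : Word d) : URel d ((unit w).hom ≫ (unitInv w).hom) (𝟙 _)
  | unit_inv_hom (w : Word d) : URel d ((unitInv w).hom ≫ (unit w).hom) (𝟙 _)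
  | mulInv_hom_inv (w : Word d) : URel d ((mulInv w).hom ≫ (mulInvInv w).hom) (𝟙 _)
  | mulInv_inv_hom (w : Word d) : URel d ((mulInvInv w).hom ≫ (mulInv w).hom) (𝟙 _)
  | invMul_hom_inv (w : Word d) : URel d ((invMul w).hom ≫ (invMulInv w).hom) (𝟙 _)
  | invMul_inv_hom (w : Word d) : URel d ((invMulInv w).hom ≫ (invMul w).hom) (𝟙 _)
  -- the two ways to cancel in `r_d r_d^{-1} r_d` and in `r_d^{-1} r_d r_d^{-1}` agree
  | triangle (w : Word d) :
      URel d (mulInv (.r d le_rfl :: w)).hom (cons (.r d le_rfl) (invMul w)).hom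
  | triangle' (w : Word d) :
      URel d (invMul (.inv :: w)).hom (cons .inv (mulInv w)).hom
  -- the tensor product is a bifunctor: morphisms in disjoint places commute
  | phi_nat {n a b : ℕ} (hn : n ≤ d) (ha : a ≤ d) (hb : b ≤ d) (h : n = a + b) {w w' : Word d}
      (s : Step d w w') :
      URel d ((phi hn ha hb h w).hom ≫ (cons (.r a ha) (cons (.r b hb) s)).hom)
        ((cons (.r n hn) s).hom ≫ (phi hn ha hb h w').hom)
  | theta_nat {a b c : ℕ} (ha : a ≤ d) (hb : b ≤ d) (hc : c ≤ d) (h : a + b = d + c)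
      {w w' : Word d} (s : Step d w w') :
      URel d ((theta ha hb hc h w).hom ≫ (cons (.r c hc) s).hom)
        ((cons (.r a ha) (cons .inv (cons (.r b hb) s))).hom ≫ (theta ha hb hc h w').hom)
  | unit_nat {w w' : Word d} (s : Step d w w') :
      URel d ((unit w).hom ≫ s.hom) ((cons (.r 0 d.zero_le) s).hom ≫ (unit w').hom)
  | mulInv_nat {w w' : Word d} (s : Step d w w') :
      URel d ((mulInv w).hom ≫ s.hom)
        ((cons (.r d le_rfl) (cons .inv s)).hom ≫ (mulInv w').hom)
  | invMul_nat {w w' : Word d} (s : Step d w w') :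
      URel d ((invMul w).hom ≫ s.hom)
        ((cons .inv (cons (.r d le_rfl) s)).hom ≫ (invMul w').hom)
  -- tensoring a relation with a letter on the left gives a relation
  | cons (x : Letter d) {u v : Paths (Word d)} {p q : u ⟶ v} (h : URel d p q) :
      URel d ((consFunctor x).map p) ((consFunctor x).map q)

/-- The category `𝒰`, with the expressions of the elements of `Λ` as objects; different
expressions of one element of `Λ` are canonically isomorphic objects. -/
abbrev U (d : ℕ) : Type := CategoryTheory.Quotient (URel d)

/-- The element `λ ∈ Λ` that is expressed by an object of `𝒰`. -/
def U.toLam {d : ℕ} (X : U d) : Lam d := Word.toLam X.as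

/-- Every element of `Λ` has an expression. -/
theorem U.toLam_surjective (d : ℕ) : Function.Surjective (U.toLam (d := d)) := by
  intro l
  obtain ⟨w, rfl⟩ := Con.mk'_surjective l
  exact ⟨⟨FreeMonoid.toList w⟩, rfl⟩

/-! ### The functor `M : 𝒰 → Vect` -/

section functor

/-- The vector space `R_a` for the letter `r_a`, and `R_d^{-1} = R_d^*` for `r_d^{-1}`. -/
def letterObj (R : Submodule k (V ⊗[k] V)) {d : ℕ} : Letter d → ModuleCat.{u} k
  | .r a _ => ModuleCat.of k (Rpow R a)
  | .inv => ModuleCat.of k (Module.Dual k (Rpow R d))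

/-- `M` on objects: the tensor product of the spaces of the letters. -/
def wordObj (R : Submodule k (V ⊗[k] V)) {d : ℕ} : Word d → ModuleCat.{u} k
  | [] => ModuleCat.of k k
  | x :: w => ModuleCat.of k (letterObj R x ⊗[k] wordObj R w)

/-- The map `φ ⊗ W : R_n ⊗ W → R_a ⊗ R_b ⊗ W`. -/
def phiMap (R : Submodule k (V ⊗[k] V)) {n a b : ℕ} (h : n = a + b) (W : Type u) [AddCommGroup W]
    [Module k W] : Rpow R n ⊗[k] W →ₗ[k] Rpow R a ⊗[k] (Rpow R b ⊗[k] W) :=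
  (TensorProduct.assoc k _ _ _).toLinearMap ∘ₗ (comul R h).rTensor W

/-- The isomorphism `R_0 ⊗ W ≅ W`. -/
def unitEquiv (R : Submodule k (V ⊗[k] V)) (W : Type u) [AddCommGroup W] [Module k W] :
    Rpow R 0 ⊗[k] W ≃ₗ[k] W :=
  TensorProduct.congr (rZero R).symm (.refl k W) ≪≫ₗ TensorProduct.lid k W

/-- The map `X ⊗ Y ⊗ Z ⊗ W → T ⊗ W` given by a trilinear map `X × Y × Z → T`. -/
def triMap {X Y Z T : Type u} [AddCommGroup X] [Module k X] [AddCommGroup Y] [Module k Y]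
    [AddCommGroup Z] [Module k Z] [AddCommGroup T] [Module k T]
    (F : X →ₗ[k] Y →ₗ[k] Z →ₗ[k] T) (W : Type u) [AddCommGroup W] [Module k W] :
    X ⊗[k] (Y ⊗[k] (Z ⊗[k] W)) →ₗ[k] T ⊗[k] W :=
  (TensorProduct.lift (TensorProduct.uncurry (.id k) Y Z T ∘ₗ F)).rTensor W ∘ₗ
    (TensorProduct.assoc k X (Y ⊗[k] Z) W).symm.toLinearMap ∘ₗ
      (TensorProduct.assoc k Y Z W).symm.toLinearMap.lTensor X

/-- The isomorphism `X ⊗ Y ⊗ W ≅ W` given by an isomorphism `X ⊗ Y ≅ k`. -/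
def cancelEquiv {X Y : Type u} [AddCommGroup X] [Module k X] [AddCommGroup Y] [Module k Y]
    (e : X ⊗[k] Y ≃ₗ[k] k) (W : Type u) [AddCommGroup W] [Module k W] :
    X ⊗[k] (Y ⊗[k] W) ≃ₗ[k] W :=
  (TensorProduct.assoc k X Y W).symm ≪≫ₗ TensorProduct.congr e (.refl k W) ≪≫ₗ
    TensorProduct.lid k W

variable {R : Submodule k (V ⊗[k] V)} {d : ℕ} (hp : IsPerfect R d)

/-- `M` on the generating morphisms. -/
def stepMap : {u v : Word d} → Step d u v → (wordObj R u →ₗ[k] wordObj R v)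
  | _, _, .phi _ _ _ h w => phiMap R h (wordObj R w)
  | _, _, .theta ha _ _ h w => triMap (thetaLin hp ha h) (wordObj R w)
  | _, _, .unit w => (unitEquiv R (wordObj R w)).toLinearMap
  | _, _, .unitInv w => (unitEquiv R (wordObj R w)).symm.toLinearMap
  | _, _, .mulInv w => (cancelEquiv (TensorProduct.comm k _ _ ≪≫ₗ evalEquiv hp)
      (wordObj R w)).toLinearMap
  | _, _, .mulInvInv w => (cancelEquiv (TensorProduct.comm k _ _ ≪≫ₗ evalEquiv hp)
      (wordObj R w)).symm.toLinearMap
  | _, _, .invMul w => (cancelEquiv (evalEquiv hp) (wordObj R w)).toLinearMap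
  | _, _, .invMulInv w => (cancelEquiv (evalEquiv hp) (wordObj R w)).symm.toLinearMap
  | _, _, .cons x s => (stepMap s).lTensor (letterObj R x)

/-- `M` on the free category on the generating morphisms. -/
def pathFunctor : Paths (Word d) ⥤ ModuleCat.{u} k :=
  Paths.lift { obj := wordObj R, map := fun s => ModuleCat.ofHom (stepMap hp s) }

theorem pathFunctor_hom {u v : Word d} (s : Step d u v) :
    (pathFunctor hp).map s.hom = ModuleCat.ofHom (stepMap hp s) := by
  exact Paths.lift_toPath _ _

end functor

section respects

@[simp]
theorem phiMap_tmul (R : Submodule k (V ⊗[k] V)) {n a b : ℕ} (h : n = a + b) (W : Type u)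
    [AddCommGroup W] [Module k W] (x : Rpow R n) (w : W) :
    phiMap R h W (x ⊗ₜ w) = TensorProduct.assoc k _ _ _ (comul R h x ⊗ₜ w) := rfl

@[simp]
theorem triMap_tmul {X Y Z T : Type u} [AddCommGroup X] [Module k X] [AddCommGroup Y] [Module k Y]
    [AddCommGroup Z] [Module k Z] [AddCommGroup T] [Module k T]
    (F : X →ₗ[k] Y →ₗ[k] Z →ₗ[k] T) (W : Type u) [AddCommGroup W] [Module k W]
    (x : X) (y : Y) (z : Z) (w : W) :
    triMap F W (x ⊗ₜ (y ⊗ₜ (z ⊗ₜ w))) = F x y z ⊗ₜ w := by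
  simp [triMap]

@[simp]
theorem cancelEquiv_tmul {X Y : Type u} [AddCommGroup X] [Module k X] [AddCommGroup Y]
    [Module k Y] (e : X ⊗[k] Y ≃ₗ[k] k) (W : Type u) [AddCommGroup W] [Module k W]
    (x : X) (y : Y) (w : W) : cancelEquiv e W (x ⊗ₜ (y ⊗ₜ w)) = e (x ⊗ₜ y) • w := by
  simp [cancelEquiv]

@[simp]
theorem evalEquiv_tmul {R : Submodule k (V ⊗[k] V)} {d : ℕ} (hp : IsPerfect R d)
    (ψ : Module.Dual k (Rpow R d)) (x : Rpow R d) : evalEquiv hp (ψ ⊗ₜ x) = ψ x :=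
  contractLeft_apply _ _

variable (W W' : Type u) [AddCommGroup W] [Module k W] [AddCommGroup W'] [Module k W']

theorem phiMap_phiMap (R : Submodule k (V ⊗[k] V)) {n a b c p q : ℕ} (h₁ : n = a + q)
    (h₂ : q = b + c) (h₃ : n = p + c) (h₄ : p = a + b) :
    (phiMap R h₂ W).lTensor (Rpow R a) ∘ₗ phiMap R h₁ W =
      phiMap R h₄ (Rpow R c ⊗[k] W) ∘ₗ phiMap R h₃ W := by
  let A : (Rpow R a ⊗[k] (Rpow R b ⊗[k] Rpow R c)) ⊗[k] W →ₗ[k]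
      Rpow R a ⊗[k] (Rpow R b ⊗[k] (Rpow R c ⊗[k] W)) :=
    (TensorProduct.assoc k _ _ _).toLinearMap.lTensor _ ∘ₗ
      (TensorProduct.assoc k _ _ _).toLinearMap
  ext x w
  have e₁ : ∀ t : Rpow R a ⊗[k] Rpow R q, (phiMap R h₂ W).lTensor (Rpow R a)
      (TensorProduct.assoc k _ _ _ (t ⊗ₜ w)) = A ((comul R h₂).lTensor _ t ⊗ₜ w) := by
    intro t
    induction t using TensorProduct.induction_on with
    | zero => simp
    | tmul x y => simp [A]
    | add s t hs ht => simp only [TensorProduct.add_tmul, map_add, hs, ht]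
  have e₃ : ∀ (s : Rpow R a ⊗[k] Rpow R b) (z : Rpow R c),
      TensorProduct.assoc k _ _ _ (s ⊗ₜ[k] (z ⊗ₜ[k] w)) =
        A (TensorProduct.assoc k _ _ _ (s ⊗ₜ z) ⊗ₜ w) := by
    intro s z
    induction s using TensorProduct.induction_on with
    | zero => simp
    | tmul x y => simp [A]
    | add s t hs ht => simp only [TensorProduct.add_tmul, map_add, hs, ht]
  have e₂ : ∀ t : Rpow R p ⊗[k] Rpow R c, phiMap R h₄ (Rpow R c ⊗[k] W)
      (TensorProduct.assoc k _ _ _ (t ⊗ₜ w)) =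
        A (TensorProduct.assoc k _ _ _ ((comul R h₄).rTensor _ t) ⊗ₜ w) := by
    intro t
    induction t using TensorProduct.induction_on with
    | zero => simp
    | tmul x y => rw [TensorProduct.assoc_tmul, phiMap_tmul, e₃, LinearMap.rTensor_tmul]
    | add s t hs ht => simp only [TensorProduct.add_tmul, map_add, hs, ht]
  simp only [TensorProduct.AlgebraTensorModule.curry_apply, LinearMap.restrictScalars_self,
    TensorProduct.curry_apply, LinearMap.comp_apply, phiMap_tmul]
  rw [e₁, e₂, comul_coassoc R h₁ h₂ h₃ h₄]

variable {R : Submodule k (V ⊗[k] V)} {d : ℕ} (hp : IsPerfect R d)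

theorem triMap_triMap {a b c e m q : ℕ} (ha : a ≤ d) (hb : b ≤ d) (he : e ≤ d)
    (h₁ : a + b = d + e) (h₂ : e + c = d + m) (h₃ : b + c = d + q) (h₄ : a + q = d + m) :
    triMap (thetaLin hp he h₂) W ∘ₗ triMap (thetaLin hp ha h₁)
        (Module.Dual k (Rpow R d) ⊗[k] (Rpow R c ⊗[k] W)) =
      triMap (thetaLin hp ha h₄) W ∘ₗ
        ((triMap (thetaLin hp hb h₃) W).lTensor _).lTensor _ := by
  ext x ψ y χ z w
  simp [theta_theta hp ha hb he h₁ h₂ h₃ h₄]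

theorem triMap_phiMap_left {n a b c e f : ℕ} (hn : n ≤ d) (hb : b ≤ d) (h₁ : n = a + b)
    (h₂ : b + c = d + e) (h₃ : n + c = d + f) (h₄ : f = a + e) :
    (triMap (thetaLin hp hb h₂) W).lTensor (Rpow R a) ∘ₗ
        phiMap R h₁ (Module.Dual k (Rpow R d) ⊗[k] (Rpow R c ⊗[k] W)) =
      phiMap R h₄ W ∘ₗ triMap (thetaLin hp hn h₃) W := by
  ext x ψ z w
  have e₁ : ∀ t : Rpow R a ⊗[k] Rpow R b, (triMap (thetaLin hp hb h₂) W).lTensor (Rpow R a)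
      (TensorProduct.assoc k _ _ _ (t ⊗ₜ[k] (ψ ⊗ₜ[k] (z ⊗ₜ[k] w)))) =
        TensorProduct.assoc k _ _ _
          ((((thetaLin hp hb h₂).flip ψ).flip z).lTensor _ t ⊗ₜ[k] w) := by
    intro t
    induction t using TensorProduct.induction_on with
    | zero => simp
    | tmul x y => simp
    | add s t hs ht => simp only [TensorProduct.add_tmul, map_add, hs, ht]
  simp only [TensorProduct.AlgebraTensorModule.curry_apply, LinearMap.restrictScalars_self,
    TensorProduct.curry_apply, LinearMap.comp_apply, phiMap_tmul, triMap_tmul]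
  rw [e₁, comul_theta_left hp hn h₁ hb h₂ h₃ h₄]

theorem triMap_phiMap_right {n a b c e f : ℕ} (ha : a ≤ d) (h₁ : n = b + c)
    (h₂ : a + b = d + e) (h₃ : a + n = d + f) (h₄ : f = e + c) :
    triMap (thetaLin hp ha h₂) (Rpow R c ⊗[k] W) ∘ₗ ((phiMap R h₁ W).lTensor _).lTensor _ =
      phiMap R h₄ W ∘ₗ triMap (thetaLin hp ha h₃) W := by
  ext x ψ z w
  have e₁ : ∀ t : Rpow R b ⊗[k] Rpow R c, triMap (thetaLin hp ha h₂) (Rpow R c ⊗[k] W)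
      (x ⊗ₜ[k] (ψ ⊗ₜ[k] (TensorProduct.assoc k _ _ _ (t ⊗ₜ[k] w)))) =
        TensorProduct.assoc k _ _ _ ((thetaLin hp ha h₂ x ψ).rTensor _ t ⊗ₜ[k] w) := by
    intro t
    induction t using TensorProduct.induction_on with
    | zero => simp
    | tmul x y => simp
    | add s t hs ht => simp only [TensorProduct.add_tmul, TensorProduct.tmul_add, map_add, hs, ht]
  simp only [TensorProduct.AlgebraTensorModule.curry_apply, LinearMap.restrictScalars_self,
    TensorProduct.curry_apply, LinearMap.comp_apply, phiMap_tmul, triMap_tmul,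
    LinearMap.lTensor_tmul]
  rw [e₁, comul_theta_right hp ha h₃ c h₁ h₄ h₂]

theorem phiMap_nat {n a b : ℕ} (h : n = a + b) (f : W →ₗ[k] W') :
    (f.lTensor (Rpow R b)).lTensor (Rpow R a) ∘ₗ phiMap R h W =
      phiMap R h W' ∘ₗ f.lTensor (Rpow R n) := by
  ext x w
  have e₁ : ∀ t : Rpow R a ⊗[k] Rpow R b, (f.lTensor (Rpow R b)).lTensor (Rpow R a)
      (TensorProduct.assoc k _ _ _ (t ⊗ₜ[k] w)) = TensorProduct.assoc k _ _ _ (t ⊗ₜ[k] f w) := by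
    intro t
    induction t using TensorProduct.induction_on with
    | zero => simp
    | tmul x y => simp
    | add s t hs ht => simp only [TensorProduct.add_tmul, map_add, hs, ht]
  exact e₁ _

theorem cancelEquiv_nat {X Y : Type u} [AddCommGroup X] [Module k X] [AddCommGroup Y]
    [Module k Y] (e : X ⊗[k] Y ≃ₗ[k] k) (f : W →ₗ[k] W') :
    f ∘ₗ (cancelEquiv e W).toLinearMap =
      (cancelEquiv e W').toLinearMap ∘ₗ (f.lTensor Y).lTensor X := by
  ext x y w
  simp

theorem unitEquiv_nat (f : W →ₗ[k] W') :
    f ∘ₗ (unitEquiv R W).toLinearMap =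
      (unitEquiv R W').toLinearMap ∘ₗ f.lTensor (Rpow R 0) := by
  ext x w
  simp [unitEquiv]

theorem triMap_nat {X Y Z T : Type u} [AddCommGroup X] [Module k X] [AddCommGroup Y] [Module k Y]
    [AddCommGroup Z] [Module k Z] [AddCommGroup T] [Module k T]
    (F : X →ₗ[k] Y →ₗ[k] Z →ₗ[k] T) (f : W →ₗ[k] W') :
    f.lTensor T ∘ₗ triMap F W =
      triMap F W' ∘ₗ ((f.lTensor Z).lTensor Y).lTensor X := by
  ext x y z w
  simp

theorem unitEquiv_symm (w : W) : (unitEquiv R W).symm w = rZero R 1 ⊗ₜ w := by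
  rw [LinearEquiv.symm_apply_eq]
  simp [unitEquiv]

theorem phiMap_zero_left {a : ℕ} (h : a = 0 + a) :
    phiMap R h W = (unitEquiv R (Rpow R a ⊗[k] W)).symm.toLinearMap := by
  ext x w
  simp only [TensorProduct.AlgebraTensorModule.curry_apply, LinearMap.restrictScalars_self,
    TensorProduct.curry_apply, phiMap_tmul, comul_zero_left, TensorProduct.assoc_tmul]
  exact (unitEquiv_symm (R := R) _ (x ⊗ₜ[k] w)).symm

theorem phiMap_zero_right {a : ℕ} (h : a = a + 0) :
    phiMap R h W = (unitEquiv R W).symm.toLinearMap.lTensor (Rpow R a) := by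
  ext x w
  simp [comul_zero_right, unitEquiv_symm]

theorem triMap_top_left {a : ℕ} (h : d + a = d + a) :
    triMap (thetaLin hp le_rfl h) W =
      (cancelEquiv (TensorProduct.comm k _ _ ≪≫ₗ evalEquiv hp)
        (Rpow R a ⊗[k] W)).toLinearMap := by
  ext x ψ y w
  simp [theta_left_top, TensorProduct.smul_tmul']

theorem triMap_top_right {a : ℕ} (ha : a ≤ d) (h : a + d = d + a) :
    triMap (thetaLin hp ha h) W =
      (cancelEquiv (evalEquiv hp) W).toLinearMap.lTensor (Rpow R a) := by
  ext x ψ y w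
  simp [theta_right_top, TensorProduct.smul_tmul]

theorem cancel_triangle :
    (cancelEquiv (TensorProduct.comm k _ _ ≪≫ₗ evalEquiv hp) (Rpow R d ⊗[k] W)).toLinearMap =
      (cancelEquiv (evalEquiv hp) W).toLinearMap.lTensor (Rpow R d) := by
  rw [← triMap_top_left W hp rfl, triMap_top_right]

theorem cancel_triangle' :
    (cancelEquiv (evalEquiv hp) (Module.Dual k (Rpow R d) ⊗[k] W)).toLinearMap =
      (cancelEquiv (TensorProduct.comm k _ _ ≪≫ₗ evalEquiv hp) W).toLinearMap.lTensor
        (Module.Dual k (Rpow R d)) := by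
  ext ψ x χ w
  have h : ψ x • χ = χ x • ψ := by
    ext y
    have := smul_comm_of_perfect hp ψ χ x y
    simp only [smul_eq_mul] at this
    simp only [LinearMap.smul_apply, smul_eq_mul, this, mul_comm]
  simp [TensorProduct.smul_tmul', h]

/-- `M`, on the free category, is compatible with tensoring with a letter on the left. -/
theorem pathFunctor_consFunctor (x : Letter d) {u v : Paths (Word d)} (p : u ⟶ v) :
    (pathFunctor hp).map ((consFunctor x).map p) =
      ModuleCat.ofHom (((pathFunctor hp).map p).hom.lTensor (letterObj R x)) := by
  induction p using Paths.induction with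
  | id =>
    refine ((pathFunctor hp).map_id _).trans ?_
    refine ModuleCat.hom_ext ?_
    exact (LinearMap.lTensor_id _ _).symm
  | comp p s ih =>
    have h₁ : (consFunctor x).map (p ≫ (Paths.of _).map s) =
        (consFunctor x).map p ≫ (Step.cons x s).hom := Paths.lift_cons _ p s
    have h₂ : (pathFunctor hp).map (p ≫ (Paths.of _).map s) =
        (pathFunctor hp).map p ≫ ModuleCat.ofHom (stepMap hp s) := Paths.lift_cons _ p s
    refine (congrArg (pathFunctor hp).map h₁).trans
      (((pathFunctor hp).map_comp ((consFunctor x).map p) (Step.cons x s).hom).trans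
        ((congrArg₂ (· ≫ ·) ih (pathFunctor_hom hp (Step.cons x s))).trans
          (Eq.trans ?_ (congrArg (fun f => ModuleCat.ofHom
            ((ModuleCat.Hom.hom f).lTensor (letterObj R x))) h₂.symm))))
    exact ModuleCat.hom_ext (LinearMap.lTensor_comp (letterObj R x) _ _).symm

theorem pathFunctor_respects {u v : Paths (Word d)} (p q : u ⟶ v) (h : URel d p q) :
    (pathFunctor hp).map p = (pathFunctor hp).map q := by
  induction h with
  | phi_phi hn ha hb hc hp' hq h₁ h₂ h₃ h₄ w =>
    simp only [Functor.map_comp, pathFunctor_hom]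
    exact ModuleCat.hom_ext (phiMap_phiMap _ R h₁ h₂ h₃ h₄)
  | theta_theta ha hb hc he hm hq h₁ h₂ h₃ h₄ w =>
    simp only [Functor.map_comp, pathFunctor_hom]
    exact ModuleCat.hom_ext (triMap_triMap _ hp ha hb he h₁ h₂ h₃ h₄)
  | phi_theta hn ha hb hc he hf h₁ h₂ h₃ h₄ w =>
    simp only [Functor.map_comp, pathFunctor_hom]
    exact ModuleCat.hom_ext (triMap_phiMap_left _ hp hn hb h₁ h₂ h₃ h₄)
  | theta_phi hn ha hb hc he hf h₁ h₂ h₃ h₄ w =>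
    simp only [Functor.map_comp, pathFunctor_hom]
    exact ModuleCat.hom_ext (triMap_phiMap_right _ hp ha h₁ h₂ h₃ h₄)
  | phi_zero_left ha h w =>
    simp only [pathFunctor_hom]
    exact ModuleCat.hom_ext (phiMap_zero_left _ h)
  | phi_zero_right ha h w =>
    simp only [pathFunctor_hom]
    exact ModuleCat.hom_ext (phiMap_zero_right _ h)
  | theta_top_left ha h w =>
    simp only [pathFunctor_hom]
    exact ModuleCat.hom_ext (triMap_top_left _ hp h)
  | theta_top_right ha h w =>
    simp only [pathFunctor_hom]
    exact ModuleCat.hom_ext (triMap_top_right _ hp ha h)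
  | unit_hom_inv w =>
    simp only [Functor.map_comp, pathFunctor_hom]
    exact ModuleCat.hom_ext (LinearEquiv.symm_comp _)
  | unit_inv_hom w =>
    simp only [Functor.map_comp, pathFunctor_hom]
    exact ModuleCat.hom_ext (LinearEquiv.comp_symm _)
  | mulInv_hom_inv w =>
    simp only [Functor.map_comp, pathFunctor_hom]
    exact ModuleCat.hom_ext (LinearEquiv.symm_comp _)
  | mulInv_inv_hom w =>
    simp only [Functor.map_comp, pathFunctor_hom]
    exact ModuleCat.hom_ext (LinearEquiv.comp_symm _)
  | invMul_hom_inv w =>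
    simp only [Functor.map_comp, pathFunctor_hom]
    exact ModuleCat.hom_ext (LinearEquiv.symm_comp _)
  | invMul_inv_hom w =>
    simp only [Functor.map_comp, pathFunctor_hom]
    exact ModuleCat.hom_ext (LinearEquiv.comp_symm _)
  | triangle w =>
    simp only [pathFunctor_hom]
    exact ModuleCat.hom_ext (cancel_triangle _ hp)
  | triangle' w =>
    simp only [pathFunctor_hom]
    exact ModuleCat.hom_ext (cancel_triangle' _ hp)
  | phi_nat hn ha hb h s =>
    simp only [Functor.map_comp, pathFunctor_hom]
    exact ModuleCat.hom_ext (phiMap_nat _ _ h _)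
  | theta_nat ha hb hc h s =>
    simp only [Functor.map_comp, pathFunctor_hom]
    exact ModuleCat.hom_ext (triMap_nat _ _ _ _)
  | unit_nat s =>
    simp only [Functor.map_comp, pathFunctor_hom]
    exact ModuleCat.hom_ext (unitEquiv_nat _ _ _)
  | mulInv_nat s =>
    simp only [Functor.map_comp, pathFunctor_hom]
    exact ModuleCat.hom_ext (cancelEquiv_nat _ _ _ _)
  | invMul_nat s =>
    simp only [Functor.map_comp, pathFunctor_hom]
    exact ModuleCat.hom_ext (cancelEquiv_nat _ _ _ _)
  | cons x h ih =>
    rw [pathFunctor_consFunctor, pathFunctor_consFunctor, ih]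

end respects

section standard

variable {R : Submodule k (V ⊗[k] V)} {d : ℕ} (hp : IsPerfect R d)

/-- The functor `M : 𝒰 → Vect`. On objects it is the tensor product of the spaces `R_a` and
`R_d^{-1}` of the letters; `φ_{a,b}` goes to the inclusion `R_{a+b} ⊆ R_a ⊗ R_b`, `θ_{a,b}` goes
to the contraction `R_a ⊗ R_d^{-1} ⊗ R_b → R_{a+b-d}`. -/
def M : U d ⥤ ModuleCat.{u} k :=
  CategoryTheory.Quotient.lift (URel d) (pathFunctor hp)
    (fun _ _ p q h => pathFunctor_respects hp p q h)

/-- The sum of the images of `M(f)`, over all morphisms `f : μ → X` of `𝒰` with `μ < X`. -/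
def nablaKer (X : U d) : Submodule k ((M hp).obj X) :=
  ⨆ (Y : U d) (f : Y ⟶ X) (_ : Lam.Lt Y.toLam X.toLam), LinearMap.range ((M hp).map f).hom

/-- The costandard object `∇(λ) = coker (⨁_{μ → λ, μ < λ} M(μ) → M(λ))`. -/
abbrev Nabla (X : U d) : Type u := (M hp).obj X ⧸ nablaKer hp X

/-- The standard object `Δ(λ) = ker (M(λ) → ⨁_{λ → μ, μ < λ} M(μ))`. -/
def Delta (X : U d) : Submodule k ((M hp).obj X) :=
  ⨅ (Y : U d) (f : X ⟶ Y) (_ : Lam.Lt Y.toLam X.toLam), LinearMap.ker ((M hp).map f).hom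

/-- The composition `Δ(λ) ↪ M(λ) ↠ ∇(λ)`. -/
def deltaToNabla (X : U d) : Delta hp X →ₗ[k] Nabla hp X :=
  (nablaKer hp X).mkQ ∘ₗ (Delta hp X).subtype

/-- `L(λ)`, the image of `Δ(λ) → M(λ) → ∇(λ)`. -/
def L (X : U d) : Submodule k (Nabla hp X) := LinearMap.range (deltaToNabla hp X)

end standard

end KoszulASRegular

end

noncomputable section

namespace KoszulASRegular

/-! ### Computing `Ext` with an explicit resolution by projective modules -/

section resolution

variable {A : Type u} [Ring A] {X : ℕ → ModuleCat.{u} A} {Z : ModuleCat.{u} A}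

/-! Perfectness. A linear resolution of `k` is minimal. Reading its differentials inside `T(V)`
identifies its `n`-th term with `A ⊗ R_n`, with the inclusion `R_{n+1} ⊆ V ⊗ R_n` followed by
multiplication as differential (`gen_basis`). In lowest degree, `Ext^n(k, A) = 0` for `n ≠ d` then
says that a nonzero functional on `R_n` does not contract all of `R_{n+1} ⊆ V ⊗ R_n` to zero.
Iterating up to the line `R_d = kω`, contraction with `ω` embeds `R_b^*` in `R_a` whenever `a + b =
d`. Exchanging `a` and `b` shows that the dimensions agree (`isPerfect_of_linearResolution`).

Reduction. Fix `ω ∈ R_d` and `ψ ∈ R_d^*` with `ψ(ω) = 1`. If `d > 0`, a word has a normal form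
`r_d^{e₀} r_{a₁} r_d^{e₁} ⋯ r_{aₙ} r_d^{eₙ}` with `0 < aᵢ < d`, and `M(λ) ≅ R_{a₁} ⊗ ⋯ ⊗ R_{aₙ}`. On
these spaces every generating morphism becomes an identity, a splitting `φ` (which increases `n`) or
a contraction `θ` (which decreases `n`). By the relations of `𝒰` a `θ` can be moved before a `φ`
(`factors_comp`), so every `M(f)` is a composition of `θ`s followed by `φ`s. If `μ < λ` then `μ` has
smaller `n`. Hence an element `x` killed by all elementary `θ`s lies in `Δ(λ)`, and a functional `F`
that vanishes on the images of all elementary `φ`s vanishes on the kernel of `M(λ) → ∇(λ)`. It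
remains to find such `x` and `F` with `F x ≠ 0`; this is `Good`.

Construction. Letters are added on the left, by induction. At a junction `r_a r_d^e r_b` a `φ` can
only have arrived if `e = 0`, and a `θ` can only start if `e = -1`, so at most one of the two
conditions is active. If neither is, tensor products do. If `e = 0`, then `F` has to vanish on
`R_{a+b} ⊗ ⋯`. For this one carries along maps to `A` which start by letting the first letter act by
left multiplication: a product of two letters vanishes on `R_2 = R` (`leftGood_cons`). If `e = -1`,
the perfect pairings turn elements of `R_u` into functionals on `R_{d-u}` and `θ` into a reversed
inclusion, so the same argument applies to `x` with right multiplication (`rightGood_cons`). To keep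
these maps nonzero, `A` must not contain a nonzero element annihilated by `V` from the left or from
the right; this follows from `Hom(k, A) = 0` and from the injectivity of the last differential.
`Calculus` axiomatizes both sides at once, and `good_of_calculus` is the induction. -/

theorem comp_eq_zero_of_exact {M₁ M₂ M₃ : ModuleCat.{u} A} (f : M₁ ⟶ M₂) (g : M₂ ⟶ M₃)
    (h : Function.Exact f.hom g.hom) : f ≫ g = 0 :=
  ModuleCat.hom_ext (LinearMap.ext fun x => (h (f.hom x)).2 ⟨x, rfl⟩)

/-- The chain complex given by a long exact sequence. -/
abbrev complexOfExact (D : ∀ n, X (n + 1) ⟶ X n)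
    (hD : ∀ n, Function.Exact (D (n + 1)).hom (D n).hom) : ChainComplex (ModuleCat.{u} A) ℕ :=
  ChainComplex.of X D fun n => comp_eq_zero_of_exact _ _ (hD n)

theorem complexOfExact_d (D : ∀ n, X (n + 1) ⟶ X n)
    (hD : ∀ n, Function.Exact (D (n + 1)).hom (D n).hom) (n : ℕ) :
    (complexOfExact D hD).d (n + 1) n = D n :=
  ChainComplex.of_d X D n

/-- The projective resolution given by a long exact sequence of projective modules. -/
def resolutionOfExact [hX : ∀ n, Projective (X n)] (D : ∀ n, X (n + 1) ⟶ X n) (ε : X 0 ⟶ Z)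
    (hε : Function.Surjective ε.hom) (h₀ : Function.Exact (D 0).hom ε.hom)
    (hD : ∀ n, Function.Exact (D (n + 1)).hom (D n).hom) : ProjectiveResolution Z where
  complex := complexOfExact D hD
  projective n := hX n
  π := (ChainComplex.toSingle₀Equiv (complexOfExact D hD) Z).symm
    ⟨ε, (congrArg (· ≫ ε) (complexOfExact_d D hD 0)).trans (comp_eq_zero_of_exact _ _ h₀)⟩
  quasiIso := ⟨fun n => by
    cases n with
    | zero =>
      -- In degree zero the condition is that `X 1 ⟶ X 0 ⟶ Z` is exact with `ε` epi.
      rw [ChainComplex.quasiIsoAt₀_iff, ShortComplex.quasiIso_iff_of_zeros' _ rfl rfl rfl]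
      refine (ShortComplex.exact_and_epi_g_iff_of_iso
        (S₂ := ShortComplex.mk (D 0) ε (comp_eq_zero_of_exact _ _ h₀)) ?_).2
        ⟨(ShortComplex.ShortExact.moduleCat_exact_iff_function_exact _).2 h₀,
          (ModuleCat.epi_iff_surjective _).2 hε⟩
      refine ShortComplex.isoMk (Iso.refl _) (Iso.refl _) (Iso.refl _) ?_ ?_
      · exact (Category.id_comp _).trans
          ((complexOfExact_d D hD 0).symm.trans (Category.comp_id _).symm)
      · refine (Category.id_comp _).trans (Eq.trans ?_ (Category.comp_id _).symm)
        exact (ChainComplex.toSingle₀Equiv_symm_apply_f_zero (C := complexOfExact D hD) ε _).symm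
    | succ n =>
      rw [quasiIsoAt_iff_exactAt' (hL := ChainComplex.exactAt_succ_single_obj ..),
        HomologicalComplex.exactAt_iff' _ (n + 2) (n + 1) n (by simp) (by simp),
        ShortComplex.ShortExact.moduleCat_exact_iff_function_exact]
      have h₁ := complexOfExact_d D hD n
      have h₂ := complexOfExact_d D hD (n + 1)
      change Function.Exact ((complexOfExact D hD).d (n + 2) (n + 1)).hom
        ((complexOfExact D hD).d (n + 1) n).hom
      rw [h₁, h₂]
      exact hD n⟩

/-- If `Ext^{n+1}(Z, N)` is one-dimensional then two cocycles are linearly dependent modulo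
coboundaries. -/
theorem exists_linear_dependence_of_resolution {k : Type u} [Field k] [Algebra k A]
    (P : ProjectiveResolution Z) (N : ModuleCat.{u} A) (n : ℕ)
    (h : Module.finrank k (Abelian.Ext Z N (n + 1)) = 1) (f₁ f₂ : P.complex.X (n + 1) ⟶ N)
    (hf₁ : P.complex.d (n + 2) (n + 1) ≫ f₁ = 0) (hf₂ : P.complex.d (n + 2) (n + 1) ≫ f₂ = 0) :
    ∃ (c₁ c₂ : k) (g : P.complex.X n ⟶ N), (c₁ ≠ 0 ∨ c₂ ≠ 0) ∧
      P.complex.d (n + 1) n ≫ g = c₁ • f₁ + c₂ • f₂ := by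
  -- Scalars act on `Ext` through endomorphisms of `N`, so they can be moved onto the cocycles.
  have hs : ∀ (c : k) (f : P.complex.X (n + 1) ⟶ N) (hf : P.complex.d (n + 2) (n + 1) ≫ f = 0),
      c • P.extMk f (n + 2) rfl hf =
        P.extMk (c • f) (n + 2) rfl (by rw [Linear.comp_smul, hf, smul_zero]) := by
    intro c f hf
    rw [Abelian.Ext.smul_eq_comp_mk₀, ProjectiveResolution.extMk_comp_mk₀]
    congr 1
  obtain ⟨c₁, c₂, hc, h0⟩ : ∃ c₁ c₂ : k, (c₁ ≠ 0 ∨ c₂ ≠ 0) ∧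
      c₁ • P.extMk f₁ (n + 2) rfl hf₁ + c₂ • P.extMk f₂ (n + 2) rfl hf₂ = 0 := by
    obtain ⟨ω, -, hω⟩ := finrank_eq_one_iff'.1 h
    obtain ⟨a₁, h₁⟩ := hω (P.extMk f₁ (n + 2) rfl hf₁)
    obtain ⟨a₂, h₂⟩ := hω (P.extMk f₂ (n + 2) rfl hf₂)
    by_cases ha : a₁ = 0
    · exact ⟨1, 0, Or.inl one_ne_zero, by rw [← h₁, ha]; simp⟩
    · refine ⟨a₂, -a₁, Or.inr (neg_ne_zero.2 ha), ?_⟩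
      rw [← h₁, ← h₂, smul_smul, smul_smul, neg_mul, neg_smul, mul_comm, add_neg_cancel]
  rw [hs c₁ f₁ hf₁, hs c₂ f₂ hf₂, ProjectiveResolution.add_extMk,
    P.extMk_eq_zero_iff _ _ _ _ n rfl] at h0
  obtain ⟨g, hg⟩ := h0
  exact ⟨c₁, c₂, g, hc, hg⟩

/-- If `Ext^{n+1}(Z, N) = 0` then every cocycle is a coboundary. -/
theorem exists_lift_of_subsingleton_ext [∀ n, Projective (X n)]
    {D : ∀ n, X (n + 1) ⟶ X n} {ε : X 0 ⟶ Z}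
    (hε : Function.Surjective ε.hom) (h₀ : Function.Exact (D 0).hom ε.hom)
    (hD : ∀ n, Function.Exact (D (n + 1)).hom (D n).hom) (N : ModuleCat.{u} A) (n : ℕ)
    (h : Subsingleton (Abelian.Ext Z N (n + 1))) (f : X (n + 1) ⟶ N) (hf : D (n + 1) ≫ f = 0) :
    ∃ g : X n ⟶ N, D n ≫ g = f := by
  have hd : ∀ m, (resolutionOfExact D ε hε h₀ hD).complex.d (m + 1) m = D m :=
    complexOfExact_d D hD
  obtain ⟨g, hg⟩ := ((resolutionOfExact D ε hε h₀ hD).extMk_eq_zero_iff f (n + 2) rfl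
    ((congrArg (· ≫ f) (hd _)).trans hf) n rfl).1 (Subsingleton.elim _ _)
  exact ⟨g, (congrArg (· ≫ g) (hd n)).symm.trans hg⟩

/-- If `Ext^0(Z, N) = 0` then every cocycle in degree zero vanishes. -/
theorem eq_zero_of_subsingleton_ext_zero {D₀ : X 1 ⟶ X 0} {ε : X 0 ⟶ Z}
    (hε : Function.Surjective ε.hom) (h₀ : Function.Exact D₀.hom ε.hom) (N : ModuleCat.{u} A)
    (h : Subsingleton (Abelian.Ext Z N 0)) (f : X 0 ⟶ N) (hf : D₀ ≫ f = 0) : f = 0 := by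
  have hS := (ShortComplex.ShortExact.moduleCat_exact_iff_function_exact
    (ShortComplex.mk D₀ ε (comp_eq_zero_of_exact _ _ h₀))).2 h₀
  have : Epi ε := (ModuleCat.epi_iff_surjective _).2 hε
  obtain ⟨g, rfl⟩ := hS.desc' f hf
  have h₂ : g = 0 := Abelian.Ext.addEquiv₀.symm.injective (Subsingleton.elim _ _)
  rw [h₂]
  exact Limits.comp_zero

/-- Each class in `Ext^n` is represented by a cocycle on `X n`, and the zero cocycle represents
zero. -/
theorem exists_ne_zero_of_nontrivial_ext [∀ n, Projective (X n)]
    {D : ∀ n, X (n + 1) ⟶ X n} {ε : X 0 ⟶ Z}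
    (hε : Function.Surjective ε.hom) (h₀ : Function.Exact (D 0).hom ε.hom)
    (hD : ∀ n, Function.Exact (D (n + 1)).hom (D n).hom) (N : ModuleCat.{u} A) (n : ℕ)
    (h : Nontrivial (Abelian.Ext Z N n)) : ∃ f : X n ⟶ N, f ≠ 0 := by
  obtain ⟨x, hx⟩ := exists_ne (0 : Abelian.Ext Z N n)
  obtain ⟨f, hf, rfl⟩ := (resolutionOfExact D ε hε h₀ hD).extMk_surjective x (n + 1) rfl
  refine ⟨f, fun h => hx ?_⟩
  subst h
  exact ProjectiveResolution.extMk_zero ..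

/-- If `Ext^{n+1}(Z, N)` is one-dimensional then two cocycles are linearly dependent modulo
coboundaries. -/
theorem exists_linear_dependence {k : Type u} [Field k] [Algebra k A] [∀ n, Projective (X n)]
    {D : ∀ n, X (n + 1) ⟶ X n} {ε : X 0 ⟶ Z}
    (hε : Function.Surjective ε.hom) (h₀ : Function.Exact (D 0).hom ε.hom)
    (hD : ∀ n, Function.Exact (D (n + 1)).hom (D n).hom)
    (N : ModuleCat.{u} A) (n : ℕ)
    (h : Module.finrank k (Abelian.Ext Z N (n + 1)) = 1) (f₁ f₂ : X (n + 1) ⟶ N)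
    (hf₁ : D (n + 1) ≫ f₁ = 0) (hf₂ : D (n + 1) ≫ f₂ = 0) :
    ∃ (c₁ c₂ : k) (g : X n ⟶ N), (c₁ ≠ 0 ∨ c₂ ≠ 0) ∧ D n ≫ g = c₁ • f₁ + c₂ • f₂ := by
  have hd : ∀ m, (resolutionOfExact D ε hε h₀ hD).complex.d (m + 1) m = D m :=
    complexOfExact_d D hD
  obtain ⟨c₁, c₂, g, hc, hg⟩ := exists_linear_dependence_of_resolution (k := k)
    (resolutionOfExact D ε hε h₀ hD) N n h f₁ f₂ ((congrArg (· ≫ f₁) (hd _)).trans hf₁)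
    ((congrArg (· ≫ f₂) (hd _)).trans hf₂)
  exact ⟨c₁, c₂, g, hc, (congrArg (· ≫ g) (hd n)).symm.trans hg⟩

end resolution

/-! ### The components of degree at most two of the quadratic algebra -/

section lowDegree

variable {k : Type u} [Field k] {V : Type u} [AddCommGroup V] [Module k V]
  (R : Submodule k (V ⊗[k] V))

/-- The product `V ⊗ V → T(V)`. -/
def mulTwo (k : Type u) [Field k] (V : Type u) [AddCommGroup V] [Module k V] :
    V ⊗[k] V →ₗ[k] TensorAlgebra k V :=
  LinearMap.mul' k (TensorAlgebra k V) ∘ₗ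
    TensorProduct.map (TensorAlgebra.ι k) (TensorAlgebra.ι k)

@[simp]
theorem mulTwo_tmul (v w : V) :
    mulTwo k V (v ⊗ₜ w) = TensorAlgebra.ι k v * TensorAlgebra.ι k w := by
  simp [mulTwo]

/-- The quotient map `T(V) → A`. -/
def QuadAlg.mk : TensorAlgebra k V →ₐ[k] QuadAlg R := RingQuot.mkAlgHom k (AlgRel R)

theorem QuadAlg.mk_surjective : Function.Surjective (QuadAlg.mk R) :=
  RingQuot.mkAlgHom_surjective k _

theorem QuadAlg.mk_ι (v : V) : QuadAlg.mk R (TensorAlgebra.ι k v) = QuadAlg.ι R v := rfl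

theorem QuadAlg.mk_relations {x : TensorAlgebra k V} (hx : x ∈ relations R) :
    QuadAlg.mk R x = 0 := by
  have h : AlgRel R x 0 := ⟨hx, rfl⟩
  exact (RingQuot.mkAlgHom_rel k h).trans (map_zero _)

theorem QuadAlg.aug_mk (x : TensorAlgebra k V) :
    QuadAlg.aug R (QuadAlg.mk R x) = TensorAlgebra.algebraMapInv x :=
  RingQuot.liftAlgHom_mkAlgHom_apply ..

@[simp]
theorem QuadAlg.aug_ι (v : V) : QuadAlg.aug R (QuadAlg.ι R v) = 0 := by
  rw [← QuadAlg.mk_ι, QuadAlg.aug_mk]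
  simp [TensorAlgebra.algebraMapInv]

/-- The action of `v ∈ V` on the truncation `k ⊕ V ⊕ (V ⊗ V) / R` of `A`. -/
def truncAct : V →ₗ[k] Module.End k (k × V × ((V ⊗[k] V) ⧸ R)) :=
  LinearMap.mk₂ k (fun v n => (0, n.1 • v, R.mkQ (v ⊗ₜ n.2.1)))
    (fun v w n => by simp [TensorProduct.add_tmul])
    (fun c v n => by
      refine Prod.ext (smul_zero c).symm (Prod.ext (smul_comm _ _ _) ?_)
      simp only [← TensorProduct.smul_tmul', map_smul, Prod.smul_snd])
    (fun v n m => by simp [add_smul, TensorProduct.tmul_add])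
    (fun c v n => by simp [mul_smul])

/-- The action of `A` on its truncation `k ⊕ V ⊕ (V ⊗ V) / R`. -/
def trunc : QuadAlg R →ₐ[k] Module.End k (k × V × ((V ⊗[k] V) ⧸ R)) :=
  RingQuot.liftAlgHom k ⟨TensorAlgebra.lift k (truncAct R), by
    rintro x y ⟨⟨t, ht, rfl⟩, rfl⟩
    rw [map_zero]
    have : ∀ s : V ⊗[k] V, TensorAlgebra.lift k (truncAct R) (mulTwo k V s) =
        LinearMap.toSpanSingleton k _ (0, 0, R.mkQ s) ∘ₗ LinearMap.fst k k _ := by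
      intro s
      induction s using TensorProduct.induction_on with
      | zero => ext <;> simp
      | tmul v w => ext <;> simp [truncAct]
      | add s t hs ht => rw [map_add, map_add, hs, ht]; ext <;> simp
    refine (this t).trans ?_
    rw [Submodule.mkQ_apply, (Submodule.Quotient.mk_eq_zero R).2 ht]
    ext <;> simp⟩

theorem trunc_mk (x : TensorAlgebra k V) :
    trunc R (QuadAlg.mk R x) = TensorAlgebra.lift k (truncAct R) x :=
  RingQuot.liftAlgHom_mkAlgHom_apply ..

theorem trunc_ι (v : V) (n) : trunc R (QuadAlg.ι R v) n = (0, n.1 • v, R.mkQ (v ⊗ₜ n.2.1)) := by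
  rw [← QuadAlg.mk_ι, trunc_mk, TensorAlgebra.lift_ι_apply]
  rfl

/-- The component of degree one of an element of `A`. -/
def degOne : QuadAlg R →ₗ[k] V :=
  LinearMap.fst k V _ ∘ₗ LinearMap.snd k k _ ∘ₗ
    (trunc R).toLinearMap.flip (1, 0, 0)

/-- The component of degree two of an element of `A`. -/
def degTwo : QuadAlg R →ₗ[k] (V ⊗[k] V) ⧸ R :=
  LinearMap.snd k V _ ∘ₗ LinearMap.snd k k _ ∘ₗ
    (trunc R).toLinearMap.flip (1, 0, 0)

/-- The action on the truncation is triangular for the grading, with the augmentation as diagonal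
entries. -/
theorem trunc_apply (y : QuadAlg R) (n) : (trunc R y n).1 = QuadAlg.aug R y * n.1 ∧
    (n.1 = 0 → (trunc R y n).2.1 = QuadAlg.aug R y • n.2.1) := by
  obtain ⟨y, rfl⟩ := QuadAlg.mk_surjective R y
  induction y using TensorAlgebra.induction generalizing n with
  | algebraMap r => simp [Module.algebraMap_end_apply]
  | ι v => simp [QuadAlg.mk_ι, trunc_ι]; tauto
  | mul a b ha hb =>
    have h1 := hb n
    have h2 := ha (trunc R (QuadAlg.mk R b) n)
    simp only [map_mul, Module.End.mul_apply]
    refine ⟨by rw [h2.1, h1.1, mul_assoc], fun hn => ?_⟩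
    rw [h2.2 (by rw [h1.1, hn, mul_zero]), h1.2 hn, mul_smul]
  | add a b ha hb =>
    simp only [map_add, LinearMap.add_apply, Prod.fst_add, Prod.snd_add]
    refine ⟨by rw [(ha n).1, (hb n).1, add_mul], fun hn => ?_⟩
    rw [(ha n).2 hn, (hb n).2 hn, add_smul]

/-- Only the constant term of `y` can contribute in degree one. -/
theorem degOne_mul_ι (y : QuadAlg R) (v : V) :
    degOne R (y * QuadAlg.ι R v) = QuadAlg.aug R y • v := by
  have := (trunc_apply R y (trunc R (QuadAlg.ι R v) (1, 0, 0))).2 (by simp [trunc_ι])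
  simpa [degOne, trunc_ι] using this

@[simp]
theorem degOne_ι (v : V) : degOne R (QuadAlg.ι R v) = v := by
  simp [degOne, trunc_ι]

theorem QuadAlg.ι_injective : Function.Injective (QuadAlg.ι R) :=
  Function.LeftInverse.injective (degOne_ι R)

theorem degTwo_mulTwo (t : V ⊗[k] V) :
    degTwo R (QuadAlg.mk R (mulTwo k V t)) = R.mkQ t := by
  induction t using TensorProduct.induction_on with
  | zero => simp
  | tmul v w => simp [degTwo, QuadAlg.mk_ι, trunc_ι]
  | add s t hs ht => rw [map_add, map_add, map_add, hs, ht, map_add]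

/-- The truncation `k ⊕ V ⊕ (V ⊗ V)/R` is an `A`-module on which `V ⊗ V` acts visibly modulo `R`. So
the ideal generated by `R` contains nothing new in degree two. -/
theorem mk_mulTwo_eq_zero {t : V ⊗[k] V} : QuadAlg.mk R (mulTwo k V t) = 0 ↔ t ∈ R := by
  constructor
  · intro h
    have := degTwo_mulTwo R t
    rw [h, map_zero] at this
    exact (Submodule.Quotient.mk_eq_zero R).1 this.symm
  · intro h
    exact QuadAlg.mk_relations R ⟨t, h, rfl⟩

end lowDegree

/-! ### Linear independence in the tensor algebra -/

section independence

variable {k : Type u} [Field k] {V : Type u} [AddCommGroup V] [Module k V]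

/-- Multiplication `V^{⊗ a} ⊗ V^{⊗ b} → T(V)` is injective, so elements of degree `b` that are
independent over `k` remain independent with coefficients in `V^{⊗ a}`. -/
theorem eq_zero_of_sum_mul_eq_zero {a b : ℕ} {J : Type u} {ρ : J → TensorAlgebra k V}
    (hρ : LinearIndependent k ρ) (hb : ∀ j, ρ j ∈ tensorPow k V b) (t : J →₀ TensorAlgebra k V)
    (ht : ∀ j, t j ∈ tensorPow k V a) (h : (t.sum fun j x => x * ρ j) = 0) : t = 0 := by
  have hY : Submodule.span k (Set.range ρ) ≤ tensorPow k V b := by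
    rw [Submodule.span_le]; rintro _ ⟨j, rfl⟩; exact hb j
  have hi := mulMap_injective (le_refl (tensorPow k V a)) hY
  let s : J →₀ tensorPow k V a := Finsupp.ofSupportFinite (fun j => ⟨t j, ht j⟩) (by
    refine t.hasFiniteSupport.subset fun j hj hj' => hj (Subtype.ext hj'))
  have hst : ∀ j, (s j : TensorAlgebra k V) = t j := fun j => rfl
  have hsupp : s.support = t.support := by
    ext j
    rw [Finsupp.mem_support_iff, Finsupp.mem_support_iff, Ne, Ne, ← hst, ZeroMemClass.coe_eq_zero]
  have h1 : (s.sum fun j x => x ⊗ₜ[k] Module.Basis.span hρ j) = 0 := by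
    apply hi
    rw [map_zero, ← h, Finsupp.sum, Finsupp.sum, map_sum, hsupp]
    refine Finset.sum_congr rfl fun j _ => ?_
    rw [Submodule.mulMap_tmul, Module.Basis.span_apply, hst]
  have h2 := TensorProduct.sum_tmul_basis_right_eq_zero (Module.Basis.span hρ) s h1
  ext1 j
  rw [← hst, h2]
  rfl

/-- An element of `X * span ρ` has an expansion with coefficients in `X`, and by
`eq_zero_of_sum_mul_eq_zero` coefficients are unique. -/
theorem mem_of_sum_mul_mem {a b : ℕ} {J : Type u} {ρ : J → TensorAlgebra k V}
    (hρ : LinearIndependent k ρ) (hb : ∀ j, ρ j ∈ tensorPow k V b)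
    {X : Submodule k (TensorAlgebra k V)} (hX : X ≤ tensorPow k V a) (t : J →₀ TensorAlgebra k V)
    (ht : ∀ j, t j ∈ tensorPow k V a)
    (h : (t.sum fun j x => x * ρ j) ∈ X * Submodule.span k (Set.range ρ)) (j : J) : t j ∈ X := by
  have key : ∀ z ∈ X * Submodule.span k (Set.range ρ), ∃ s : J →₀ TensorAlgebra k V,
      (∀ j, s j ∈ X) ∧ z = s.sum fun j x => x * ρ j := by
    intro z hz
    induction hz using Submodule.mul_induction_on' with
    | mem_mul_mem x hx y hy =>
      obtain ⟨c, rfl⟩ := (Finsupp.mem_span_range_iff_exists_finsupp).1 hy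
      refine ⟨c.mapRange (fun r => r • x) (zero_smul _ _), fun j => ?_, ?_⟩
      · rw [Finsupp.mapRange_apply]; exact X.smul_mem _ hx
      · rw [Finsupp.sum_mapRange_index (by simp), Finsupp.mul_sum]
        simp
    | add x hx y hy h1 h2 =>
      obtain ⟨s, hs, rfl⟩ := h1
      obtain ⟨s', hs', rfl⟩ := h2
      refine ⟨s + s', fun j => X.add_mem (hs j) (hs' j), ?_⟩
      classical
      rw [Finsupp.sum_add_index (by simp) (by simp [add_mul])]
  obtain ⟨s, hs, he⟩ := key _ h
  have h0 : t - s = 0 := by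
    refine eq_zero_of_sum_mul_eq_zero (a := a) hρ hb (t - s)
      (fun j => Submodule.sub_mem _ (ht j) (hX (hs j))) ?_
    classical
    rw [Finsupp.sum_sub_index (by simp [sub_mul]), he, sub_self]
  rw [sub_eq_zero] at h0
  rw [h0]
  exact hs j

end independence

/-! ### Linear resolutions of `k`, and their generators as bases of the `R_n` -/

section linearResolution

variable {k : Type u} [Field k] {V : Type u} [AddCommGroup V] [Module k V]
  {R : Submodule k (V ⊗[k] V)}

theorem tensorPow_one : tensorPow k V 1 = LinearMap.range (TensorAlgebra.ι k (M := V)) :=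
  pow_one _

theorem tensorPow_add (a b : ℕ) :
    tensorPow k V (a + b) = tensorPow k V a * tensorPow k V b := pow_add _ _ _

theorem mulTwo_mem (t : V ⊗[k] V) : mulTwo k V t ∈ tensorPow k V 2 := by
  rw [tensorPow, pow_two]
  induction t using TensorProduct.induction_on with
  | zero => simp
  | tmul x y => rw [mulTwo_tmul]; exact Submodule.mul_mem_mul ⟨x, rfl⟩ ⟨y, rfl⟩
  | add s t hs ht => rw [map_add]; exact Submodule.add_mem _ hs ht

theorem relations_le : relations R ≤ tensorPow k V 2 := by
  rintro _ ⟨t, -, rfl⟩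
  exact mulTwo_mem t

theorem Rpow_zero : Rpow R 0 = tensorPow k V 0 := by
  refine le_antisymm (Rpow_le R 0) (le_inf le_rfl ?_)
  simp

theorem Rpow_one : Rpow R 1 = tensorPow k V 1 := by
  refine le_antisymm (Rpow_le R 1) (le_inf le_rfl ?_)
  simp only [le_iInf_iff]
  intro i j h
  omega

theorem Rpow_le_relations (n : ℕ) : Rpow R (n + 2) ≤ relations R * Rpow R n := by
  refine (Rpow_le_mul R (show n + 2 = 2 + n by omega)).trans (mul_le_mul' ?_ le_rfl)
  refine inf_le_right.trans ((iInf₂_le 0 0).trans ((iInf_le _ rfl).trans ?_))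
  simp [tensorPow]

/-- `R_{n+2} = (V ⊗ R_{n+1}) ∩ (R ⊗ R_n)`. -/
theorem mem_Rpow_add_two {n : ℕ} {z : TensorAlgebra k V} : z ∈ Rpow R (n + 2) ↔
    z ∈ tensorPow k V 1 * Rpow R (n + 1) ∧ z ∈ relations R * Rpow R n := by
  constructor
  · intro h
    refine ⟨?_, Rpow_le_relations n h⟩
    rw [← Rpow_one (R := R)]
    exact Rpow_le_mul R (show n + 2 = 1 + (n + 1) by omega) h
  · rintro ⟨h₁, h₂⟩
    refine ⟨?_, ?_⟩
    · rw [show n + 2 = 1 + (n + 1) by omega, tensorPow_add]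
      exact mul_le_mul' le_rfl (Rpow_le R _) h₁
    · simp only [SetLike.mem_coe, Submodule.mem_iInf]
      intro i j hij
      -- The condition with `R` in the leftmost position comes from `R ⊗ R_n`; all others come from
      -- `V ⊗ R_{n+1}`.
      rcases i with _ | i
      · obtain rfl : j = n := by omega
        rw [tensorPow, pow_zero, one_mul]
        exact mul_le_mul' le_rfl (Rpow_le R _) h₂
      · rw [show i + 1 = 1 + i by omega, tensorPow_add, mul_assoc, mul_assoc]
        refine (show tensorPow k V 1 * Rpow R (n + 1) ≤ _ from mul_le_mul' le_rfl ?_) h₁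
        rw [← mul_assoc]
        intro x hx
        have h := hx.2
        simp only [SetLike.mem_coe, Submodule.mem_iInf] at h
        exact h i j (by omega)

variable (R) in
/-- A linear free resolution of the trivial module. -/
structure LinearResolution where
  /-- The index sets of the bases of the free modules. -/
  J : ℕ → Type u
  [uniqueJ : Unique (J 0)]
  /-- The differentials. -/
  D : ∀ n, (J (n + 1) →₀ QuadAlg R) →ₗ[QuadAlg R] (J n →₀ QuadAlg R)
  linear : ∀ n i j, D n (Finsupp.single i 1) j ∈ LinearMap.range (QuadAlg.ι R)
  exact_aug : Function.Exact (D 0) (fun x => QuadAlg.aug R (x default))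
  exact : ∀ n, Function.Exact (D (n + 1)) (D n)

/-- The index sets of a linear resolution, with the one point set in degree zero. -/
def consIndex (I : ℕ → Type u) : ℕ → Type u
  | 0 => PUnit
  | n + 1 => I n

/-- The term `A` is written as the free module on one point, so that all differentials have the same
form and the index sets are shifted by one. -/
theorem IsKoszul.nonempty_linearResolution (h : IsKoszul R) : Nonempty (LinearResolution R) := by
  obtain ⟨I, δ₀, δ, h₁, h₂, h₃, h₄, h₅⟩ := h
  let e : QuadAlg R →ₗ[QuadAlg R] (PUnit.{u + 1} →₀ QuadAlg R) := Finsupp.lsingle PUnit.unit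
  have he : ∀ x : PUnit.{u + 1} →₀ QuadAlg R, e (x PUnit.unit) = x := fun x =>
    (Finsupp.unique_single x).symm
  refine ⟨{ J := consIndex I, uniqueJ := inferInstanceAs (Unique PUnit), D := fun n => match n with
    | 0 => e ∘ₗ δ₀
    | n + 1 => δ n, linear := ?_, exact_aug := ?_, exact := ?_ }⟩
  · rintro (_ | n) i j
    · convert h₁ i
      exact Finsupp.single_eq_same
    · exact h₂ n i j
  · intro x
    refine (h₃ (x PUnit.unit)).trans ?_
    constructor
    · rintro ⟨y, hy⟩
      exact ⟨y, (congrArg e hy).trans (he x)⟩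
    · rintro ⟨y, rfl⟩
      exact ⟨y, Finsupp.single_eq_same.symm⟩
  · rintro (_ | n)
    · intro x
      refine Iff.trans ?_ (h₄ x)
      constructor
      · intro h
        exact Finsupp.single_injective PUnit.unit (h.trans (Finsupp.single_zero _).symm)
      · intro h
        exact (congrArg e h).trans (map_zero e)
    · exact h₅ n

namespace LinearResolution

attribute [instance] uniqueJ

variable (P : LinearResolution R)

/-- The coefficients, in `V`, of the differential. -/
def coef (n : ℕ) (i : P.J (n + 1)) : P.J n →₀ V :=
  (P.D n (Finsupp.single i 1)).mapRange (degOne R) (map_zero _)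

/-- By linearity the entries lie in `A₁`, which is identified with `V`, so the `V`-valued
coefficients determine the differential. -/
theorem D_single (n : ℕ) (i : P.J (n + 1)) :
    P.D n (Finsupp.single i 1) = (P.coef n i).mapRange (QuadAlg.ι R) (map_zero _) := by
  ext j
  obtain ⟨v, hv⟩ := P.linear n i j
  rw [Finsupp.mapRange_apply, coef, Finsupp.mapRange_apply, ← hv, degOne_ι]

/-- `∑ v_j e_j ↦ ∑ v_j ρ_j`. -/
def combine {J : Type u} (ρ : J → TensorAlgebra k V) : (J →₀ V) →ₗ[k] TensorAlgebra k V :=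
  Finsupp.lsum k fun j => LinearMap.mulRight k (ρ j) ∘ₗ TensorAlgebra.ι k

theorem combine_apply {J : Type u} (ρ : J → TensorAlgebra k V) (t : J →₀ V) :
    combine ρ t = (t.mapRange (TensorAlgebra.ι k) (map_zero _)).sum fun j x => x * ρ j := by
  rw [Finsupp.sum_mapRange_index (by simp)]
  rfl

@[simp]
theorem combine_single {J : Type u} (ρ : J → TensorAlgebra k V) (j : J) (v : V) :
    combine ρ (Finsupp.single j v) = TensorAlgebra.ι k v * ρ j := by
  simp [combine]

/-- The generators of the resolution, as elements of the tensor algebra. -/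
def gen : ∀ n, P.J n → TensorAlgebra k V
  | 0 => fun _ => 1
  | n + 1 => fun i => combine (gen n) (P.coef n i)

theorem gen_succ (n : ℕ) (i : P.J (n + 1)) :
    P.gen (n + 1) i = combine (P.gen n) (P.coef n i) := rfl

/-- The coefficients, in `V ⊗ V`, of the composition of two differentials. -/
def coefTwo (n : ℕ) : (P.J (n + 1) →₀ V) →ₗ[k] (P.J n →₀ V ⊗[k] V) :=
  Finsupp.lsum k fun j =>
    { toFun := fun v => (P.coef n j).mapRange (fun w => v ⊗ₜ w) (TensorProduct.tmul_zero _ _)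
      map_add' := fun v w => by ext; simp [TensorProduct.add_tmul]
      map_smul' := fun c v => by ext; simp [TensorProduct.smul_tmul'] }

theorem coefTwo_single (n : ℕ) (j : P.J (n + 1)) (v : V) :
    P.coefTwo n (Finsupp.single j v) =
      (P.coef n j).mapRange (fun w => v ⊗ₜ w) (TensorProduct.tmul_zero _ _) := by
  rw [coefTwo, Finsupp.lsum_single]
  rfl

/-- Expanding the generators once more gives coefficients in `V ⊗ V`. They are the same as those of
the composition of the two maps in `D_mapRange_ι`, which links relations in `T(V)` with the complex.
-/
theorem combine_gen_succ (n : ℕ) (t : P.J (n + 1) →₀ V) :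
    combine (P.gen (n + 1)) t =
      ((P.coefTwo n t).mapRange (mulTwo k V) (map_zero _)).sum fun j x => x * P.gen n j := by
  classical
  induction t using Finsupp.induction_linear with
  | zero => simp
  | add s t hs ht =>
    rw [map_add, hs, ht, map_add, Finsupp.mapRange_add (map_add _),
      Finsupp.sum_add_index (by simp) (by simp [add_mul])]
  | single j v =>
    rw [combine_single, coefTwo_single, gen_succ, combine_apply, Finsupp.sum_mapRange_index (by simp),
      Finsupp.sum_mapRange_index (by simp), Finsupp.sum_mapRange_index (by simp), Finsupp.sum,
      Finset.mul_sum]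
    simp [mul_assoc, Finsupp.sum]

theorem D_mapRange_ι (n : ℕ) (t : P.J (n + 1) →₀ V) :
    P.D n (t.mapRange (QuadAlg.ι R) (map_zero _)) =
      (P.coefTwo n t).mapRange (fun s => QuadAlg.mk R (mulTwo k V s)) (by simp) := by
  induction t using Finsupp.induction_linear with
  | zero => simp
  | add s t hs ht =>
    rw [Finsupp.mapRange_add (map_add _), map_add, hs, ht, map_add,
      Finsupp.mapRange_add (by simp)]
  | single j v =>
    rw [Finsupp.mapRange_single, coefTwo_single,
      show (Finsupp.single j (QuadAlg.ι R v)) = QuadAlg.ι R v • Finsupp.single j 1 by simp,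
      map_smul, D_single]
    ext l
    simp [QuadAlg.mk_ι]

/-- The entries of the image have degree two, where `A` is `(V ⊗ V) / R`. -/
theorem D_mapRange_ι_eq_zero {n : ℕ} {t : P.J (n + 1) →₀ V} :
    P.D n (t.mapRange (QuadAlg.ι R) (map_zero _)) = 0 ↔ ∀ l, P.coefTwo n t l ∈ R := by
  rw [D_mapRange_ι, Finsupp.ext_iff]
  simp only [Finsupp.mapRange_apply, Finsupp.coe_zero, Pi.zero_apply, mk_mulTwo_eq_zero]

/-- Extension of scalars from `k` to `A`. -/
def scal {J : Type u} : (J →₀ k) →ₗ[k] (J →₀ QuadAlg R) :=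
  Finsupp.mapRange.linearMap (Algebra.linearMap k (QuadAlg R))

/-- The entries of the differential have degree one, so the degree one part of `D y` depends only on
the constant terms of `y`. This is how an arbitrary preimage is replaced by a scalar combination of
basis vectors. -/
theorem coef_sum (n : ℕ) (y : P.J (n + 1) →₀ QuadAlg R) :
    (P.D n y).mapRange (degOne R) (map_zero _) =
      Finsupp.linearCombination k (P.coef n) (y.mapRange (QuadAlg.aug R) (map_zero _)) := by
  induction y using Finsupp.induction_linear with
  | zero => simp
  | add s t hs ht =>
    rw [map_add, Finsupp.mapRange_add (map_add _), hs, ht, Finsupp.mapRange_add (map_add _), map_add]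
  | single j a =>
    rw [Finsupp.mapRange_single, Finsupp.linearCombination_single,
      show (Finsupp.single j a) = a • Finsupp.single j (1 : QuadAlg R) by simp, map_smul, D_single]
    ext l
    simp [degOne_mul_ι]

theorem D_scal (n : ℕ) (c : P.J (n + 1) →₀ k) :
    P.D n (scal c) =
      (Finsupp.linearCombination k (P.coef n) c).mapRange (QuadAlg.ι R) (map_zero _) := by
  induction c using Finsupp.induction_linear with
  | zero => simp
  | add s t hs ht =>
    rw [map_add, map_add, hs, ht, map_add, Finsupp.mapRange_add (map_add _)]
  | single j a =>
    have : (scal (Finsupp.single j a) : P.J (n + 1) →₀ QuadAlg R) =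
        algebraMap k (QuadAlg R) a • Finsupp.single j (1 : QuadAlg R) := by
      simp [scal, Algebra.algebraMap_eq_smul_one]
    rw [this, map_smul, D_single]
    ext l
    simp [Algebra.smul_def]

/-- Minimality of the resolution: differentials take values in the augmentation ideal. -/
theorem aug_D (n : ℕ) (y : P.J (n + 1) →₀ QuadAlg R) (j) : QuadAlg.aug R (P.D n y j) = 0 := by
  induction y using Finsupp.induction_linear with
  | zero => simp
  | add s t hs ht => rw [map_add, Finsupp.add_apply, map_add, hs, ht, add_zero]
  | single i a =>
    rw [show (Finsupp.single i a) = a • Finsupp.single i (1 : QuadAlg R) by simp, map_smul, D_single]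
    simp

/-- A scalar relation between the images of the basis vectors is a cycle with constant entries. It
is a boundary by exactness, so by minimality its entries also lie in the augmentation ideal, and
they vanish. -/
theorem linearCombination_coef_injective (n : ℕ) :
    Function.Injective (Finsupp.linearCombination k (P.coef n)) := by
  rw [injective_iff_map_eq_zero]
  intro c hc
  have h : P.D n (scal c) = 0 := by rw [D_scal, hc]; simp
  obtain ⟨y, hy⟩ := (P.exact n _).1 h
  ext i
  have := P.aug_D (n + 1) y i
  rw [hy] at this
  simpa [scal] using this

theorem linearCombination_gen_succ (n : ℕ) (c : P.J (n + 1) →₀ k) :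
    Finsupp.linearCombination k (P.gen (n + 1)) c =
      combine (P.gen n) (Finsupp.linearCombination k (P.coef n) c) := by
  induction c using Finsupp.induction_linear with
  | zero => simp
  | add s t hs ht => simp only [map_add, hs, ht]
  | single j a => simp only [Finsupp.linearCombination_single, map_smul]; rfl

theorem combine_injective {J : Type u} {b : ℕ} {ρ : J → TensorAlgebra k V}
    (hρ : LinearIndependent k ρ) (hb : ∀ j, ρ j ∈ tensorPow k V b) :
    Function.Injective (combine ρ) := by
  rw [injective_iff_map_eq_zero]
  intro t ht
  rw [combine_apply] at ht
  have := eq_zero_of_sum_mul_eq_zero (a := 1) hρ hb _ (fun j => by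
    rw [tensorPow_one, Finsupp.mapRange_apply]; exact ⟨_, rfl⟩) ht
  ext j
  have h := DFunLike.congr_fun this j
  rw [Finsupp.mapRange_apply] at h
  exact (TensorAlgebra.ι_eq_zero_iff _ _).1 h

theorem exists_combine {J : Type u} {ρ : J → TensorAlgebra k V} {z : TensorAlgebra k V}
    (hz : z ∈ tensorPow k V 1 * Submodule.span k (Set.range ρ)) : ∃ t, combine ρ t = z := by
  induction hz using Submodule.mul_induction_on' with
  | mem_mul_mem x hx y hy =>
    rw [tensorPow_one] at hx
    obtain ⟨v, rfl⟩ := hx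
    obtain ⟨c, rfl⟩ := (Finsupp.mem_span_range_iff_exists_finsupp).1 hy
    refine ⟨c.mapRange (fun r => r • v) (zero_smul _ _), ?_⟩
    rw [combine_apply, Finsupp.sum_mapRange_index (by simp), Finsupp.sum_mapRange_index (by simp),
      Finsupp.mul_sum]
    simp
  | add x hx y hy h1 h2 =>
    obtain ⟨s, rfl⟩ := h1
    obtain ⟨t, rfl⟩ := h2
    exact ⟨s + t, map_add _ _ _⟩

/-- The generators in homological degree `n` form a basis of `R_n`. -/
theorem gen_basis (n : ℕ) : LinearIndependent k (P.gen n) ∧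
    Submodule.span k (Set.range (P.gen n)) = Rpow R n := by
  -- Independence passes from degree `n` to `n + 1`: the vectors of coefficients are independent,
  -- and `combine` is injective on them.
  have hli : ∀ n, LinearIndependent k (P.gen n) →
      Submodule.span k (Set.range (P.gen n)) = Rpow R n → LinearIndependent k (P.gen (n + 1)) := by
    intro n h1 h2
    rw [LinearIndependent]
    have : ⇑(Finsupp.linearCombination k (P.gen (n + 1))) =
        combine (P.gen n) ∘ Finsupp.linearCombination k (P.coef n) :=
      funext (P.linearCombination_gen_succ n)
    rw [this]
    refine (combine_injective (b := n) h1 fun j => Rpow_le R n ?_).comp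
      (P.linearCombination_coef_injective n)
    rw [← h2]
    exact Submodule.subset_span ⟨j, rfl⟩
  have h0 : LinearIndependent k (P.gen 0) ∧
      Submodule.span k (Set.range (P.gen 0)) = Rpow R 0 := by
    constructor
    · rw [linearIndependent_unique_iff]
      exact fun h => (one_ne_zero (α := k))
        ((TensorAlgebra.algebraMap_leftInverse (R := k) V).injective (by simp [gen] at h))
    · rw [Rpow_zero, tensorPow, pow_zero, Submodule.one_eq_span, Set.range_unique]
      rfl
  have h1 : LinearIndependent k (P.gen 1) ∧
      Submodule.span k (Set.range (P.gen 1)) = Rpow R 1 := by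
    refine ⟨hli 0 h0.1 h0.2, le_antisymm ?_ ?_⟩
    · rw [Submodule.span_le, Rpow_one, tensorPow_one]
      rintro _ ⟨i, rfl⟩
      have : ∀ t : P.J 0 →₀ V, combine (P.gen 0) t ∈
          LinearMap.range (TensorAlgebra.ι k (M := V)) := by
        intro t
        rw [Finsupp.unique_single t, combine_single]
        simp [gen]
      exact this _
    · rw [Rpow_one, tensorPow_one]
      rintro _ ⟨v, rfl⟩
      -- An element of `V` has augmentation zero, so it is a boundary, and the constant terms of a
      -- preimage express it through the generators.
      obtain ⟨y, hy⟩ := (P.exact_aug (Finsupp.single default (QuadAlg.ι R v))).1 (by simp)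
      have h2 := P.coef_sum 0 y
      rw [hy, Finsupp.mapRange_single, degOne_ι] at h2
      have h3 := P.linearCombination_gen_succ 0 (y.mapRange (QuadAlg.aug R) (map_zero _))
      rw [← h2, combine_single] at h3
      rw [Finsupp.mem_span_range_iff_exists_finsupp]
      exact ⟨_, h3.trans (by simp [gen])⟩
  induction n using Nat.twoStepInduction with
  | zero => exact h0
  | one => exact h1
  | more n ih ih' =>
    refine ⟨hli _ ih'.1 ih'.2, le_antisymm ?_ ?_⟩
    · rw [Submodule.span_le]
      rintro _ ⟨i, rfl⟩
      rw [SetLike.mem_coe, mem_Rpow_add_two]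
      constructor
      · rw [gen_succ, combine_apply]
        refine Submodule.sum_mem _ fun j _ => Submodule.mul_mem_mul ?_ ?_
        · rw [tensorPow_one, Finsupp.mapRange_apply]; exact ⟨_, rfl⟩
        · rw [← ih'.2]; exact Submodule.subset_span ⟨j, rfl⟩
      -- This is `D ∘ D = 0` on a basis vector.
      · have hR : ∀ l, P.coefTwo n (P.coef (n + 1) i) l ∈ R := by
          rw [← D_mapRange_ι_eq_zero, ← D_single]
          exact (P.exact n _).2 ⟨_, rfl⟩
        rw [gen_succ, combine_gen_succ]
        refine Submodule.sum_mem _ fun j _ => Submodule.mul_mem_mul ?_ ?_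
        · rw [Finsupp.mapRange_apply]; exact ⟨_, hR j, rfl⟩
        · rw [← ih.2]; exact Submodule.subset_span ⟨j, rfl⟩
    · intro z hz
      rw [mem_Rpow_add_two, ← ih'.2, ← ih.2] at hz
      obtain ⟨t, rfl⟩ := exists_combine hz.1
      have hR : ∀ l, P.coefTwo n t l ∈ R := by
        intro l
        have h := hz.2
        rw [combine_gen_succ] at h
        have := mem_of_sum_mul_mem (a := 2) (b := n) ih.1 (fun j => Rpow_le R n (by
          rw [← ih.2]; exact Submodule.subset_span ⟨j, rfl⟩)) relations_le _ (fun j => by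
            rw [Finsupp.mapRange_apply]; exact mulTwo_mem _) h l
        rw [Finsupp.mapRange_apply] at this
        rw [← mk_mulTwo_eq_zero]
        exact QuadAlg.mk_relations R this
      -- Conversely, an element of `V ⊗ R_{n+1}` that also lies in `R ⊗ R_n` has a cycle as its
      -- coefficient vector. It is a boundary, and again only the constant terms of a preimage
      -- matter.
      obtain ⟨y, hy⟩ := (P.exact n _).1 (P.D_mapRange_ι_eq_zero.2 hR)
      have h2 := P.coef_sum (n + 1) y
      have h4 : (t.mapRange (QuadAlg.ι R) (map_zero _)).mapRange (degOne R) (map_zero _) = t := by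
        ext; simp
      rw [hy, h4] at h2
      rw [Finsupp.mem_span_range_iff_exists_finsupp]
      refine ⟨y.mapRange (QuadAlg.aug R) (map_zero _), ?_⟩
      rw [h2]
      exact P.linearCombination_gen_succ (n + 1) _

end LinearResolution
end linearResolution

/-! ### What regularity says about a linear resolution -/

section regular

variable {k : Type u} [Field k] {V : Type u} [AddCommGroup V] [Module k V]
  {R : Submodule k (V ⊗[k] V)}

namespace LinearResolution

variable (P : LinearResolution R)

/-- The free modules of a linear resolution. -/
abbrev freeModule (n : ℕ) : ModuleCat.{u} (QuadAlg R) := ModuleCat.of _ (P.J n →₀ QuadAlg R)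

instance (n : ℕ) : Projective (P.freeModule n) := by
  unfold freeModule
  infer_instance

/-- The augmentation of a linear resolution. -/
def augLin : (P.J 0 →₀ QuadAlg R) →ₗ[QuadAlg R] QuadAlg.trivialModule R where
  toFun x := (QuadAlg.aug R (x default) : k)
  map_add' x y := (congrArg (QuadAlg.aug R) (Finsupp.add_apply x y default)).trans (map_add _ _ _)
  map_smul' _ _ := map_mul (QuadAlg.aug R) _ _

theorem augLin_surjective : Function.Surjective P.augLin := fun c =>
  ⟨Finsupp.single default (algebraMap k _ c), (congrArg (QuadAlg.aug R)
    Finsupp.single_eq_same).trans ((QuadAlg.aug R).commutes c)⟩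

theorem augLin_exact : Function.Exact (P.D 0) P.augLin := P.exact_aug

theorem exists_lift (N : ModuleCat.{u} (QuadAlg R)) (n : ℕ)
    (h : Subsingleton (Abelian.Ext (QuadAlg.trivialModule R) N (n + 1)))
    (f : (P.J (n + 1) →₀ QuadAlg R) →ₗ[QuadAlg R] N) (hf : f ∘ₗ P.D (n + 1) = 0) :
    ∃ g : (P.J n →₀ QuadAlg R) →ₗ[QuadAlg R] N, g ∘ₗ P.D n = f := by
  obtain ⟨g, hg⟩ := exists_lift_of_subsingleton_ext (X := P.freeModule)
    (D := fun n => ModuleCat.ofHom (P.D n)) (ε := ModuleCat.ofHom P.augLin)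
    P.augLin_surjective P.augLin_exact P.exact N n h (ModuleCat.ofHom f)
    (by rw [← ModuleCat.ofHom_comp, hf]; rfl)
  exact ⟨g.hom, congrArg ModuleCat.Hom.hom hg⟩

theorem eq_zero_of_comp_D_zero (N : ModuleCat.{u} (QuadAlg R))
    (h : Subsingleton (Abelian.Ext (QuadAlg.trivialModule R) N 0))
    (f : (P.J 0 →₀ QuadAlg R) →ₗ[QuadAlg R] N) (hf : f ∘ₗ P.D 0 = 0) : f = 0 := by
  have := eq_zero_of_subsingleton_ext_zero (X := P.freeModule)
    (D₀ := ModuleCat.ofHom (P.D 0)) (ε := ModuleCat.ofHom P.augLin)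
    P.augLin_surjective P.augLin_exact N h (ModuleCat.ofHom f)
    (by rw [← ModuleCat.ofHom_comp, hf]; rfl)
  exact congrArg ModuleCat.Hom.hom this

/-- The linear map to `A` which takes prescribed values in `k` on the basis. -/
def constMap {J : Type u} (φ : J → k) : (J →₀ QuadAlg R) →ₗ[QuadAlg R] QuadAlg R :=
  Finsupp.linearCombination _ fun j => algebraMap k (QuadAlg R) (φ j)

theorem constMap_single {J : Type u} (φ : J → k) (j : J) :
    constMap φ (Finsupp.single j (1 : QuadAlg R)) = algebraMap k (QuadAlg R) (φ j) := by
  simp [constMap]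

theorem aug_comp_D {n : ℕ} (g : (P.J n →₀ QuadAlg R) →ₗ[QuadAlg R] QuadAlg R)
    (i : P.J (n + 1)) : QuadAlg.aug R (g (P.D n (Finsupp.single i 1))) = 0 := by
  rw [← Finsupp.sum_single (P.D n (Finsupp.single i 1)), Finsupp.sum, map_sum, map_sum]
  refine Finset.sum_eq_zero fun j _ => ?_
  rw [← mul_one (P.D n (Finsupp.single i 1) j), ← smul_eq_mul, ← Finsupp.smul_single, map_smul,
    smul_eq_mul, map_mul, P.aug_D, zero_mul]

/-- By minimality, coboundaries take values in the augmentation ideal on basis vectors, so a nonzero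
cochain with constant values is never a coboundary. -/
theorem eq_zero_of_constMap {n : ℕ} (φ : P.J (n + 1) → k)
    (g : (P.J n →₀ QuadAlg R) →ₗ[QuadAlg R] QuadAlg R) (h : g ∘ₗ P.D n = constMap φ) : φ = 0 := by
  ext i
  have h₁ := P.aug_comp_D g i
  rw [← LinearMap.comp_apply, h, constMap_single, AlgHom.commutes] at h₁
  exact h₁

/-- `∑ v_j e_j ↦ ∑ φ_j v_j`. -/
def evalCoef {J : Type u} (φ : J → k) : (J →₀ V) →ₗ[k] V :=
  Finsupp.lsum k fun j => φ j • LinearMap.id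

theorem evalCoef_single {J : Type u} (φ : J → k) (j : J) (v : V) :
    evalCoef φ (Finsupp.single j v) = φ j • v := by
  simp [evalCoef]

theorem constMap_mapRange_ι {J : Type u} (φ : J → k) (t : J →₀ V) :
    constMap φ (t.mapRange (QuadAlg.ι R) (map_zero _)) = QuadAlg.ι R (evalCoef φ t) := by
  induction t using Finsupp.induction_linear with
  | zero => simp
  | add s t hs ht =>
    rw [Finsupp.mapRange_add (map_add _), map_add, hs, ht, map_add, map_add]
  | single j v =>
    rw [Finsupp.mapRange_single, evalCoef_single, constMap, Finsupp.linearCombination_single,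
      smul_eq_mul, map_smul, Algebra.smul_def, Algebra.commutes]

theorem constMap_comp_D {n : ℕ} (φ : P.J n → k) (h : ∀ i, evalCoef φ (P.coef n i) = 0) :
    constMap φ ∘ₗ P.D n = 0 := by
  refine Finsupp.lhom_ext' fun i => LinearMap.ext_ring ?_
  simp only [LinearMap.comp_apply, Finsupp.lsingle_apply, LinearMap.zero_apply]
  rw [D_single, constMap_mapRange_ι, h, map_zero]

/-- The complex `Hom(P, A)` has no cocycles of degree zero in homological degree `n` if
`Ext^n(k, A) = 0`. -/
theorem eq_zero_of_evalCoef {n : ℕ}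
    (h : Subsingleton (Abelian.Ext (QuadAlg.trivialModule R)
      (ModuleCat.of (QuadAlg R) (QuadAlg R)) n))
    (φ : P.J n → k) (hφ : ∀ i, evalCoef φ (P.coef n i) = 0) : φ = 0 := by
  have h₁ := P.constMap_comp_D φ hφ
  cases n with
  | zero =>
    have h₂ := P.eq_zero_of_comp_D_zero (ModuleCat.of (QuadAlg R) (QuadAlg R)) h _ h₁
    ext j
    have h₃ := constMap_single (R := R) φ j
    rw [h₂, LinearMap.zero_apply] at h₃
    have h₄ := congrArg (QuadAlg.aug R) h₃
    rw [AlgHom.commutes, map_zero] at h₄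
    exact h₄.symm
  | succ n =>
    obtain ⟨g, hg⟩ := P.exists_lift (ModuleCat.of (QuadAlg R) (QuadAlg R)) n h _ h₁
    exact P.eq_zero_of_constMap φ g hg

/-- The coefficient of a basis vector, as a map to the trivial module. -/
def coordMap {J : Type u} (i : J) : (J →₀ QuadAlg R) →ₗ[QuadAlg R] QuadAlg.trivialModule R where
  toFun x := (QuadAlg.aug R (x i) : k)
  map_add' x y := (congrArg (QuadAlg.aug R) (Finsupp.add_apply x y i)).trans (map_add _ _ _)
  map_smul' _ _ := map_mul (QuadAlg.aug R) _ _

theorem smul_eq_zero_of_aug {a : QuadAlg R} (ha : QuadAlg.aug R a = 0)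
    (m : QuadAlg.trivialModule R) : a • m = 0 := by
  have h : @Eq k (a • m) (QuadAlg.aug R a * @id k m) := rfl
  rw [ha, zero_mul] at h
  exact h

/-- By minimality a coordinate map to `k` is a cocycle, and every coboundary with values in `k`
vanishes on basis vectors. A basis vector would therefore give a nonzero class in `Ext^{d+1}(k, k)`.
-/
theorem isEmpty_J {d : ℕ} (h : Subsingleton (Abelian.Ext (QuadAlg.trivialModule R)
    (QuadAlg.trivialModule R) (d + 1))) : IsEmpty (P.J (d + 1)) := by
  refine ⟨fun i => ?_⟩
  have h₁ : coordMap i ∘ₗ P.D (d + 1) = 0 := by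
    exact LinearMap.ext fun y => P.aug_D (d + 1) y i
  obtain ⟨g, hg⟩ := P.exists_lift (QuadAlg.trivialModule R) d h _ h₁
  have h₂ : g (P.D d (Finsupp.single i 1)) = 0 := by
    rw [← Finsupp.sum_single (P.D d (Finsupp.single i 1)), Finsupp.sum, map_sum]
    refine Finset.sum_eq_zero fun j _ => ?_
    rw [← mul_one (P.D d (Finsupp.single i 1) j), ← smul_eq_mul, ← Finsupp.smul_single, map_smul]
    exact smul_eq_zero_of_aug (P.aug_D d _ j) _
  have h₃ : @Eq k (coordMap i (Finsupp.single i (1 : QuadAlg R))) (1 : k) :=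
    (congrArg (QuadAlg.aug R) Finsupp.single_eq_same).trans (map_one _)
  rw [← hg] at h₃
  exact zero_ne_one (α := k) (h₂.symm.trans h₃)

theorem nonempty_J {d : ℕ} (h : Nontrivial (Abelian.Ext (QuadAlg.trivialModule R)
      (ModuleCat.of (QuadAlg R) (QuadAlg R)) d)) : Nonempty (P.J d) := by
  obtain ⟨f, hf⟩ := exists_ne_zero_of_nontrivial_ext (X := P.freeModule)
    (D := fun n => ModuleCat.ofHom (P.D n)) (ε := ModuleCat.ofHom P.augLin)
    P.augLin_surjective P.augLin_exact P.exact _ d h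
  by_contra hJ
  rw [not_nonempty_iff] at hJ
  exact hf (ModuleCat.hom_ext (LinearMap.ext fun x => by
    rw [Subsingleton.elim x 0]; exact (map_zero _).trans (map_zero _).symm))

theorem hom_smul_apply {M N : ModuleCat.{u} (QuadAlg R)} (c : k) (f : M ⟶ N) (x : M) :
    (c • f).hom x = algebraMap k (QuadAlg R) c • f.hom x := rfl

/-- Since `P_{d+1} = 0`, every map `P_d → A` is a cocycle. Two different basis vectors would give
two coordinate maps that are dependent modulo coboundaries, contrary to `eq_zero_of_constMap`. In
degree zero there is one basis vector by definition. -/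
theorem subsingleton_J {d : ℕ} [IsEmpty (P.J (d + 1))]
    (h : Module.finrank k (Abelian.Ext (QuadAlg.trivialModule R)
      (ModuleCat.of (QuadAlg R) (QuadAlg R)) d) = 1) : Subsingleton (P.J d) := by
  classical
  cases d with
  | zero => infer_instance
  | succ n =>
    refine ⟨fun i j => ?_⟩
    by_contra hij
    have hD : P.D (n + 1) = 0 := LinearMap.ext fun x => by
      rw [Subsingleton.elim x 0, map_zero, map_zero]
    have h₀ : ∀ f : P.freeModule (n + 1) ⟶ ModuleCat.of (QuadAlg R) (QuadAlg R),
        (ModuleCat.ofHom (P.D (n + 1)) : P.freeModule (n + 2) ⟶ P.freeModule (n + 1)) ≫ f = 0 := by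
      intro f
      rw [hD]
      exact Limits.zero_comp
    obtain ⟨c₁, c₂, g, hc, hg⟩ := exists_linear_dependence (k := k) (X := P.freeModule)
      (D := fun n => ModuleCat.ofHom (P.D n)) (ε := ModuleCat.ofHom P.augLin)
      P.augLin_surjective P.augLin_exact P.exact _ n h
      (ModuleCat.ofHom (constMap (Pi.single i 1))) (ModuleCat.ofHom (constMap (Pi.single j 1)))
      (h₀ _) (h₀ _)
    have h₁ : g.hom ∘ₗ P.D n = constMap (c₁ • Pi.single i 1 + c₂ • Pi.single j 1) := by
      refine (congrArg ModuleCat.Hom.hom hg).trans ?_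
      refine Finsupp.lhom_ext' fun l => LinearMap.ext_ring ?_
      simp only [LinearMap.comp_apply, Finsupp.lsingle_apply, constMap_single]
      rw [ModuleCat.hom_add, LinearMap.add_apply, hom_smul_apply, hom_smul_apply,
        ModuleCat.hom_ofHom, ModuleCat.hom_ofHom, constMap_single, constMap_single]
      simp only [smul_eq_mul, ← map_mul, ← map_add]
      rfl
    have h₂ := P.eq_zero_of_constMap _ _ h₁
    rcases hc with hc | hc
    · apply hc
      simpa [hij] using congrFun h₂ i
    · apply hc
      simpa [Ne.symm hij] using congrFun h₂ j

/-- An element annihilated by `V` from the left is a map `P_0 → A` that vanishes on boundaries, so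
it represents an element of `Hom(k, A)`. -/
theorem eq_zero_of_ι_mul (P : LinearResolution R) {z : QuadAlg R}
    (h : Subsingleton (Abelian.Ext (QuadAlg.trivialModule R)
      (ModuleCat.of (QuadAlg R) (QuadAlg R)) 0))
    (hz : ∀ v, QuadAlg.ι R v * z = 0) : z = 0 := by
  have h₁ := P.eq_zero_of_comp_D_zero (ModuleCat.of (QuadAlg R) (QuadAlg R)) h
    (Finsupp.linearCombination _ fun _ => z) (by
      refine Finsupp.lhom_ext' fun i => LinearMap.ext_ring ?_
      simp only [LinearMap.comp_apply, Finsupp.lsingle_apply, LinearMap.zero_apply]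
      rw [D_single, Finsupp.unique_single (P.coef 0 i), Finsupp.mapRange_single,
        Finsupp.linearCombination_single]
      exact hz _)
  have h₂ := LinearMap.congr_fun h₁ (Finsupp.single default 1)
  rwa [Finsupp.linearCombination_single, one_smul] at h₂

/-- The last differential is injective and has entries in `V`. If `z` annihilates `V` on its right,
then `z` times a basis vector is a cycle. -/
theorem eq_zero_of_mul_ι {z : QuadAlg R} {n : ℕ} [IsEmpty (P.J (n + 2))] [Nonempty (P.J (n + 1))]
    (hz : ∀ v, z * QuadAlg.ι R v = 0) : z = 0 := by
  obtain ⟨i⟩ := ‹Nonempty (P.J (n + 1))›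
  have h₁ : P.D n (z • Finsupp.single i 1) = 0 := by
    rw [map_smul, D_single]
    ext j
    simp [hz]
  obtain ⟨y, hy⟩ := (P.exact n _).1 h₁
  rw [Subsingleton.elim y 0, map_zero] at hy
  simpa using (DFunLike.congr_fun hy i).symm

end LinearResolution

theorem IsASRegular.subsingleton_ext {d : ℕ} (h : IsASRegular R d) (N : ModuleCat.{u} (QuadAlg R)) :
    Subsingleton (Abelian.Ext (QuadAlg.trivialModule R) N (d + 1)) := by
  have h₁ : projectiveDimension (QuadAlg.trivialModule R) ≤ d :=
    (le_iSup (fun M : ModuleCat.{u} (QuadAlg R) => projectiveDimension M) _).trans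
      h.globalDimension_eq.le
  rw [projectiveDimension_le_iff] at h₁
  exact HasProjectiveDimensionLT.subsingleton _ (d + 1) _ le_rfl N

end regular

/-! ### Contraction of a tensor factor with a functional -/

section contraction

variable {k : Type u} [Field k]

/-- Contraction `id ⊗ f : P ⊗ Q → P` of the right factor with a functional `f` on `Q`. -/
def contractR (P : Type u) [AddCommGroup P] [Module k P] {Q : Type u} [AddCommGroup Q]
    [Module k Q] : Module.Dual k Q →ₗ[k] (P ⊗[k] Q →ₗ[k] P) :=
  (TensorProduct.rid k P).toLinearMap.compRight k (M := P ⊗[k] Q) ∘ₗ LinearMap.lTensorHom P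

variable {P Q : Type u} [AddCommGroup P] [Module k P] [AddCommGroup Q] [Module k Q]

@[simp]
theorem contractR_tmul (f : Module.Dual k Q) (p : P) (q : Q) :
    contractR P f (p ⊗ₜ q) = f q • p := by
  simp [contractR]

theorem dual_contract (f : Module.Dual k P) (g : Module.Dual k Q) (t : P ⊗[k] Q) :
    f (contractR P g t) = g (contractL Q f t) := by
  induction t using TensorProduct.induction_on with
  | zero => simp
  | tmul x y => simp [mul_comm]
  | add s t hs ht => simp only [map_add, hs, ht]

theorem eq_zero_of_contractR (t : P ⊗[k] Q) (h : ∀ g, contractR P g t = 0) : t = 0 := by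
  let b := Module.Basis.ofVectorSpace k Q
  classical
  apply (TensorProduct.equivFinsuppOfBasisRight b).injective
  rw [map_zero]
  ext i
  have : ∀ s : P ⊗[k] Q, TensorProduct.equivFinsuppOfBasisRight b s i =
      contractR P (b.coord i) s := by
    intro s
    induction s using TensorProduct.induction_on with
    | zero => simp
    | tmul p q => simp [TensorProduct.equivFinsuppOfBasisRight_apply_tmul]
    | add s t hs ht => simp [hs, ht]
  rw [this, h]
  rfl

theorem eq_zero_of_contractL (t : P ⊗[k] Q) (h : ∀ f, contractL Q f t = 0) : t = 0 := by
  refine eq_zero_of_contractR t fun g => ?_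
  rw [← Module.forall_dual_apply_eq_zero_iff k]
  intro f
  rw [dual_contract, h, map_zero]

end contraction

/-! ### Perfectness of the pairings `R_d ⊆ R_a ⊗ R_b` -/

section perfect

variable {k : Type u} [Field k] {V : Type u} [AddCommGroup V] [Module k V]
  {R : Submodule k (V ⊗[k] V)}

instance [FiniteDimensional k V] (a : ℕ) : FiniteDimensional k (Rpow R a) := by
  have h : FiniteDimensional k (tensorPow k V a) := by
    rw [← Submodule.fg_iff_finiteDimensional]
    refine Submodule.FG.pow ?_ a
    rw [LinearMap.range_eq_map]
    exact Module.Finite.fg_top.map _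
  exact Submodule.finiteDimensional_of_le (Rpow_le R a)

variable (R) in
/-- The identification of `V` with `R_1`. -/
def toRpowOne : V →ₗ[k] Rpow R 1 :=
  (TensorAlgebra.ι k).codRestrict (Rpow R 1) (fun v => by
    rw [Rpow_one, tensorPow_one]; exact ⟨v, rfl⟩)

@[simp]
theorem coe_toRpowOne (v : V) : (toRpowOne R v : TensorAlgebra k V) = TensorAlgebra.ι k v := rfl

theorem toRpowOne_bijective : Function.Bijective (toRpowOne R) := by
  constructor
  · intro v w h
    exact (TensorAlgebra.ι_inj k _ _).1 (congrArg Subtype.val h)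
  · rintro ⟨x, hx⟩
    have h := hx
    rw [Rpow_one, tensorPow_one] at h
    obtain ⟨v, rfl⟩ := h
    exact ⟨v, rfl⟩

theorem comul_eq_of_mulMap {n a b : ℕ} (h : n = a + b) (x : Rpow R n) (t : Rpow R a ⊗[k] Rpow R b)
    (ht : Submodule.mulMap (Rpow R a) (Rpow R b) t = x) : comul R h x = t :=
  mulMap_injective (Rpow_le R a) (Rpow_le R b) ((mulMap_comul R h x).trans ht.symm)

theorem comul_injective {n a b : ℕ} (h : n = a + b) : Function.Injective (comul R h) := by
  intro x y hxy
  refine Subtype.ext ?_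
  rw [← mulMap_comul R h x, hxy, mulMap_comul]

/-- Coassociativity, contracted on the right. -/
theorem comul_contractR {n a b c p q : ℕ} (h₁ : n = a + q)
    (h₂ : q = b + c) (h₃ : n = p + c) (h₄ : p = a + b) (g : Module.Dual k (Rpow R c))
    (x : Rpow R n) :
    comul R h₄ (contractR _ g (comul R h₃ x)) =
      (contractR _ g ∘ₗ comul R h₂).lTensor _ (comul R h₁ x) := by
  have e₁ : ∀ t, comul R h₄ (contractR _ g t) = contractR _ g ((comul R h₄).rTensor _ t) := by
    intro t
    induction t using TensorProduct.induction_on with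
    | zero => simp
    | tmul x y => simp
    | add s t hs ht => simp only [map_add, hs, ht]
  have e₂ : ∀ t : Rpow R a ⊗[k] (Rpow R b ⊗[k] Rpow R c),
      contractR _ g ((TensorProduct.assoc k _ _ _).symm t) = (contractR _ g).lTensor _ t := by
    intro t
    induction t using TensorProduct.induction_on with
    | zero => simp
    | tmul x y =>
      induction y using TensorProduct.induction_on with
      | zero => simp
      | tmul x y => simp
      | add s t hs ht => simp only [TensorProduct.tmul_add, map_add, hs, ht]
    | add s t hs ht => simp only [map_add, hs, ht]
  rw [e₁, LinearMap.lTensor_comp, LinearMap.comp_apply, ← comul_coassoc R h₁ h₂ h₃ h₄, ← e₂,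
    LinearEquiv.symm_apply_apply]

namespace LinearResolution

variable (P : LinearResolution R)

/-- The generators in homological degree `n`, as a basis of `R_n`. -/
def basis (n : ℕ) : Module.Basis (P.J n) k (Rpow R n) :=
  (Module.Basis.span (P.gen_basis n).1).map (LinearEquiv.ofEq _ _ (P.gen_basis n).2)

theorem coe_basis (n : ℕ) (j : P.J n) : (P.basis n j : TensorAlgebra k V) = P.gen n j := by
  simp [basis, Module.Basis.span_apply]

/-- In the bases given by the resolution, `R_{n+1} ⊆ V ⊗ R_n` has the same matrix as the
differential. So contraction with a functional on `R_n` becomes the coboundary of a constant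
cochain. -/
theorem comul_basis {n : ℕ} (h : n + 1 = 1 + n) (i : P.J (n + 1)) :
    comul R h (P.basis (n + 1) i) =
      (P.coef n i).sum fun j v => toRpowOne R v ⊗ₜ P.basis n j := by
  apply comul_eq_of_mulMap
  rw [coe_basis, gen_succ, combine_apply, Finsupp.sum_mapRange_index (by simp), Finsupp.sum,
    Finsupp.sum, map_sum]
  simp [coe_basis]

theorem contractR_comul_basis {n : ℕ} (h : n + 1 = 1 + n) (g : Module.Dual k (Rpow R n))
    (i : P.J (n + 1)) : contractR _ g (comul R h (P.basis (n + 1) i)) =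
      toRpowOne R (evalCoef (fun j => g (P.basis n j)) (P.coef n i)) := by
  rw [comul_basis, evalCoef, Finsupp.lsum_apply, Finsupp.sum, Finsupp.sum, map_sum, map_sum]
  simp

end LinearResolution

/-- If all contractions with `g` vanished, the cochain with constant values `g` would be a cocycle
in `Hom(P, A)`. It is then zero, because `Ext^n(k, A) = 0` and constant cochains are not
coboundaries. -/
theorem exists_contractR_ne_zero (P : LinearResolution R) {d : ℕ} (hR : IsASRegular R d)
    {n : ℕ} (hn : n ≠ d) (h : n + 1 = 1 + n) {g : Module.Dual k (Rpow R n)} (hg : g ≠ 0) :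
    ∃ x : Rpow R (n + 1), contractR _ g (comul R h x) ≠ 0 := by
  by_contra! H
  apply hg
  have h₁ := P.eq_zero_of_evalCoef (hR.ext_eq_zero n hn) (fun j => g (P.basis n j)) (fun i => by
    apply toRpowOne_bijective (R := R).1
    rw [← P.contractR_comul_basis h, H, map_zero])
  exact (P.basis n).ext fun j => congrFun h₁ j

/-- Induction on the codegree `m = d - b`: the functional `g` on `R_b` is enlarged to the
restriction of `f ⊗ g` to `R_{b+1} ⊆ V ⊗ R_b`, with `f` chosen to keep it nonzero, until the top
degree is reached. -/
theorem exists_contractR_top_ne_zero (P : LinearResolution R) {d : ℕ} (hR : IsASRegular R d)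
    (m : ℕ) : ∀ {b : ℕ} (h : d = m + b) {g : Module.Dual k (Rpow R b)} (_ : g ≠ 0),
    ∃ x : Rpow R d, contractR _ g (comul R h x) ≠ 0 := by
  induction m with
  | zero =>
    intro b h g hg
    obtain rfl : d = b := by omega
    obtain ⟨x, hx⟩ := DFunLike.ne_iff.1 hg
    refine ⟨x, ?_⟩
    rw [comul_zero_left, contractR_tmul]
    refine smul_ne_zero hx ?_
    rw [Ne, LinearEquiv.map_eq_zero_iff]
    exact one_ne_zero
  | succ m ih =>
    intro b h g hg
    obtain ⟨y, hy⟩ := exists_contractR_ne_zero P hR (n := b) (by omega) (by omega) hg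
    obtain ⟨f, hf⟩ : ∃ f : Module.Dual k (Rpow R 1),
        f (contractR _ g (comul R (show b + 1 = 1 + b by omega) y)) ≠ 0 := by
      by_contra! H
      exact hy ((Module.forall_dual_apply_eq_zero_iff k _).1 H)
    obtain ⟨x, hx⟩ := ih (b := b + 1) (by omega)
      (g := f ∘ₗ contractR _ g ∘ₗ comul R (show b + 1 = 1 + b by omega))
      (fun h0 => hf (LinearMap.congr_fun h0 y))
    refine ⟨x, fun h0 => hx ?_⟩
    -- By coassociativity, contraction of `x` with `f ⊗ g` is contraction with `g` followed by `f`.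
    have h₁ := comul_contractR (show d = m + (b + 1) by omega) (show b + 1 = 1 + b by omega) h
      (rfl : m + 1 = m + 1) g x
    rw [h0, map_zero] at h₁
    have h₂ : ∀ t : Rpow R m ⊗[k] Rpow R (b + 1),
        contractR _ (f ∘ₗ contractR _ g ∘ₗ comul R (show b + 1 = 1 + b by omega)) t =
        contractR _ f ((contractR _ g ∘ₗ comul R (show b + 1 = 1 + b by omega)).lTensor _ t) := by
      intro t
      induction t using TensorProduct.induction_on with
      | zero => simp
      | tmul x y => simp
      | add s t hs ht => simp only [map_add, hs, ht]
    rw [h₂, ← h₁, map_zero]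

/-- `P_d` has exactly one basis vector, so `R_d = kω`. Contraction with `ω` embeds `R_b^*` in `R_a`
for all `a + b = d`. Exchanging `a` and `b` makes the dimensions equal, so these maps are bijective,
and `slice` at `ω` is the transpose. -/
theorem isPerfect_of_linearResolution [FiniteDimensional k V] (P : LinearResolution R) {d : ℕ}
    (hR : IsASRegular R d) : IsPerfect R d := by
  have hJ : IsEmpty (P.J (d + 1)) := P.isEmpty_J (hR.subsingleton_ext _)
  have h₁ : Subsingleton (P.J d) := P.subsingleton_J hR.finrank_ext
  have h₂ : Nonempty (P.J d) := P.nonempty_J (Module.nontrivial_of_finrank_eq_succ hR.finrank_ext)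
  obtain ⟨i⟩ := h₂
  have hd : Module.finrank k (Rpow R d) = 1 := by
    have : Unique (P.J d) := ⟨⟨i⟩, fun _ => Subsingleton.elim _ _⟩
    rw [Module.finrank_eq_card_basis (P.basis d), Fintype.card_unique]
  obtain ⟨ω, hω₀, hω⟩ := finrank_eq_one_iff'.1 hd
  have hinj : ∀ {a b : ℕ} (h : d = a + b), Function.Injective
      ((contractR (k := k) (Rpow R a)).flip (comul R h ω)) := by
    intro a b h
    rw [injective_iff_map_eq_zero]
    intro g hg
    by_contra hg0
    obtain ⟨x, hx⟩ := exists_contractR_top_ne_zero P hR a h hg0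
    obtain ⟨c, rfl⟩ := hω x
    apply hx
    rw [map_smul, map_smul]
    exact (congrArg (c • ·) hg).trans (smul_zero c)
  have hle : ∀ {a b : ℕ} (h : d = a + b),
      Module.finrank k (Rpow R b) ≤ Module.finrank k (Rpow R a) := by
    intro a b h
    have := LinearMap.finrank_le_finrank_of_injective (hinj h)
    rwa [Subspace.dual_finrank_eq] at this
  have heq : ∀ {a b : ℕ} (h : d = a + b),
      Module.finrank k (Rpow R b) = Module.finrank k (Rpow R a) := fun {a b} h =>
    le_antisymm (hle h) (hle (show d = b + a by omega))
  refine ⟨hd, fun {a b} h => ?_⟩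
  have hs : Function.Surjective ((contractR (k := k) (Rpow R a)).flip (comul R h ω)) := by
    refine (LinearMap.injective_iff_surjective_of_finrank_eq_finrank ?_).1 (hinj h)
    rw [Subspace.dual_finrank_eq, heq h]
  have hi : Function.Injective (slice R h) := by
    rw [injective_iff_map_eq_zero]
    intro f hf
    ext y
    obtain ⟨g, rfl⟩ := hs y
    have := LinearMap.congr_fun hf ω
    rw [slice_apply] at this
    rw [LinearMap.flip_apply, dual_contract, this]
    simp
  have hext : ∀ F G : Rpow R d →ₗ[k] Rpow R b, F ω = G ω → F = G := by
    intro F G hFG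
    ext1 x
    obtain ⟨c, rfl⟩ := hω x
    rw [map_smul, map_smul, hFG]
  have hi' : Function.Injective ((contractL (k := k) (Rpow R b)).flip (comul R h ω)) :=
    fun f g hfg => hi (hext _ _ hfg)
  have hs' := (LinearMap.injective_iff_surjective_of_finrank_eq_finrank
    (by rw [Subspace.dual_finrank_eq, heq h])).1 hi'
  refine ⟨hi, fun F => ?_⟩
  obtain ⟨f, hf⟩ := hs' (F ω)
  exact ⟨f, hext _ _ hf⟩

end perfect

/-! ### Naturality of contractions -/

section tensors

variable {k : Type u} [Field k]

theorem contractL_lTensor {P Q Q' : Type u} [AddCommGroup P] [Module k P] [AddCommGroup Q]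
    [Module k Q] [AddCommGroup Q'] [Module k Q'] (f : Module.Dual k P) (F : Q →ₗ[k] Q')
    (t : P ⊗[k] Q) : contractL Q' f (F.lTensor P t) = F (contractL Q f t) := by
  induction t using TensorProduct.induction_on with
  | zero => simp
  | tmul x y => simp
  | add s t hs ht => simp only [map_add, hs, ht]

theorem contractR_rTensor {P P' Q : Type u} [AddCommGroup P] [Module k P] [AddCommGroup P']
    [Module k P'] [AddCommGroup Q] [Module k Q] (g : Module.Dual k Q) (F : P →ₗ[k] P')
    (t : P ⊗[k] Q) : contractR P' g (F.rTensor Q t) = F (contractR P g t) := by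
  induction t using TensorProduct.induction_on with
  | zero => simp
  | tmul x y => simp
  | add s t hs ht => simp only [map_add, hs, ht]

theorem contractR_comm {P Q : Type u} [AddCommGroup P] [Module k P] [AddCommGroup Q]
    [Module k Q] (f : Module.Dual k P) (t : P ⊗[k] Q) :
    contractR Q f (TensorProduct.comm k P Q t) = contractL Q f t := by
  induction t using TensorProduct.induction_on with
  | zero => simp
  | tmul x y => simp
  | add s t hs ht => simp only [map_add, hs, ht]

theorem exists_dual_ne_zero {W : Type u} [AddCommGroup W] [Module k W] {x : W} (hx : x ≠ 0) :
    ∃ f : Module.Dual k W, f x ≠ 0 := by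
  by_contra! H
  exact hx ((Module.forall_dual_apply_eq_zero_iff k _).1 H)

end tensors

/-! ### Nonvanishing of contractions, from the perfect pairings -/

section nondegenerate

variable {k : Type u} [Field k] {V : Type u} [AddCommGroup V] [Module k V]
  {R : Submodule k (V ⊗[k] V)} {d : ℕ}

theorem IsPerfect.exists_slice_eq (hp : IsPerfect R d) {a b : ℕ} (h : d = a + b) {ω : Rpow R d} (hω : ω ≠ 0)
    (y : Rpow R b) : ∃ f, slice R h f ω = y := by
  obtain ⟨ψ, hψ⟩ := exists_dual_ne_zero (k := k) hω
  obtain ⟨f, hf⟩ := (hp.bijective h).2 (((ψ ω)⁻¹ • ψ).smulRight y)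
  refine ⟨f, ?_⟩
  rw [hf]
  simp [hψ]

theorem IsPerfect.slice_ne_zero (hp : IsPerfect R d) {a b : ℕ} (h : d = a + b) {ω : Rpow R d} (hω : ω ≠ 0)
    {f : Module.Dual k (Rpow R a)} (hf : f ≠ 0) : slice R h f ω ≠ 0 := by
  intro h0
  apply hf
  apply (hp.bijective h).1
  rw [map_zero]
  ext1 x
  obtain ⟨c, rfl⟩ := (finrank_eq_one_iff_of_nonzero' ω hω).1 hp.finrank_eq_one x
  rw [map_smul, h0]
  simp

theorem IsPerfect.contractR_ne_zero (hp : IsPerfect R d) {a b : ℕ} (h : d = a + b) {ω : Rpow R d} (hω : ω ≠ 0)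
    {g : Module.Dual k (Rpow R b)} (hg : g ≠ 0) : contractR _ g (comul R h ω) ≠ 0 := by
  intro h0
  obtain ⟨y, hy⟩ := DFunLike.ne_iff.1 hg
  obtain ⟨f, rfl⟩ := hp.exists_slice_eq h hω y
  apply hy
  rw [slice_apply, ← dual_contract, h0, map_zero]
  rfl

theorem IsPerfect.exists_ne_zero (hp : IsPerfect R d) : ∃ ω : Rpow R d, ω ≠ 0 := by
  obtain ⟨ω, hω, -⟩ := finrank_eq_one_iff'.1 hp.finrank_eq_one
  exact ⟨ω, hω⟩

/-- Every nonzero functional on `R_1` can be contracted with the right end of `R_{c+1}`. -/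
theorem IsPerfect.exists_contractR_ne_zero (hp : IsPerfect R d) {c n : ℕ} (hn : n = c + 1) (hc : n ≤ d)
    {ξ : Module.Dual k (Rpow R 1)} (hξ : ξ ≠ 0) :
    ∃ y : Rpow R n, contractR _ ξ (comul R hn y) ≠ 0 := by
  obtain ⟨ω, hω⟩ := hp.exists_ne_zero
  have h₃ : d = (d - 1) + 1 := by omega
  have h₄ : d - 1 = (d - n) + c := by omega
  have hw := hp.contractR_ne_zero h₃ hω hξ
  have hw' : comul R h₄ (contractR _ ξ (comul R h₃ ω)) ≠ 0 := fun h0 =>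
    hw (comul_injective h₄ (h0.trans (map_zero _).symm))
  obtain ⟨f, hf⟩ : ∃ f, contractL _ f (comul R h₄ (contractR _ ξ (comul R h₃ ω))) ≠ 0 := by
    by_contra! H
    exact hw' (eq_zero_of_contractL _ H)
  -- Contracting `ω` on the right with `ξ` gives a nonzero element. A functional `f` on its left
  -- factor `R_{d-n}` keeps it nonzero, and the two contractions commute.
  refine ⟨slice R (show d = (d - n) + n by omega) f ω, ?_⟩
  rw [comul_contractR (show d = (d - n) + n by omega) hn h₃ h₄, contractL_lTensor] at hf
  exact hf

/-- Every nonzero functional on `R_1` can be contracted with the left end of `R_{1+c}`. -/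
theorem IsPerfect.exists_contractL_ne_zero (hp : IsPerfect R d) {c n : ℕ} (hn : n = 1 + c) (hc : n ≤ d)
    {ξ : Module.Dual k (Rpow R 1)} (hξ : ξ ≠ 0) :
    ∃ y : Rpow R n, contractL _ ξ (comul R hn y) ≠ 0 := by
  obtain ⟨ω, hω⟩ := hp.exists_ne_zero
  have h₁ : d = 1 + (d - 1) := by omega
  have h₂ : d - 1 = c + (d - n) := by omega
  have hw := hp.slice_ne_zero h₁ hω hξ
  have hw' : comul R h₂ (slice R h₁ ξ ω) ≠ 0 := fun h0 =>
    hw (comul_injective h₂ (h0.trans (map_zero _).symm))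
  obtain ⟨g, hg⟩ : ∃ g, contractR _ g (comul R h₂ (slice R h₁ ξ ω)) ≠ 0 := by
    by_contra! H
    exact hw' (eq_zero_of_contractR _ H)
  -- The mirror image: contract `ω` on the left with `ξ` first, then cut off `R_{d-n}` on the right.
  refine ⟨contractR _ g (comul R (show d = n + (d - n) by omega) ω), ?_⟩
  rw [comul_slice R h₁ h₂ (show d = n + (d - n) by omega) hn, contractR_rTensor] at hg
  exact hg

/-- `R_a` is nonzero for `a ≤ d`, because `R_a ⊗ R_{d-a}` contains `R_d`. -/
theorem IsPerfect.exists_dual_pair (hp : IsPerfect R d) {a : ℕ} (ha : a ≤ d) :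
    ∃ (y : Rpow R a) (f : Module.Dual k (Rpow R a)), f y ≠ 0 := by
  obtain ⟨ω, hω⟩ := hp.exists_ne_zero
  obtain ⟨f, hf⟩ : ∃ f, contractL _ f (comul R (show d = a + (d - a) by omega) ω) ≠ 0 := by
    by_contra! H
    exact hω (comul_injective _ ((eq_zero_of_contractL _ H).trans (map_zero _).symm))
  have : f ≠ 0 := by
    rintro rfl
    simp at hf
  obtain ⟨y, hy⟩ := DFunLike.ne_iff.1 this
  exact ⟨y, f, hy⟩

end nondegenerate

/-! ### Maps to `A` that begin with the action of the first letter, for both sides at once -/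

section calculus

variable {k : Type u} [Field k] {V : Type u} [AddCommGroup V] [Module k V]

/-- A coassociative family of maps `R_{a+b} → R_a ⊗ R_b`, and an action of `R_1` on `A` for
which the composition of two actions vanishes on `R_2`. There are two instances: the inclusions
with left multiplication, and their opposites with right multiplication. -/
structure Calculus (R : Submodule k (V ⊗[k] V)) (d : ℕ) (A : Type u) [AddCommGroup A]
    [Module k A] where
  /-- The comultiplication. -/
  δ : ∀ {n a b : ℕ}, n = a + b → (Rpow R n →ₗ[k] Rpow R a ⊗[k] Rpow R b)
  coassoc : ∀ {n a b c p q : ℕ} (h₁ : n = a + q) (h₂ : q = b + c) (h₃ : n = p + c) (h₄ : p = a + b)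
    (x : Rpow R n), TensorProduct.assoc k _ _ _ ((δ h₄).rTensor _ (δ h₃ x)) =
      (δ h₂).lTensor _ (δ h₁ x)
  counit : ∀ {a : ℕ} (h : a = a + 0) (x : Rpow R a), δ h x = x ⊗ₜ rZero R 1
  δ_injective : ∀ {n a b : ℕ} (h : n = a + b), Function.Injective (δ h)
  exists_contractR : ∀ {n c : ℕ} (h : n = c + 1) (_ : n ≤ d) {ξ : Module.Dual k (Rpow R 1)}
    (_ : ξ ≠ 0), ∃ y, contractR _ ξ (δ h y) ≠ 0
  /-- The unit of `A`. -/
  one : A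
  /-- The action. -/
  act : Rpow R 1 ⊗[k] A →ₗ[k] A
  act_act : ∀ {n : ℕ} (h : n = 1 + 1), act ∘ₗ act.lTensor (Rpow R 1) ∘ₗ
    (TensorProduct.assoc k _ _ _).toLinearMap ∘ₗ (δ h).rTensor A = 0
  act_one : ∀ v, act (v ⊗ₜ one) = 0 → v = 0
  act_eq_zero : ∀ b, (∀ v, act (v ⊗ₜ b) = 0) → b = 0

namespace Calculus

variable {R : Submodule k (V ⊗[k] V)} {d : ℕ} {A : Type u} [AddCommGroup A] [Module k A]
  (S : Calculus R d A)

/-- The map `δ ⊗ W`. -/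
def phi {n a b : ℕ} (h : n = a + b) (W : Type u) [AddCommMonoid W] [Module k W] :
    Rpow R n ⊗[k] W →ₗ[k] Rpow R a ⊗[k] (Rpow R b ⊗[k] W) :=
  (TensorProduct.assoc k _ _ _).toLinearMap ∘ₗ (S.δ h).rTensor W

variable (W W' : Type u) [AddCommMonoid W] [Module k W] [AddCommMonoid W'] [Module k W']

@[simp]
theorem phi_tmul {n a b : ℕ} (h : n = a + b) (x : Rpow R n) (w : W) :
    S.phi h W (x ⊗ₜ w) = TensorProduct.assoc k _ _ _ (S.δ h x ⊗ₜ w) := rfl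

theorem phi_phi {n a b c p q : ℕ} (h₁ : n = a + q)
    (h₂ : q = b + c) (h₃ : n = p + c) (h₄ : p = a + b) :
    (S.phi h₂ W).lTensor (Rpow R a) ∘ₗ S.phi h₁ W =
      S.phi h₄ (Rpow R c ⊗[k] W) ∘ₗ S.phi h₃ W := by
  let A : (Rpow R a ⊗[k] (Rpow R b ⊗[k] Rpow R c)) ⊗[k] W →ₗ[k]
      Rpow R a ⊗[k] (Rpow R b ⊗[k] (Rpow R c ⊗[k] W)) :=
    (TensorProduct.assoc k _ _ _).toLinearMap.lTensor _ ∘ₗ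
      (TensorProduct.assoc k _ _ _).toLinearMap
  ext x w
  have e₁ : ∀ t : Rpow R a ⊗[k] Rpow R q, (S.phi h₂ W).lTensor (Rpow R a)
      (TensorProduct.assoc k _ _ _ (t ⊗ₜ w)) = A ((S.δ h₂).lTensor _ t ⊗ₜ w) := by
    intro t
    induction t using TensorProduct.induction_on with
    | zero => simp
    | tmul x y => simp [A]
    | add s t hs ht => simp only [TensorProduct.add_tmul, map_add, hs, ht]
  have e₃ : ∀ (s : Rpow R a ⊗[k] Rpow R b) (z : Rpow R c),
      TensorProduct.assoc k _ _ _ (s ⊗ₜ[k] (z ⊗ₜ[k] w)) =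
        A (TensorProduct.assoc k _ _ _ (s ⊗ₜ z) ⊗ₜ w) := by
    intro s z
    induction s using TensorProduct.induction_on with
    | zero => simp
    | tmul x y => simp [A]
    | add s t hs ht => simp only [TensorProduct.add_tmul, map_add, hs, ht]
  have e₂ : ∀ t : Rpow R p ⊗[k] Rpow R c, S.phi h₄ (Rpow R c ⊗[k] W)
      (TensorProduct.assoc k _ _ _ (t ⊗ₜ w)) =
        A (TensorProduct.assoc k _ _ _ ((S.δ h₄).rTensor _ t) ⊗ₜ w) := by
    intro t
    induction t using TensorProduct.induction_on with
    | zero => simp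
    | tmul x y => rw [TensorProduct.assoc_tmul, phi_tmul, e₃, LinearMap.rTensor_tmul]
    | add s t hs ht => simp only [TensorProduct.add_tmul, map_add, hs, ht]
  simp only [TensorProduct.AlgebraTensorModule.curry_apply, LinearMap.restrictScalars_self,
    TensorProduct.curry_apply, LinearMap.comp_apply, phi_tmul]
  rw [e₁, e₂, S.coassoc h₁ h₂ h₃ h₄]

variable {W W'}

theorem phi_nat {n a b : ℕ} (h : n = a + b) (f : W →ₗ[k] W') :
    (f.lTensor (Rpow R b)).lTensor (Rpow R a) ∘ₗ S.phi h W =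
      S.phi h W' ∘ₗ f.lTensor (Rpow R n) := by
  ext x w
  have e₁ : ∀ t : Rpow R a ⊗[k] Rpow R b, (f.lTensor (Rpow R b)).lTensor (Rpow R a)
      (TensorProduct.assoc k _ _ _ (t ⊗ₜ[k] w)) = TensorProduct.assoc k _ _ _ (t ⊗ₜ[k] f w) := by
    intro t
    induction t using TensorProduct.induction_on with
    | zero => simp
    | tmul x y => simp
    | add s t hs ht => simp only [TensorProduct.add_tmul, map_add, hs, ht]
  exact e₁ _

/-- The maps `R_a ⊗ W → A`, `r ⊗ w ↦ ∑ r₍₁₎ · G(r₍₂₎ ⊗ w)`. -/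
def lead {a b : ℕ} (h : a = 1 + b) (G : Rpow R b ⊗[k] W →ₗ[k] A) :
    Rpow R a ⊗[k] W →ₗ[k] A :=
  S.act ∘ₗ G.lTensor (Rpow R 1) ∘ₗ S.phi h W

theorem lead_comp_lTensor {a b : ℕ} (h : a = 1 + b) (G : Rpow R b ⊗[k] W' →ₗ[k] A)
    (f : W →ₗ[k] W') : S.lead h G ∘ₗ f.lTensor _ = S.lead h (G ∘ₗ f.lTensor _) := by
  rw [lead, lead, LinearMap.comp_assoc, LinearMap.comp_assoc, ← phi_nat, LinearMap.lTensor_comp]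
  rfl

/-- The functional `f`, as a map `R_b ⊗ k → A` with values in `k`. -/
def const {b : ℕ} (f : Module.Dual k (Rpow R b)) : Rpow R b ⊗[k] k →ₗ[k] A :=
  (LinearMap.toSpanSingleton k A S.one ∘ₗ f) ∘ₗ (TensorProduct.rid k _).toLinearMap

theorem lead_const {a b : ℕ} (h : a = 1 + b) (f : Module.Dual k (Rpow R b)) (x : Rpow R a) :
    S.lead h (S.const f) (x ⊗ₜ 1) = S.act (contractR _ f (S.δ h x) ⊗ₜ S.one) := by
  have e : ∀ t : Rpow R 1 ⊗[k] Rpow R b, S.act ((S.const f).lTensor (Rpow R 1)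
      (TensorProduct.assoc k _ _ _ (t ⊗ₜ (1 : k)))) = S.act (contractR _ f t ⊗ₜ S.one) := by
    intro t
    induction t using TensorProduct.induction_on with
    | zero => simp
    | tmul x y => simp [const, TensorProduct.smul_tmul']
    | add s t hs ht => simp only [TensorProduct.add_tmul, map_add, hs, ht]
  exact e _

/-- A nonzero `x` has a nonzero component in `R_1 ⊗ R_b`. Some functional on `R_b` leaves a nonzero
letter, and letters act faithfully on the unit. -/
theorem exists_lead_const_ne_zero {a b : ℕ} (h : a = 1 + b) {x : Rpow R a} (hx : x ≠ 0) :
    ∃ f : Module.Dual k (Rpow R b), S.lead h (S.const f) (x ⊗ₜ 1) ≠ 0 := by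
  obtain ⟨f, hf⟩ : ∃ f, contractR _ f (S.δ h x) ≠ 0 := by
    by_contra! H
    exact hx (S.δ_injective h ((eq_zero_of_contractR _ H).trans (map_zero _).symm))
  exact ⟨f, fun h0 => hf (S.act_one _ ((S.lead_const h f x).symm.trans h0))⟩

theorem act_act' {n : ℕ} (h : n = 1 + 1) :
    S.act ∘ₗ S.act.lTensor (Rpow R 1) ∘ₗ S.phi h A = 0 := S.act_act h

theorem lead_unit (h : 1 = 1 + 0) : S.lead h (unitEquiv R A).toLinearMap = S.act := by
  ext x b
  simp [lead, S.counit, unitEquiv]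

/-- Removing the last letter and removing the first letter commute. So a map that consumes the last
letter by `ζ`, and then lets the first letter act, is again of the form `lead`. -/
theorem lead_slide {c c₁ e : ℕ} (i₁ : c = c₁ + 1) (i₂ : c₁ = e + 1) (i₃ : c = 1 + c₁)
    (i₄ : c₁ = 1 + e) (ζ : Rpow R 1 ⊗[k] A →ₗ[k] W) (F : Rpow R e ⊗[k] W →ₗ[k] A) :
    S.lead i₃ (F ∘ₗ ζ.lTensor (Rpow R e) ∘ₗ S.phi i₂ A) =
      S.lead i₄ F ∘ₗ ζ.lTensor (Rpow R c₁) ∘ₗ S.phi i₁ A := by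
  refine LinearMap.ext fun t => ?_
  have h₁ := LinearMap.congr_fun (S.phi_phi A i₃ i₂ i₁ i₄) t
  have h₂ := LinearMap.congr_fun (S.phi_nat i₄ ζ) (S.phi i₁ A t)
  simp only [LinearMap.comp_apply] at h₁ h₂
  simp only [lead, LinearMap.comp_apply, LinearMap.lTensor_comp_apply]
  rw [h₁, h₂]

/-- On `R_{c+1}` the last two letters lie in `R_2`, by coassociativity. So a vanishing condition on
`R_2 ⊗ A` can be imposed behind an arbitrary `R_{c₁}`. -/
theorem lTensor_comp_phi_eq_zero {c c₁ : ℕ} (i₁ : c = c₁ + 1) {ζ : Rpow R 1 ⊗[k] A →ₗ[k] W}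
    (hζ : ζ ∘ₗ S.act.lTensor (Rpow R 1) ∘ₗ S.phi (rfl : 1 + 1 = 1 + 1) A = 0) :
    ζ.lTensor (Rpow R c₁) ∘ₗ S.phi i₁ A ∘ₗ S.act.lTensor (Rpow R c) ∘ₗ
      S.phi (rfl : c + 1 = c + 1) A = 0 := by
  rw [← LinearMap.comp_assoc (S.phi (rfl : c + 1 = c + 1) A), ← phi_nat, LinearMap.comp_assoc,
    ← S.phi_phi A (show c + 1 = c₁ + (1 + 1) by omega) (rfl : 1 + 1 = 1 + 1) rfl i₁,
    ← LinearMap.comp_assoc, ← LinearMap.comp_assoc, ← LinearMap.lTensor_comp,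
    ← LinearMap.lTensor_comp, LinearMap.comp_assoc, hζ, LinearMap.lTensor_zero,
    LinearMap.zero_comp]

theorem lTensor_assoc_tmul {c : ℕ} (ζ : Rpow R 1 ⊗[k] A →ₗ[k] k) (b : A)
    (t : Rpow R c ⊗[k] Rpow R 1) :
    ζ.lTensor (Rpow R c) (TensorProduct.assoc k _ _ _ (t ⊗ₜ b)) =
      contractR _ (ζ ∘ₗ (TensorProduct.mk k _ _).flip b) t ⊗ₜ 1 := by
  induction t using TensorProduct.induction_on with
  | zero => simp
  | tmul x y => simp [TensorProduct.smul_tmul]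
  | add s t hs ht => simp only [TensorProduct.add_tmul, map_add, hs, ht]

/-- Choose a letter `v` with `v · b ≠ 0`. For `c = 1` the map is the action itself. Otherwise take a
functional `β` on `A` with `β(v · b) ≠ 0`, let the last letter of `R_c` act, apply `β`, and map the
remaining `R_{c-1}` to `A` through its first letter. On `R_{c+1} ⊗ A` two consecutive letters of
`R_2` act, which gives zero. -/
theorem exists_extension_aux {c : ℕ} (hc : 0 < c) (hcd : c ≤ d) {b : A} (hb : b ≠ 0) :
    ∃ (c' : ℕ) (h : c = 1 + c') (Γ : Rpow R c' ⊗[k] A →ₗ[k] A) (y : Rpow R c),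
      S.lead h Γ (y ⊗ₜ b) ≠ 0 ∧
      S.lead h Γ ∘ₗ S.act.lTensor (Rpow R c) ∘ₗ S.phi (rfl : c + 1 = c + 1) A = 0 := by
  obtain ⟨v, hv⟩ : ∃ v, S.act (v ⊗ₜ b) ≠ 0 := by
    by_contra! H
    exact hb (S.act_eq_zero b H)
  obtain rfl | ⟨c₁, e, i₁, i₂, i₃, i₄⟩ : c = 1 ∨ ∃ c₁ e, c = c₁ + 1 ∧ c₁ = e + 1 ∧ c = 1 + c₁ ∧
      c₁ = 1 + e := by
    rcases c with _ | _ | e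
    · omega
    · exact Or.inl rfl
    · exact Or.inr ⟨e + 1, e, by omega⟩
  · refine ⟨0, rfl, (unitEquiv R A).toLinearMap, v, ?_, ?_⟩
    · rw [S.lead_unit]; exact hv
    · rw [S.lead_unit]; exact S.act_act' rfl
  · obtain ⟨β, hβ⟩ := exists_dual_ne_zero (k := k) hv
    -- The functional `ξ = β(- · b)` on letters is nonzero, so contracting the last letter of a
    -- suitable `y ∈ R_c` with it leaves a nonzero element of `R_{c-1}`.
    have hξ : (β ∘ₗ S.act) ∘ₗ (TensorProduct.mk k _ _).flip b ≠ 0 := fun h =>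
      hβ (LinearMap.congr_fun h v)
    obtain ⟨y, hy⟩ := S.exists_contractR i₁ hcd hξ
    obtain ⟨f, hf⟩ := S.exists_lead_const_ne_zero i₄ hy
    refine ⟨c₁, i₃, S.const f ∘ₗ (β ∘ₗ S.act).lTensor (Rpow R e) ∘ₗ S.phi i₂ A, y, ?_, ?_⟩
    · rw [S.lead_slide i₁ i₂ i₃ i₄, LinearMap.comp_apply, LinearMap.comp_apply, phi_tmul,
        lTensor_assoc_tmul]
      exact hf
    · have z₀ : (β ∘ₗ S.act) ∘ₗ S.act.lTensor (Rpow R 1) ∘ₗ S.phi (rfl : 1 + 1 = 1 + 1) A = 0 :=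
        (congrArg (β ∘ₗ ·) (S.act_act' rfl)).trans (LinearMap.comp_zero _)
      rw [S.lead_slide i₁ i₂ i₃ i₄, LinearMap.comp_assoc, LinearMap.comp_assoc,
        S.lTensor_comp_phi_eq_zero i₁ z₀, LinearMap.comp_zero]

/-- A map `R_a ⊗ W → A` that starts with the action of the first factor can be extended to
`R_c ⊗ R_a ⊗ W`, such that it vanishes on `R_{c+a} ⊗ W`. -/
theorem exists_extension {a a' c : ℕ} (ha : a = 1 + a') (hc : 0 < c) (hcd : c ≤ d)
    (G : Rpow R a' ⊗[k] W →ₗ[k] A) {m : Rpow R a ⊗[k] W} (hm : S.lead ha G m ≠ 0) :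
    ∃ (c' : ℕ) (h : c = 1 + c') (Γ : Rpow R c' ⊗[k] A →ₗ[k] A) (y : Rpow R c),
      S.lead h Γ (y ⊗ₜ S.lead ha G m) ≠ 0 ∧
      ∀ {n : ℕ} (hn : n = c + a),
        S.lead h Γ ∘ₗ (S.lead ha G).lTensor (Rpow R c) ∘ₗ S.phi hn W = 0 := by
  obtain ⟨c', h, Γ, y, h₁, h₂⟩ := S.exists_extension_aux hc hcd hm
  refine ⟨c', h, Γ, y, h₁, fun {n} hn => ?_⟩
  -- By coassociativity `R_{c+a} ⊆ R_c ⊗ R_1 ⊗ R_{a'}` goes through `R_{c+1} ⊗ R_{a'}`, so the first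
  -- letter of `R_a` can be joined to `R_c`.
  have : (S.lead ha G).lTensor (Rpow R c) ∘ₗ S.phi hn W = S.act.lTensor (Rpow R c) ∘ₗ
      S.phi (rfl : c + 1 = c + 1) A ∘ₗ G.lTensor _ ∘ₗ
        S.phi (show n = (c + 1) + a' by omega) W := by
    rw [lead, LinearMap.lTensor_comp, LinearMap.lTensor_comp, LinearMap.comp_assoc,
      LinearMap.comp_assoc, S.phi_phi W hn ha (show n = (c + 1) + a' by omega) rfl,
      ← LinearMap.comp_assoc (S.phi _ W), S.phi_nat, LinearMap.comp_assoc]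
  rw [this, ← LinearMap.comp_assoc (G.lTensor _ ∘ₗ _), ← LinearMap.comp_assoc, h₂,
    LinearMap.zero_comp]

end Calculus
end calculus

/-! ### The two calculi: left multiplication, and reversed inclusions with right multiplication -/

section instances

variable {k : Type u} [Field k] {V : Type u} [AddCommGroup V] [Module k V]
  {R : Submodule k (V ⊗[k] V)} {d : ℕ}

theorem QuadAlg.mk_Rpow_two {n : ℕ} (h : n = 1 + 1) (x : Rpow R n) : QuadAlg.mk R x = 0 := by
  subst h
  suffices h : Rpow R (1 + 1) ≤ relations R by
    exact QuadAlg.mk_relations R (h x.2)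
  refine inf_le_right.trans ((iInf₂_le 0 0).trans ((iInf_le _ rfl).trans ?_))
  simp [tensorPow]

/-- `R_1` in `A`. -/
def degreeOne (R : Submodule k (V ⊗[k] V)) : Rpow R 1 →ₗ[k] QuadAlg R :=
  (QuadAlg.mk R).toLinearMap ∘ₗ (Rpow R 1).subtype

@[simp]
theorem degreeOne_toRpowOne (v : V) : degreeOne R (toRpowOne R v) = QuadAlg.ι R v := rfl

theorem degreeOne_injective : Function.Injective (degreeOne R) := by
  intro x y h
  obtain ⟨v, rfl⟩ := toRpowOne_bijective.2 x
  obtain ⟨w, rfl⟩ := toRpowOne_bijective.2 y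
  rw [degreeOne_toRpowOne, degreeOne_toRpowOne] at h
  rw [QuadAlg.ι_injective R h]

/-- Left multiplication with `R_1`. -/
def leftAct (R : Submodule k (V ⊗[k] V)) : Rpow R 1 ⊗[k] QuadAlg R →ₗ[k] QuadAlg R :=
  TensorProduct.lift (LinearMap.mul k (QuadAlg R) ∘ₗ degreeOne R)

/-- Right multiplication with `R_1`. -/
def rightAct (R : Submodule k (V ⊗[k] V)) : Rpow R 1 ⊗[k] QuadAlg R →ₗ[k] QuadAlg R :=
  TensorProduct.lift ((LinearMap.mul k (QuadAlg R)).flip ∘ₗ degreeOne R)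

@[simp]
theorem leftAct_tmul (x : Rpow R 1) (b : QuadAlg R) : leftAct R (x ⊗ₜ b) = QuadAlg.mk R x * b :=
  rfl

@[simp]
theorem rightAct_tmul (x : Rpow R 1) (b : QuadAlg R) : rightAct R (x ⊗ₜ b) = b * QuadAlg.mk R x :=
  rfl

theorem leftAct_leftAct (t : Rpow R 1 ⊗[k] Rpow R 1) (b : QuadAlg R) :
    leftAct R ((leftAct R).lTensor _ (TensorProduct.assoc k _ _ _ (t ⊗ₜ b))) =
      QuadAlg.mk R (Submodule.mulMap _ _ t) * b := by
  induction t using TensorProduct.induction_on with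
  | zero => simp
  | tmul x y => simp [mul_assoc]
  | add s t hs ht => simp only [TensorProduct.add_tmul, map_add, hs, ht, add_mul]

theorem rightAct_rightAct (t : Rpow R 1 ⊗[k] Rpow R 1) (b : QuadAlg R) :
    rightAct R ((rightAct R).lTensor _ (TensorProduct.assoc k _ _ _
      (TensorProduct.comm k _ _ t ⊗ₜ b))) = b * QuadAlg.mk R (Submodule.mulMap _ _ t) := by
  induction t using TensorProduct.induction_on with
  | zero => simp
  | tmul x y => simp [mul_assoc]
  | add s t hs ht => simp only [TensorProduct.add_tmul, map_add, hs, ht, mul_add]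

/-- The inclusions `R_{a+b} ⊆ R_a ⊗ R_b` and left multiplication. -/
def leftCalculus (hp : IsPerfect R d)
    (hA : ∀ z : QuadAlg R, (∀ v, QuadAlg.ι R v * z = 0) → z = 0) :
    Calculus R d (QuadAlg R) where
  δ h := comul R h
  coassoc h₁ h₂ h₃ h₄ x := comul_coassoc R h₁ h₂ h₃ h₄ x
  counit h x := comul_zero_right R h x
  δ_injective h := comul_injective h
  exists_contractR h hd _ hξ := hp.exists_contractR_ne_zero h hd hξ
  one := 1
  act := leftAct R
  act_act h := by
    refine TensorProduct.ext' fun x b => ?_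
    refine (leftAct_leftAct _ b).trans ?_
    rw [mulMap_comul, QuadAlg.mk_Rpow_two h, zero_mul]
    rfl
  act_one v hv := degreeOne_injective (by
    rw [map_zero]
    exact (mul_one _).symm.trans hv)
  act_eq_zero b hb := hA b fun v => hb (toRpowOne R v)

/-- The reversed inclusion `R_{b+a} ⊆ R_a ⊗ R_b`. -/
def comulOp (R : Submodule k (V ⊗[k] V)) {n a b : ℕ} (h : n = a + b) :
    Rpow R n →ₗ[k] Rpow R a ⊗[k] Rpow R b :=
  (TensorProduct.comm k _ _).toLinearMap ∘ₗ comul R (h.trans (Nat.add_comm a b))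

theorem comulOp_apply {n a b : ℕ} (h : n = a + b) (h' : n = b + a) (x : Rpow R n) :
    comulOp R h x = TensorProduct.comm k _ _ (comul R h' x) := rfl

/-- This is coassociativity of the inclusions read backwards; `Φ` reverses the order of the three
factors. -/
theorem comulOp_coassoc {n a b c p q : ℕ} (h₁ : n = a + q) (h₂ : q = b + c) (h₃ : n = p + c)
    (h₄ : p = a + b) (x : Rpow R n) :
    TensorProduct.assoc k _ _ _ ((comulOp R h₄).rTensor _ (comulOp R h₃ x)) =
      (comulOp R h₂).lTensor _ (comulOp R h₁ x) := by
  let Φ : Rpow R c ⊗[k] (Rpow R b ⊗[k] Rpow R a) →ₗ[k] Rpow R a ⊗[k] (Rpow R b ⊗[k] Rpow R c) :=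
    (TensorProduct.assoc k _ _ _).toLinearMap ∘ₗ
      (TensorProduct.comm k _ _).toLinearMap.rTensor (Rpow R c) ∘ₗ
        (TensorProduct.comm k _ _).toLinearMap
  have i₃ : n = c + p := by omega
  have i₄ : p = b + a := by omega
  have i₁ : n = q + a := by omega
  have i₂ : q = c + b := by omega
  have e₁ : ∀ t : Rpow R c ⊗[k] Rpow R p, TensorProduct.assoc k _ _ _
      ((comulOp R h₄).rTensor _ (TensorProduct.comm k _ _ t)) = Φ ((comul R i₄).lTensor _ t) := by
    intro t
    induction t using TensorProduct.induction_on with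
    | zero => simp
    | tmul x y => rfl
    | add s t hs ht => simp only [map_add, hs, ht]
  have e₂ : ∀ t : Rpow R q ⊗[k] Rpow R a,
      (comulOp R h₂).lTensor _ (TensorProduct.comm k _ _ t) =
        Φ (TensorProduct.assoc k _ _ _ ((comul R i₂).rTensor _ t)) := by
    intro t
    induction t using TensorProduct.induction_on with
    | zero => simp
    | tmul x y =>
      have : ∀ s : Rpow R c ⊗[k] Rpow R b, y ⊗ₜ[k] TensorProduct.comm k _ _ s =
          Φ (TensorProduct.assoc k _ _ _ (s ⊗ₜ y)) := by
        intro s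
        induction s using TensorProduct.induction_on with
        | zero => simp
        | tmul x y => rfl
        | add s t hs ht => simp only [map_add, TensorProduct.tmul_add, TensorProduct.add_tmul, hs, ht]
      exact this (comul R i₂ x)
    | add s t hs ht => simp only [map_add, hs, ht]
  rw [comulOp_apply h₃ i₃, e₁, comulOp_apply h₁ i₁, e₂, comul_coassoc R i₃ i₄ i₁ i₂]

/-- The reversed inclusions and right multiplication. -/
def rightCalculus (hp : IsPerfect R d)
    (hA : ∀ z : QuadAlg R, (∀ v, z * QuadAlg.ι R v = 0) → z = 0) :
    Calculus R d (QuadAlg R) where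
  δ h := comulOp R h
  coassoc h₁ h₂ h₃ h₄ x := comulOp_coassoc h₁ h₂ h₃ h₄ x
  counit h x := by
    rw [comulOp_apply h (h.trans (Nat.add_comm _ _)), comul_zero_left, TensorProduct.comm_tmul]
  δ_injective h := (TensorProduct.comm k _ _).injective.comp (comul_injective _)
  exists_contractR h hd ξ hξ := by
    obtain ⟨y, hy⟩ := hp.exists_contractL_ne_zero (h.trans (Nat.add_comm _ _)) hd hξ
    exact ⟨y, by rwa [comulOp_apply h (h.trans (Nat.add_comm _ _)), contractR_comm]⟩
  one := 1
  act := rightAct R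
  act_act h := by
    refine TensorProduct.ext' fun x b => ?_
    refine (rightAct_rightAct _ b).trans ?_
    rw [mulMap_comul, QuadAlg.mk_Rpow_two h, mul_zero]
    rfl
  act_one v hv := degreeOne_injective (by
    rw [map_zero]
    exact (one_mul _).symm.trans hv)
  act_eq_zero b hb := hA b fun v => hb (toRpowOne R v)

/-- For the left calculus the faithfulness condition is `Hom(k, A) = 0`, where `d > 0` enters. For
the right one it is the injectivity of the last differential `P_d → P_{d-1}`. -/
theorem exists_calculus [FiniteDimensional k V] (hd : 0 < d) (hK : IsKoszul R)
    (hR : IsASRegular R d) :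
    ∃ (A : Type u) (_ : AddCommGroup A) (_ : Module k A) (S T : Calculus R d A),
      (∀ {n a b : ℕ} (h : n = a + b), S.δ h = comul R h) ∧
      ∀ {n a b : ℕ} (h : n = a + b), T.δ h = comulOp R h := by
  obtain ⟨P⟩ := hK.nonempty_linearResolution
  have hp := isPerfect_of_linearResolution P hR
  obtain ⟨n, rfl⟩ : ∃ n, d = n + 1 := ⟨d - 1, by omega⟩
  have h₁ : IsEmpty (P.J (n + 2)) := P.isEmpty_J (hR.subsingleton_ext _)
  have h₂ : Nonempty (P.J (n + 1)) :=
    P.nonempty_J (Module.nontrivial_of_finrank_eq_succ hR.finrank_ext)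
  exact ⟨QuadAlg R, _, _,
    leftCalculus hp fun z hz => P.eq_zero_of_ι_mul (hR.ext_eq_zero 0 (by omega)) hz,
    rightCalculus hp fun z hz => P.eq_zero_of_mul_ι (n := n) hz, fun _ => rfl, fun _ => rfl⟩

end instances

/-! ### Elementary maps between the spaces of normal forms -/

section normalForms

variable {k : Type u} [Field k] {V : Type u} [AddCommGroup V] [Module k V]

/-- The tensor product of the spaces `R_a` for `(a, e)` in a list. A list `[(a₁, e₁), …, (aₙ, eₙ)]`
together with an integer `e₀` stands for `r_d^{e₀} r_{a₁} r_d^{e₁} ⋯ r_{aₙ} r_d^{eₙ}`. -/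
def listObj (R : Submodule k (V ⊗[k] V)) : List (ℕ × ℤ) → ModuleCat.{u} k
  | [] => ModuleCat.of k k
  | p :: l => ModuleCat.of k (Rpow R p.1 ⊗[k] listObj R l)

variable {R : Submodule k (V ⊗[k] V)} {d : ℕ} (hp : IsPerfect R d) (ψ : Module.Dual k (Rpow R d))
  (ω : Rpow R d)

/-- The contraction `R_a ⊗ R_b ⊗ W → R_{a+b-d} ⊗ W`, for a fixed element of `R_d^{-1}`. -/
def thMap {a b c : ℕ} (ha : a ≤ d) (h : a + b = d + c) (W : Type u) [AddCommGroup W] [Module k W] :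
    Rpow R a ⊗[k] (Rpow R b ⊗[k] W) →ₗ[k] Rpow R c ⊗[k] W :=
  triMap (thetaLin hp ha h) W ∘ₗ
    (TensorProduct.mk k (Module.Dual k (Rpow R d)) (Rpow R b ⊗[k] W) ψ).lTensor (Rpow R a)

section
variable (W W' : Type u) [AddCommGroup W] [Module k W] [AddCommGroup W'] [Module k W']

@[simp]
theorem thMap_tmul {a b c : ℕ} (ha : a ≤ d) (h : a + b = d + c) (x : Rpow R a) (y : Rpow R b)
    (w : W) : thMap hp ψ ha h W (x ⊗ₜ (y ⊗ₜ w)) = thetaLin hp ha h x ψ y ⊗ₜ w := by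
  simp [thMap]

theorem thMap_phiMap_left {n a b c e f : ℕ} (hn : n ≤ d) (hb : b ≤ d) (h₁ : n = a + b)
    (h₂ : b + c = d + e) (h₃ : n + c = d + f) (h₄ : f = a + e) :
    (thMap hp ψ hb h₂ W).lTensor (Rpow R a) ∘ₗ phiMap R h₁ (Rpow R c ⊗[k] W) =
      phiMap R h₄ W ∘ₗ thMap hp ψ hn h₃ W := by
  refine LinearMap.ext fun t => ?_
  have e₁ := LinearMap.congr_fun (phiMap_nat (Rpow R c ⊗[k] W)
    (Module.Dual k (Rpow R d) ⊗[k] (Rpow R c ⊗[k] W)) (R := R) h₁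
    (TensorProduct.mk k (Module.Dual k (Rpow R d)) (Rpow R c ⊗[k] W) ψ)) t
  have e₂ := LinearMap.congr_fun (triMap_phiMap_left W hp hn hb h₁ h₂ h₃ h₄)
    ((TensorProduct.mk k (Module.Dual k (Rpow R d)) (Rpow R c ⊗[k] W) ψ).lTensor (Rpow R n) t)
  simp only [LinearMap.comp_apply] at e₁ e₂
  simp only [thMap, LinearMap.comp_apply, LinearMap.lTensor_comp_apply]
  rw [e₁, e₂]

theorem thMap_phiMap_right {n a b c e f : ℕ} (ha : a ≤ d) (h₁ : n = b + c)
    (h₂ : a + b = d + e) (h₃ : a + n = d + f) (h₄ : f = e + c) :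
    thMap hp ψ ha h₂ (Rpow R c ⊗[k] W) ∘ₗ (phiMap R h₁ W).lTensor _ =
      phiMap R h₄ W ∘ₗ thMap hp ψ ha h₃ W := by
  refine LinearMap.ext fun t => ?_
  have e₂ := LinearMap.congr_fun (triMap_phiMap_right W hp ha h₁ h₂ h₃ h₄)
    ((TensorProduct.mk k (Module.Dual k (Rpow R d)) (Rpow R n ⊗[k] W) ψ).lTensor (Rpow R a) t)
  simp only [LinearMap.comp_apply] at e₂
  simp only [thMap, LinearMap.comp_apply]
  rw [← e₂, ← LinearMap.lTensor_comp_apply, ← LinearMap.lTensor_comp_apply]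
  rfl

variable {W W'}

theorem thMap_nat {a b c : ℕ} (ha : a ≤ d) (h : a + b = d + c) (f : W →ₗ[k] W') :
    f.lTensor _ ∘ₗ thMap hp ψ ha h W = thMap hp ψ ha h W' ∘ₗ (f.lTensor _).lTensor _ := by
  ext x y w
  simp

variable {ψ ω}

theorem thMap_top_left {a : ℕ} (h : d + a = d + a) (hω : ψ ω = 1) (t : Rpow R a ⊗[k] W) :
    thMap hp ψ le_rfl h W (ω ⊗ₜ t) = t := by
  induction t using TensorProduct.induction_on with
  | zero => simp
  | tmul x y => simp [theta_left_top, hω]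
  | add s t hs ht => simp only [TensorProduct.tmul_add, map_add, hs, ht]

theorem thMap_top_right {a : ℕ} (ha : a ≤ d) (h : a + d = d + a) (hω : ψ ω = 1) :
    thMap hp ψ ha h W ∘ₗ (TensorProduct.mk k (Rpow R d) W ω).lTensor (Rpow R a) =
      LinearMap.id := by
  ext x y
  simp [theta_right_top, hω]

end

/-- A family of maps between the spaces of normal forms. -/
abbrev MapRel (R : Submodule k (V ⊗[k] V)) : Type u :=
  ∀ (_ : ℤ) (l : List (ℕ × ℤ)) (_ : ℤ) (l' : List (ℕ × ℤ)),
    (listObj R l →ₗ[k] listObj R l') → Prop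

/-- The nontrivial maps `φ_{a,b}`, in normal form. -/
inductive Ph (ω : Rpow R d) : MapRel R
  | split {n a b : ℕ} (h : n = a + b) (ha : 0 < a) (hb : 0 < b) (hn : n < d) (e₀ e z : ℤ)
      (hz : z = 0) (l : List (ℕ × ℤ)) :
      Ph ω e₀ ((n, e) :: l) e₀ ((a, z) :: (b, e) :: l) (phiMap R h (listObj R l))
  | top {a b : ℕ} (h : d = a + b) (ha : 0 < a) (hb : 0 < b) (e₀ e₁ e₂ z : ℤ)
      (hz : z = 0) (he : e₀ = e₁ + 1 + e₂) (l : List (ℕ × ℤ)) :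
      Ph ω e₀ l e₁ ((a, z) :: (b, e₂) :: l)
        (phiMap R h (listObj R l) ∘ₗ TensorProduct.mk k (Rpow R d) (listObj R l) ω)
  | cons (a : ℕ) (e₀ : ℤ) {e e' : ℤ} {l l' : List (ℕ × ℤ)} {f : listObj R l →ₗ[k] listObj R l'}
      (h : Ph ω e l e' l' f) : Ph ω e₀ ((a, e) :: l) e₀ ((a, e') :: l') (f.lTensor (Rpow R a))

/-- The nontrivial maps `θ_{a,b}`, in normal form. -/
inductive Th (hp : IsPerfect R d) (ψ : Module.Dual k (Rpow R d)) : MapRel R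
  | contr {a b c : ℕ} (h : a + b = d + c) (ha : a < d) (hb : b < d) (hc : 0 < c) (e₀ e z : ℤ)
      (hz : z = -1) (l : List (ℕ × ℤ)) :
      Th hp ψ e₀ ((a, z) :: (b, e) :: l) e₀ ((c, e) :: l) (thMap hp ψ ha.le h (listObj R l))
  | cancel {a b : ℕ} (h : a + b = d + 0) (ha : a < d) (hb : b < d) (e₀ e e₁ z : ℤ)
      (hz : z = -1) (he : e₁ = e₀ + e) (l : List (ℕ × ℤ)) :
      Th hp ψ e₀ ((a, z) :: (b, e) :: l) e₁ l
        ((unitEquiv R (listObj R l)).toLinearMap ∘ₗ thMap hp ψ ha.le h (listObj R l))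
  | cons (a : ℕ) (e₀ : ℤ) {e e' : ℤ} {l l' : List (ℕ × ℤ)} {f : listObj R l →ₗ[k] listObj R l'}
      (h : Th hp ψ e l e' l' f) : Th hp ψ e₀ ((a, e) :: l) e₀ ((a, e') :: l') (f.lTensor (Rpow R a))

/-- The reflexive closure. -/
inductive MapRel.Refl (P : MapRel R) : MapRel R
  | refl (e : ℤ) (l : List (ℕ × ℤ)) : Refl P e l e l LinearMap.id
  | of {e e' : ℤ} {l l' : List (ℕ × ℤ)} {f : listObj R l →ₗ[k] listObj R l'}
      (h : P e l e' l' f) : Refl P e l e' l' f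

/-- The reflexive transitive closure. -/
inductive MapRel.Star (P : MapRel R) : MapRel R
  | refl (e : ℤ) (l : List (ℕ × ℤ)) : Star P e l e l LinearMap.id
  | snoc {e e' e'' : ℤ} {l l' l'' : List (ℕ × ℤ)} {f : listObj R l →ₗ[k] listObj R l'}
      {g : listObj R l' →ₗ[k] listObj R l''} (h : Star P e l e' l' f) (h' : P e' l' e'' l'' g) :
      Star P e l e'' l'' (g ∘ₗ f)

variable {hp ψ ω}

/-- Multiplication by a power of `r_d` on the left changes only the leading exponents, not the map.
-/
theorem Ph.shift {e e' : ℤ} {l l' : List (ℕ × ℤ)} {f : listObj R l →ₗ[k] listObj R l'}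
    (h : Ph ω e l e' l' f) (s : ℤ) : Ph ω (s + e) l (s + e') l' f := by
  cases h with
  | split h ha hb hn _ _ _ hz => exact .split h ha hb hn _ _ _ hz _
  | top h ha hb _ _ _ _ hz he => exact .top h ha hb _ _ _ _ hz (by rw [he]; ring) _
  | cons _ _ h => exact .cons _ _ h

theorem Th.shift {e e' : ℤ} {l l' : List (ℕ × ℤ)} {f : listObj R l →ₗ[k] listObj R l'}
    (h : Th hp ψ e l e' l' f) (s : ℤ) : Th hp ψ (s + e) l (s + e') l' f := by
  cases h with
  | contr h ha hb hc _ _ _ hz => exact .contr h ha hb hc _ _ _ hz _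
  | cancel h ha hb _ _ _ _ hz he => exact .cancel h ha hb _ _ _ _ hz (by rw [he]; ring) _
  | cons _ _ h => exact .cons _ _ h

theorem Ph.refl_cons (a : ℕ) (e₀ : ℤ) {e e' : ℤ} {l l' : List (ℕ × ℤ)}
    {f : listObj R l →ₗ[k] listObj R l'} (h : (Ph ω).Refl e l e' l' f) :
    (Ph ω).Refl e₀ ((a, e) :: l) e₀ ((a, e') :: l') (f.lTensor (Rpow R a)) := by
  cases h with
  | refl =>
    rw [LinearMap.lTensor_id]
    exact .refl e₀ ((a, e) :: l)
  | of h => exact .of (.cons a e₀ h)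

theorem Th.refl_cons (a : ℕ) (e₀ : ℤ) {e e' : ℤ} {l l' : List (ℕ × ℤ)}
    {f : listObj R l →ₗ[k] listObj R l'} (h : (Th hp ψ).Refl e l e' l' f) :
    (Th hp ψ).Refl e₀ ((a, e) :: l) e₀ ((a, e') :: l') (f.lTensor (Rpow R a)) := by
  cases h with
  | refl =>
    rw [LinearMap.lTensor_id]
    exact .refl e₀ ((a, e) :: l)
  | of h => exact .of (.cons a e₀ h)

end normalForms

/-! ### Moving contractions before splittings -/

section commutation

variable {k : Type u} [Field k] {V : Type u} [AddCommGroup V] [Module k V]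
  {R : Submodule k (V ⊗[k] V)} {d : ℕ} {hp : IsPerfect R d} {ψ : Module.Dual k (Rpow R d)}
  {ω : Rpow R d}

/-- `g` factors as a map in `Ph` after a map in `Th`. -/
def Factors (hp : IsPerfect R d) (ψ : Module.Dual k (Rpow R d)) (ω : Rpow R d) : MapRel R :=
  fun e l e' l' f => ∃ e₁ l₁ g h, (Th hp ψ).Refl e l e₁ l₁ g ∧ (Ph ω).Refl e₁ l₁ e' l' h ∧
    f = h ∘ₗ g

theorem lTensor_unitEquiv_phiMap {a : ℕ} (h : a = a + 0) (W : Type u) [AddCommGroup W]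
    [Module k W] (t : Rpow R a ⊗[k] W) :
    (unitEquiv R W).toLinearMap.lTensor (Rpow R a) (phiMap R h W t) = t := by
  rw [phiMap_zero_right, ← LinearMap.lTensor_comp_apply, LinearEquiv.comp_symm,
    LinearMap.lTensor_id, LinearMap.id_apply]

theorem unitEquiv_phiMap {a : ℕ} (h : a = 0 + a) (W : Type u) [AddCommGroup W]
    [Module k W] (t : Rpow R a ⊗[k] W) :
    unitEquiv R _ (phiMap R h W t) = t := by
  rw [phiMap_zero_left]
  exact LinearEquiv.apply_symm_apply _ _

/-- Inserting `ω`, splitting it and contracting its left half with `R_a` amounts to splitting `R_a`: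
contraction with all of `ω` is the identity, as `ψ ω = 1`. -/
theorem thMap_phiMap_top (hp : IsPerfect R d) {a b c e : ℕ} (ha : a ≤ d) (h₁ : d = b + c)
    (h₂ : a + b = d + e) (h₄ : a = e + c) (hω : ψ ω = 1) (W : Type u) [AddCommGroup W]
    [Module k W] (t : Rpow R a ⊗[k] W) :
    thMap hp ψ ha h₂ (Rpow R c ⊗[k] W)
      ((phiMap R h₁ W ∘ₗ TensorProduct.mk k (Rpow R d) W ω).lTensor (Rpow R a) t) =
        phiMap R h₄ W t := by
  have h := LinearMap.congr_fun (thMap_phiMap_right hp ψ W ha h₁ h₂ (Nat.add_comm a d) h₄)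
    ((TensorProduct.mk k (Rpow R d) W ω).lTensor (Rpow R a) t)
  have h' := LinearMap.congr_fun (thMap_top_right (W := W) hp ha (Nat.add_comm a d) hω) t
  simp only [LinearMap.comp_apply, LinearMap.id_apply] at h h'
  rw [LinearMap.lTensor_comp_apply, h, h']

/-- If the contraction uses the new letter `b`, the relation `(r_a θ_{b,c}) φ_{a,b} = φ_{a,b+c-d}
θ_{a+b,c}` applies; for `b + c = d` the remaining `φ_{a,0}` is trivial. If it takes place further to
the right, the two maps commute. -/
theorem factors_split {n a b : ℕ} (h : n = a + b) (ha : 0 < a) (hb : 0 < b) (hn : n < d) {e e' : ℤ}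
    (e₀ : ℤ) {z : ℤ} (hz : z = 0) {l l' : List (ℕ × ℤ)}
    {g : listObj R ((b, e) :: l) →ₗ[k] listObj R l'} (hg : Th hp ψ z ((b, e) :: l) e' l' g) :
    Factors hp ψ ω e₀ ((n, e) :: l) e₀ ((a, e') :: l')
      (g.lTensor (Rpow R a) ∘ₗ phiMap R h (listObj R l)) := by
  cases hg with
  | @contr _ c f i₁ i₂ i₃ i₄ _ e₂ _ he l =>
    refine ⟨e₀, (a + f, e₂) :: l, _, _,
      .of (.contr (show n + c = d + (a + f) by omega) hn i₃ (by omega) _ _ _ he _),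
      .of (.split rfl ha i₄ (by omega) _ _ _ hz _), ?_⟩
    exact thMap_phiMap_left hp ψ _ hn.le i₂.le h i₁ _ rfl
  | @cancel _ c i₁ i₂ i₃ _ e₂ _ _ he he' =>
    subst hz
    obtain rfl : e' = e₂ := by omega
    refine ⟨e₀, (a, e') :: l', _, _,
      .of (.contr (show n + c = d + a by omega) hn i₃ ha _ _ _ he _), .refl _ _, ?_⟩
    refine LinearMap.ext fun t => ?_
    have := LinearMap.congr_fun (thMap_phiMap_left hp ψ (listObj R l') hn.le i₂.le h i₁
      (show n + c = d + a by omega) rfl) t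
    refine (LinearMap.lTensor_comp_apply _ _ _ _).trans ?_
    refine (congrArg _ this).trans ?_
    exact lTensor_unitEquiv_phiMap rfl _ _
  | cons _ _ hf =>
    exact ⟨e₀, _, _, _, .of (.cons n e₀ hf), .of (.split h ha hb hn _ _ _ hz _),
      phiMap_nat _ _ h _⟩

/-- The same as `factors_split` for an inserted `ω`. Here the contraction `θ_{d,c}` with all of `ω`
is an identity, so that only a splitting of `R_c`, or nothing, remains. -/
theorem factors_top {a b : ℕ} (h : d = a + b) (ha : 0 < a) (hb : 0 < b) {e₀ e₁ e₂ e' z : ℤ}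
    (hz : z = 0) (he : e₀ = e₁ + 1 + e₂) (hω : ψ ω = 1) {l l' : List (ℕ × ℤ)}
    {g : listObj R ((b, e₂) :: l) →ₗ[k] listObj R l'} (hg : Th hp ψ z ((b, e₂) :: l) e' l' g) :
    Factors hp ψ ω e₀ l e₁ ((a, e') :: l')
      (g.lTensor (Rpow R a) ∘ₗ phiMap R h (listObj R l) ∘ₗ
        TensorProduct.mk k (Rpow R d) (listObj R l) ω) := by
  cases hg with
  | @contr _ c f i₁ i₂ i₃ i₄ _ e₃ _ he' l =>
    obtain rfl : e₀ = e₁ := by omega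
    refine ⟨e₀, (c, e₃) :: l, _, _, .refl _ _,
      .of (.split (show c = a + f by omega) ha i₄ i₃ _ _ _ hz _), ?_⟩
    refine LinearMap.ext fun t => ?_
    have := LinearMap.congr_fun (thMap_phiMap_left hp ψ (listObj R l) le_rfl i₂.le h i₁
      (rfl : d + c = d + c) (show c = a + f by omega)) (ω ⊗ₜ t)
    refine this.trans ?_
    exact congrArg (phiMap R _ (listObj R l)) (thMap_top_left hp rfl hω t)
  | @cancel _ c i₁ i₂ i₃ _ e₃ _ _ he' he'' =>
    subst hz
    obtain rfl : e' = e₃ := by omega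
    obtain rfl : e₀ = e₁ := by omega
    obtain rfl : a = c := by omega
    refine ⟨e₀, (a, e') :: l', _, _, .refl _ _, .refl _ _, ?_⟩
    refine LinearMap.ext fun t => ?_
    have := LinearMap.congr_fun (thMap_phiMap_left hp ψ (listObj R l') le_rfl i₂.le h i₁
      (rfl : d + a = d + a) rfl) (ω ⊗ₜ t)
    refine (LinearMap.lTensor_comp_apply _ _ _ _).trans ?_
    refine (congrArg _ this).trans ?_
    exact (lTensor_unitEquiv_phiMap rfl _ _).trans (thMap_top_left hp rfl hω t)
  | @cons _ _ _ e₃ _ l₃ f hf =>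
    subst he
    refine ⟨_, _, _, _, .of (hf.shift (e₁ + 1)), .of (.top h ha hb _ _ _ _ hz rfl _), ?_⟩
    refine LinearMap.ext fun t => ?_
    exact LinearMap.congr_fun (phiMap_nat _ _ h f) (ω ⊗ₜ t)

/-- The letter `b` to be contracted may come from a splitting, from an inserted `ω`, or from further
to the left than the map `f` acts. The first two cases use the relation `(θ_{a,b} r_c) φ_{b,c} =
φ_{a+b-d,c} θ_{a,b+c}`, and in the third the maps commute. -/
theorem factors_contr {a b c : ℕ} (h : a + b = d + c) (ha : a < d) (hb : b < d) (hc : 0 < c)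
    (e₀ : ℤ) {z e e' : ℤ} (hz : z = -1) (hω : ψ ω = 1) {l l' : List (ℕ × ℤ)}
    {f : listObj R l →ₗ[k] listObj R ((b, e') :: l')} (hf : Ph ω e l z ((b, e') :: l') f) :
    Factors hp ψ ω e₀ ((a, e) :: l) e₀ ((c, e') :: l')
      (thMap hp ψ ha.le h (listObj R l') ∘ₗ f.lTensor (Rpow R a)) := by
  cases hf with
  | @split n _ b' i₁ i₂ i₃ i₄ _ e₃ _ he l =>
    refine ⟨e₀, (c + b', e₃) :: l, _, _,
      .of (.contr (show a + n = d + (c + b') by omega) ha i₄ (by omega) _ _ _ hz _),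
      .of (.split rfl hc i₃ (by omega) _ _ _ he _), ?_⟩
    exact thMap_phiMap_right hp ψ _ ha.le i₁ h _ rfl
  | @top _ b' i₁ i₂ i₃ _ _ e₃ _ he he' l =>
    obtain rfl : e = e₃ := by omega
    refine ⟨e₀, (a, e) :: l, _, _, .refl _ _,
      .of (.split (show a = c + b' by omega) hc i₃ ha _ _ _ he _), ?_⟩
    refine LinearMap.ext fun t => ?_
    exact thMap_phiMap_top hp ha.le i₁ h (show a = c + b' by omega) hω _ t
  | cons _ _ hf =>
    exact ⟨_, _, _, _, .of (.contr h ha hb hc _ _ _ hz _), .of (.cons c e₀ hf),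
      (thMap_nat hp ψ ha.le h _).symm⟩

/-- As `factors_contr`, for `a + b = d`: the splitting `φ_{0,b'}` that appears is undone by the
identification `R_0 = k`. -/
theorem factors_cancel {a b : ℕ} (h : a + b = d + 0) (ha : a < d) (hb : b < d)
    {e₀ z e e₁ e' : ℤ} (hz : z = -1) (he₁ : e₁ = e₀ + e') (hω : ψ ω = 1) {l l' : List (ℕ × ℤ)}
    {f : listObj R l →ₗ[k] listObj R ((b, e') :: l')} (hf : Ph ω e l z ((b, e') :: l') f) :
    Factors hp ψ ω e₀ ((a, e) :: l) e₁ l'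
      (((unitEquiv R (listObj R l')).toLinearMap ∘ₗ thMap hp ψ ha.le h (listObj R l')) ∘ₗ
        f.lTensor (Rpow R a)) := by
  cases hf with
  | @split n _ b' i₁ i₂ i₃ i₄ _ e₃ _ he l =>
    obtain rfl : e₁ = e₀ := by omega
    refine ⟨e₁, (b', e₃) :: l, _, _,
      .of (.contr (show a + n = d + b' by omega) ha i₄ (by omega) _ _ _ hz _), .refl _ _, ?_⟩
    refine LinearMap.ext fun t => ?_
    have h₁ := LinearMap.congr_fun (thMap_phiMap_right hp ψ (listObj R l) ha.le i₁ h
      (show a + n = d + b' by omega) (Nat.zero_add b').symm) t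
    exact (congrArg (unitEquiv R _) h₁).trans (unitEquiv_phiMap _ _ _)
  | @top _ b' i₁ i₂ i₃ _ _ e₃ _ he he' l =>
    obtain rfl : e = e₃ := by omega
    obtain rfl : e₁ = e₀ := by omega
    obtain rfl : a = b' := by omega
    refine ⟨e₁, (a, e) :: l, _, _, .refl _ _, .refl _ _, ?_⟩
    refine LinearMap.ext fun t => ?_
    have h₁ := thMap_phiMap_top hp ha.le i₁ h (Nat.zero_add a).symm hω (listObj R l) t
    exact (congrArg (unitEquiv R _) h₁).trans (unitEquiv_phiMap _ _ _)
  | @cons _ _ e₃ _ l _ f hf =>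
    subst he₁
    refine ⟨_, _, _, _, .of (.cancel h ha hb _ _ _ _ hz rfl _), .of (hf.shift e₀), ?_⟩
    refine LinearMap.ext fun t => ?_
    have h₁ := LinearMap.congr_fun (thMap_nat hp ψ ha.le h f) t
    have h₂ := LinearMap.congr_fun (unitEquiv_nat (R := R) _ _ f)
      (thMap hp ψ ha.le h (listObj R l) t)
    exact (congrArg (unitEquiv R _) h₁.symm).trans h₂.symm

/-- A map in `Th` can be moved past a map in `Ph`. -/
theorem factors_comp (hω : ψ ω = 1) {e e' : ℤ} {l l' : List (ℕ × ℤ)}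
    {f : listObj R l →ₗ[k] listObj R l'} (hf : Ph ω e l e' l' f) : ∀ {e'' : ℤ}
    {l'' : List (ℕ × ℤ)} {g : listObj R l' →ₗ[k] listObj R l''} (_ : Th hp ψ e' l' e'' l'' g),
    Factors hp ψ ω e l e'' l'' (g ∘ₗ f) := by
  induction hf with
  | split h ha hb hn e₀ e z hz l =>
    intro e'' l'' g hg
    cases hg with
    -- A splitting leaves exponent `0` at the new junction, while a contraction there would need
    -- `-1`.
    | contr _ _ _ _ _ _ _ hz' => omega
    | cancel _ _ _ _ _ _ _ hz' => omega
    | cons _ _ hg => exact factors_split h ha hb hn _ hz hg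
  | top h ha hb e₀ e₁ e₂ z hz he l =>
    intro e'' l'' g hg
    cases hg with
    | contr _ _ _ _ _ _ _ hz' => omega
    | cancel _ _ _ _ _ _ _ hz' => omega
    | cons _ _ hg => exact factors_top h ha hb hz he hω hg
  | cons a e₀ hf ih =>
    intro e'' l'' g hg
    cases hg with
    | contr h ha hb hc _ _ _ hz => exact factors_contr h ha hb hc e₀ hz hω hf
    | cancel h ha hb _ _ _ _ hz he => exact factors_cancel h ha hb hz he hω hf
    | cons _ _ hg =>
      obtain ⟨e₁, l₁, u, v, hu, hv, huv⟩ := ih hg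
      refine ⟨_, _, _, _, Th.refl_cons a e₀ hu, Ph.refl_cons a e₀ hv, ?_⟩
      exact (LinearMap.lTensor_comp (Rpow R a) _ _).symm.trans
        ((congrArg (LinearMap.lTensor (Rpow R a)) huv).trans (LinearMap.lTensor_comp _ _ _))

theorem factors_comp_refl (hω : ψ ω = 1) {e e' e'' : ℤ} {l l' l'' : List (ℕ × ℤ)}
    {f : listObj R l →ₗ[k] listObj R l'} {g : listObj R l' →ₗ[k] listObj R l''}
    (hf : Ph ω e l e' l' f) (hg : (Th hp ψ).Refl e' l' e'' l'' g) :
    Factors hp ψ ω e l e'' l'' (g ∘ₗ f) := by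
  cases hg with
  | refl => exact ⟨_, _, _, _, .refl _ _, .of hf, rfl⟩
  | of hg => exact factors_comp hω hf hg

theorem MapRel.Star.snoc_refl {P : MapRel R} {e e' e'' : ℤ} {l l' l'' : List (ℕ × ℤ)}
    {f : listObj R l →ₗ[k] listObj R l'} {g : listObj R l' →ₗ[k] listObj R l''}
    (hf : P.Star e l e' l' f) (hg : P.Refl e' l' e'' l'' g) : P.Star e l e'' l'' (g ∘ₗ f) := by
  cases hg with
  | refl => exact hf
  | of hg => exact hf.snoc hg

/-- Compositions of maps in `Ph` after compositions of maps in `Th`. -/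
def FactorsStar (hp : IsPerfect R d) (ψ : Module.Dual k (Rpow R d)) (ω : Rpow R d) : MapRel R :=
  fun e l e' l' f => ∃ e₁ l₁ g h, (Th hp ψ).Star e l e₁ l₁ g ∧ (Ph ω).Star e₁ l₁ e' l' h ∧
    f = h ∘ₗ g

/-- One contraction passes the splittings one after the other. Each crossing leaves at most one
contraction and at most one splitting, so the induction is on the number of splittings. -/
theorem exists_comp_star (hω : ψ ω = 1) {e e' : ℤ} {l l' : List (ℕ × ℤ)}
    {f : listObj R l →ₗ[k] listObj R l'} (hf : (Ph ω).Star e l e' l' f) : ∀ {e'' : ℤ}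
    {l'' : List (ℕ × ℤ)} {g : listObj R l' →ₗ[k] listObj R l''}
    (_ : (Th hp ψ).Refl e' l' e'' l'' g),
    ∃ e₁ l₁ u v, (Th hp ψ).Refl e l e₁ l₁ u ∧ (Ph ω).Star e₁ l₁ e'' l'' v ∧ g ∘ₗ f = v ∘ₗ u := by
  induction hf with
  | refl => exact fun {_ _ g} hg => ⟨_, _, _, _, hg, .refl _ _, rfl⟩
  | snoc _ h' ih =>
    intro e'' l'' g hg
    obtain ⟨e₁, l₁, u, v, hu, hv, huv⟩ := factors_comp_refl hω h' hg
    obtain ⟨e₂, l₂, u', v', hu', hv', huv'⟩ := ih hu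
    refine ⟨_, _, _, _, hu', hv'.snoc_refl hv, ?_⟩
    rw [← LinearMap.comp_assoc, huv, LinearMap.comp_assoc, huv', LinearMap.comp_assoc]

theorem FactorsStar.comp_Ph {e e' e'' : ℤ} {l l' l'' : List (ℕ × ℤ)}
    {f : listObj R l →ₗ[k] listObj R l'} {g : listObj R l' →ₗ[k] listObj R l''}
    (hf : FactorsStar hp ψ ω e l e' l' f) (hg : (Ph ω).Refl e' l' e'' l'' g) :
    FactorsStar hp ψ ω e l e'' l'' (g ∘ₗ f) := by
  obtain ⟨_, _, u, v, hu, hv, rfl⟩ := hf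
  exact ⟨_, _, _, _, hu, hv.snoc_refl hg, rfl⟩

theorem FactorsStar.comp_Th (hω : ψ ω = 1) {e e' e'' : ℤ} {l l' l'' : List (ℕ × ℤ)}
    {f : listObj R l →ₗ[k] listObj R l'} {g : listObj R l' →ₗ[k] listObj R l''}
    (hf : FactorsStar hp ψ ω e l e' l' f) (hg : (Th hp ψ).Refl e' l' e'' l'' g) :
    FactorsStar hp ψ ω e l e'' l'' (g ∘ₗ f) := by
  obtain ⟨_, _, u, v, hu, hv, rfl⟩ := hf
  obtain ⟨_, _, u', v', hu', hv', h⟩ := exists_comp_star hω hv hg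
  refine ⟨_, _, _, _, hu.snoc_refl hu', hv', ?_⟩
  rw [← LinearMap.comp_assoc, h, LinearMap.comp_assoc]

theorem Ph.length {e e' : ℤ} {l l' : List (ℕ × ℤ)} {f : listObj R l →ₗ[k] listObj R l'}
    (h : Ph ω e l e' l' f) : l.length < l'.length := by
  induction h with
  | split | top => simp
  | cons _ _ _ ih => simpa using ih

theorem Th.length {e e' : ℤ} {l l' : List (ℕ × ℤ)} {f : listObj R l →ₗ[k] listObj R l'}
    (h : Th hp ψ e l e' l' f) : l'.length < l.length := by
  induction h with
  | contr | cancel => simp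
  | cons _ _ _ ih => simpa using ih

/-- The elements of `M` that are killed by all maps in `Th`. -/
def Killed (hp : IsPerfect R d) (ψ : Module.Dual k (Rpow R d)) (l : List (ℕ × ℤ))
    (x : listObj R l) : Prop :=
  ∀ ⦃e e' l'⦄ ⦃f : listObj R l →ₗ[k] listObj R l'⦄, Th hp ψ e l e' l' f → f x = 0

/-- The maps that vanish on the images of all maps in `Ph`. -/
def Kills (ω : Rpow R d) (l : List (ℕ × ℤ)) {B : Type u} [AddCommGroup B] [Module k B]
    (F : listObj R l →ₗ[k] B) : Prop :=
  ∀ ⦃e l' e'⦄ ⦃f : listObj R l' →ₗ[k] listObj R l⦄, Ph ω e l' e' l f → F ∘ₗ f = 0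

/-- The first contraction of a nonempty chain already kills `x`; the second alternative is the empty
chain. -/
theorem Killed.star {e e' : ℤ} {l l' : List (ℕ × ℤ)} {f : listObj R l →ₗ[k] listObj R l'}
    (hf : (Th hp ψ).Star e l e' l' f) {x : listObj R l} (hx : Killed hp ψ l x) :
    f x = 0 ∨ l'.length = l.length ∧ Killed hp ψ l' (f x) := by
  induction hf with
  | refl => exact .inr ⟨rfl, hx⟩
  | snoc _ h' ih =>
    left
    rcases ih hx with h | h
    · rw [LinearMap.comp_apply, h, map_zero]
    · exact h.2 h'

theorem MapRel.Star.length_le {e e' : ℤ} {l l' : List (ℕ × ℤ)}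
    {f : listObj R l →ₗ[k] listObj R l'} (hf : (Th hp ψ).Star e l e' l' f) :
    l'.length ≤ l.length := by
  induction hf with
  | refl => exact le_rfl
  | snoc _ h' ih => exact h'.length.le.trans ih

theorem MapRel.Star.le_length {e e' : ℤ} {l l' : List (ℕ × ℤ)}
    {f : listObj R l →ₗ[k] listObj R l'} (hf : (Ph ω).Star e l e' l' f) :
    l.length ≤ l'.length := by
  induction hf with
  | refl => exact le_rfl
  | snoc _ h' ih => exact ih.trans h'.length.le

/-- Splittings do not shorten a list, so a map to a shorter list has to begin with a contraction. -/
theorem FactorsStar.apply_eq_zero {e e' : ℤ} {l l' : List (ℕ × ℤ)}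
    {f : listObj R l →ₗ[k] listObj R l'} (hf : FactorsStar hp ψ ω e l e' l' f)
    (h : l'.length < l.length) {x : listObj R l} (hx : Killed hp ψ l x) : f x = 0 := by
  obtain ⟨_, l₁, u, v, hu, hv, rfl⟩ := hf
  rcases hx.star hu with h₁ | h₁
  · rw [LinearMap.comp_apply, h₁, map_zero]
  · have := hv.le_length
    omega

/-- Dually, contractions do not lengthen a list, so a map to a longer list has to end with a
splitting. -/
theorem FactorsStar.comp_eq_zero {e e' : ℤ} {l l' : List (ℕ × ℤ)}
    {f : listObj R l →ₗ[k] listObj R l'} (hf : FactorsStar hp ψ ω e l e' l' f)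
    (h : l.length < l'.length) {B : Type u} [AddCommGroup B] [Module k B]
    {F : listObj R l' →ₗ[k] B} (hF : Kills ω l' F) : F ∘ₗ f = 0 := by
  obtain ⟨_, l₁, u, v, hu, hv, rfl⟩ := hf
  cases hv with
  | refl =>
    have := hu.length_le
    omega
  | snoc _ h' => rw [← LinearMap.comp_assoc, ← LinearMap.comp_assoc, hF h', LinearMap.zero_comp,
      LinearMap.zero_comp]

end commutation

/-! ### Elements of `R_u ⊗ N` made from functionals on `R_{d-u} ⊗ W` -/

section suspension

variable {k : Type u} [Field k] {V : Type u} [AddCommGroup V] [Module k V]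
  {R : Submodule k (V ⊗[k] V)} {d : ℕ}
variable {W N : Type u} [AddCommMonoid W] [Module k W] [AddCommMonoid N] [Module k N]

/-- A map `X : W^* → N` gives a map `(R_c ⊗ W)^* → R_u ⊗ N`, `g ↦ ∑ ω₍₁₎ ⊗ X(g(ω₍₂₎ ⊗ -))`, for every
element `ω` of `R_d`. -/
def suspend {n u c : ℕ} (h : n = u + c) (ω : Rpow R n) (X : Module.Dual k W →ₗ[k] N) :
    Module.Dual k (Rpow R c ⊗[k] W) →ₗ[k] Rpow R u ⊗[k] N where
  toFun g := (X ∘ₗ TensorProduct.curry g).lTensor (Rpow R u) (comul R h ω)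
  map_add' g g' := by
    have : X ∘ₗ TensorProduct.curry (g + g') =
        X ∘ₗ TensorProduct.curry g + X ∘ₗ TensorProduct.curry g' :=
      LinearMap.ext fun x => map_add X (TensorProduct.curry g x) (TensorProduct.curry g' x)
    rw [this, LinearMap.lTensor_add, LinearMap.add_apply]
  map_smul' r g := by
    have : X ∘ₗ TensorProduct.curry (r • g) = r • (X ∘ₗ TensorProduct.curry g) :=
      LinearMap.ext fun x => map_smul X r (TensorProduct.curry g x)
    rw [this, LinearMap.lTensor_smul, LinearMap.smul_apply]
    rfl

theorem suspend_apply {n u c : ℕ} (h : n = u + c) (ω : Rpow R n) (X : Module.Dual k W →ₗ[k] N)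
    (g : Module.Dual k (Rpow R c ⊗[k] W)) :
    suspend h ω X g = (X ∘ₗ TensorProduct.curry g).lTensor (Rpow R u) (comul R h ω) := rfl

/-- The functional `f ⊗ F`. -/
def dualTensor {P : Type u} [AddCommMonoid P] [Module k P] (f : Module.Dual k P)
    (F : Module.Dual k N) : Module.Dual k (P ⊗[k] N) :=
  F ∘ₗ contractL N f

theorem dualTensor_lTensor {P N' : Type u} [AddCommMonoid P] [Module k P] [AddCommMonoid N']
    [Module k N'] (f : Module.Dual k P)
    (F : Module.Dual k N') (φ : N →ₗ[k] N') :
    dualTensor f F ∘ₗ φ.lTensor P = dualTensor f (F ∘ₗ φ) := by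
  ext x y
  simp [dualTensor]

theorem dualTensor_suspend {n u c : ℕ} (h : n = u + c) (ω : Rpow R n)
    (X : Module.Dual k W →ₗ[k] N) (f : Module.Dual k (Rpow R u)) (F : Module.Dual k N)
    (g : Module.Dual k (Rpow R c ⊗[k] W)) :
    dualTensor f F (suspend h ω X g) =
      F (X (TensorProduct.curry g (contractL _ f (comul R h ω)))) := by
  rw [suspend_apply]
  generalize comul R h ω = t
  induction t using TensorProduct.induction_on with
  | zero => simp
  | tmul x y =>
    simp only [dualTensor, LinearMap.comp_apply, LinearMap.lTensor_tmul, contractL_tmul, map_smul]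
  | add s t hs ht => simp only [map_add, hs, ht]

/-- Contraction is dual to a reversed inclusion. After contracting the two outer factors, the double
suspension is obtained from `ω` in `R_f ⊗ R_c ⊗ R_{c'}` by evaluating `g` on the last two factors in
reversed order. By coassociativity these factors lie in `R_{c+c'}`, where `g` vanishes. -/
theorem thMap_suspend_suspend {N : Type u} [AddCommGroup N] [Module k N] (hp : IsPerfect R d) {ψ : Module.Dual k (Rpow R d)} {ω : Rpow R d}
    (hω : ψ ω = 1) {u c u' c' f n : ℕ} (h : d = u + c) (h' : d = u' + c') (hu : u' ≤ d)
    (hf : u' + u = d + f) (hn : n = c' + c) (X : Module.Dual k W →ₗ[k] N)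
    (g : Module.Dual k (Rpow R c' ⊗[k] (Rpow R c ⊗[k] W)))
    (hg : g ∘ₗ (TensorProduct.assoc k _ _ _).toLinearMap ∘ₗ (comulOp R hn).rTensor W = 0) :
    thMap hp ψ hu hf N (suspend h' ω (suspend h ω X) g) = 0 := by
  have i₁ : u' = f + c := by omega
  have i₂ : n = c + c' := by omega
  have i₃ : d = f + n := by omega
  let Ψ : Rpow R c ⊗[k] Rpow R c' →ₗ[k] N := X ∘ₗ TensorProduct.curry (g ∘ₗ
    (TensorProduct.assoc k _ _ _).toLinearMap ∘ₗ (TensorProduct.comm k _ _).toLinearMap.rTensor W)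
  have hΨ : Ψ ∘ₗ comul R i₂ = 0 := by
    refine LinearMap.ext fun x => ?_
    have : TensorProduct.curry (g ∘ₗ (TensorProduct.assoc k _ _ _).toLinearMap ∘ₗ
        (TensorProduct.comm k _ _).toLinearMap.rTensor W) (comul R i₂ x) = 0 :=
      LinearMap.ext fun w => LinearMap.congr_fun hg (x ⊗ₜ w)
    exact (congrArg X this).trans (map_zero X)
  have e₁ : ∀ (p : Rpow R u') (Y : Rpow R c →ₗ[k] N) (s : Rpow R u ⊗[k] Rpow R c),
      thMap hp ψ hu hf N (p ⊗ₜ Y.lTensor _ s) = Y.lTensor _ ((thetaLin hp hu hf p ψ).rTensor _ s) := by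
    intro p Y s
    induction s using TensorProduct.induction_on with
    | zero => simp
    | tmul x y => simp
    | add s t hs ht => simp only [TensorProduct.tmul_add, map_add, hs, ht]
  -- The contraction of `p` with the left half of `ω` is the left half of `p`, since `θ(p, ψ, ω) =
  -- ψ(ω) p = p`.
  have e₂ : ∀ p : Rpow R u', (thetaLin hp hu hf p ψ).rTensor _ (comul R h ω) = comul R i₁ p := by
    intro p
    rw [← comul_theta_right hp hu (Nat.add_comm u' d) c h i₁ hf, theta_right_top, hω, one_smul]
  have e₃ : ∀ (q : Rpow R c') (v : Rpow R f ⊗[k] Rpow R c),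
      (X ∘ₗ TensorProduct.curry (TensorProduct.curry g q)).lTensor _ v =
        Ψ.lTensor _ (TensorProduct.assoc k _ _ _ (v ⊗ₜ q)) := by
    intro q v
    induction v using TensorProduct.induction_on with
    | zero => simp
    | tmul x y => rfl
    | add s t hs ht => simp only [TensorProduct.add_tmul, map_add, hs, ht]
  have e₄ : ∀ t : Rpow R u' ⊗[k] Rpow R c', thMap hp ψ hu hf N
      ((suspend h ω X ∘ₗ TensorProduct.curry g).lTensor _ t) =
        Ψ.lTensor _ (TensorProduct.assoc k _ _ _ ((comul R i₁).rTensor _ t)) := by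
    intro t
    induction t using TensorProduct.induction_on with
    | zero => simp
    | tmul p q =>
      rw [LinearMap.lTensor_tmul, LinearMap.comp_apply, suspend_apply, e₁, e₂, e₃,
        LinearMap.rTensor_tmul]
    | add s t hs ht => simp only [map_add, hs, ht]
  rw [suspend_apply, e₄, comul_coassoc R i₃ i₂ h' i₁, ← LinearMap.lTensor_comp_apply, hΨ,
    LinearMap.lTensor_zero, LinearMap.zero_apply]

end suspension

/-! ### Reducing functionals on tensor products to pure tensors -/

section pairs

variable {k : Type u} [Field k] {P N : Type u} [AddCommGroup P] [Module k P] [AddCommGroup N]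
  [Module k N]

/-- If all left contractions of `t` lie in `K` then `t ∈ P ⊗ K`, so `F` is nonzero on some pure
tensor there. -/
theorem exists_contractL_mem {t : P ⊗[k] N} {F : Module.Dual k (P ⊗[k] N)} (hF : F t ≠ 0)
    (K : Submodule k N) (ht : ∀ f, contractL N f t ∈ K) : ∃ w ∈ K, ∃ y, F (y ⊗ₜ w) ≠ 0 := by
  by_contra! H
  obtain ⟨s, rfl⟩ := mem_range_lTensor K t ht
  apply hF
  have : F ∘ₗ K.subtype.lTensor P = 0 := by
    ext x w
    exact H w w.2 x
  exact LinearMap.congr_fun this s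

/-- Otherwise `t` would lie in `P ⊗ K`, where `K` is the space of all `w` with `F(y ⊗ w) = 0` for
all `y`, and `F t` would vanish. -/
theorem exists_lTensor_curry_ne_zero {t : P ⊗[k] N} {F : Module.Dual k (P ⊗[k] N)} (hF : F t ≠ 0) :
    ∃ y, (TensorProduct.curry F y).lTensor P t ≠ 0 := by
  by_contra! H
  let K : Submodule k N := ⨅ y, LinearMap.ker (TensorProduct.curry F y)
  obtain ⟨w, hw, y, hy⟩ := exists_contractL_mem hF K fun f => by
    rw [Submodule.mem_iInf]
    intro y
    rw [LinearMap.mem_ker, ← contractL_lTensor, H, map_zero]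
  exact hy ((Submodule.mem_iInf _).1 hw y)

end pairs

/-! ### Construction of the element and the functional, one letter at a time -/

section good

variable {k : Type u} [Field k] {V : Type u} [AddCommGroup V] [Module k V]
  {R : Submodule k (V ⊗[k] V)} {d : ℕ} {hp : IsPerfect R d} {ψ : Module.Dual k (Rpow R d)}
  {ω : Rpow R d}

/-- A splitting creates a junction with exponent `0`. If the first junction has another exponent, or
is absent, only splittings inside `r` have to be considered. -/
theorem kills_of_ne {a : ℕ} {e : ℤ} {r : List (ℕ × ℤ)} {B : Type u} [AddCommGroup B] [Module k B]
    {F : listObj R ((a, e) :: r) →ₗ[k] B} (he : e = 0 → r = [])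
    (h : ∀ ⦃e₁ l e₂⦄ ⦃f : listObj R l →ₗ[k] listObj R r⦄, Ph ω e₁ l e₂ r f →
      F ∘ₗ f.lTensor (Rpow R a) = 0) : Kills ω ((a, e) :: r) F := by
  intro e₁ l e₂ f hf
  cases hf with
  | split _ _ _ _ _ _ _ hz => exact absurd (he hz) (List.cons_ne_nil _ _)
  | top _ _ _ _ _ _ _ hz => exact absurd (he hz) (List.cons_ne_nil _ _)
  | cons _ _ hf => exact h hf

/-- The only additional splitting ends at the first junction, and it factors through `R_{a+b}`, also
if `a + b = d`. -/
theorem kills_cons {a b : ℕ} {e e' : ℤ} {r : List (ℕ × ℤ)} {B : Type u} [AddCommGroup B]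
    [Module k B] {F : listObj R ((a, e) :: (b, e') :: r) →ₗ[k] B}
    (h : ∀ ⦃e₁ l e₂⦄ ⦃f : listObj R l →ₗ[k] listObj R ((b, e') :: r)⦄,
      Ph ω e₁ l e₂ ((b, e') :: r) f → F ∘ₗ f.lTensor (Rpow R a) = 0)
    (h' : ∀ ⦃n⦄ (hn : n = a + b), F ∘ₗ phiMap R hn (listObj R r) = 0) :
    Kills ω ((a, e) :: (b, e') :: r) F := by
  intro e₁ l e₂ f hf
  cases hf with
  | split hn => exact h' hn
  | top hn => exact LinearMap.ext fun t => LinearMap.congr_fun (h' hn) (ω ⊗ₜ t)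
  | cons _ _ hf => exact h hf

/-- A contraction consumes a junction with exponent `-1`. -/
theorem killed_of_ne {a : ℕ} {e : ℤ} {r : List (ℕ × ℤ)} {x : listObj R ((a, e) :: r)}
    (he : e = -1 → r = [])
    (h : ∀ ⦃e₁ e₂ l⦄ ⦃f : listObj R r →ₗ[k] listObj R l⦄, Th hp ψ e₁ r e₂ l f →
      f.lTensor (Rpow R a) x = 0) : Killed hp ψ ((a, e) :: r) x := by
  intro e₁ e₂ l f hf
  cases hf with
  | contr _ _ _ _ _ _ _ hz => exact absurd (he hz) (List.cons_ne_nil _ _)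
  | cancel _ _ _ _ _ _ _ hz => exact absurd (he hz) (List.cons_ne_nil _ _)
  | cons _ _ hf => exact h hf

theorem killed_cons {a b : ℕ} {e e' : ℤ} {r : List (ℕ × ℤ)}
    {x : listObj R ((a, e) :: (b, e') :: r)}
    (h : ∀ ⦃e₁ e₂ l⦄ ⦃f : listObj R ((b, e') :: r) →ₗ[k] listObj R l⦄,
      Th hp ψ e₁ ((b, e') :: r) e₂ l f → f.lTensor (Rpow R a) x = 0)
    (h' : ∀ ⦃c⦄ (ha : a ≤ d) (hc : a + b = d + c), thMap hp ψ ha hc (listObj R r) x = 0) :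
    Killed hp ψ ((a, e) :: (b, e') :: r) x := by
  intro e₁ e₂ l f hf
  cases hf with
  | contr hc ha => exact h' ha.le hc
  | cancel hc ha => exact (congrArg (unitEquiv R _) (h' ha.le hc)).trans (map_zero _)
  | cons _ _ hf => exact h hf

theorem Killed.tmul {a : ℕ} {r : List (ℕ × ℤ)} {x : listObj R r} (hx : Killed hp ψ r x)
    (y : Rpow R a) ⦃e₁ e₂ : ℤ⦄ ⦃l : List (ℕ × ℤ)⦄ ⦃f : listObj R r →ₗ[k] listObj R l⦄
    (hf : Th hp ψ e₁ r e₂ l f) : f.lTensor (Rpow R a) (y ⊗ₜ x) = 0 := by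
  rw [LinearMap.lTensor_tmul, hx hf, TensorProduct.tmul_zero]

theorem Kills.comp_lTensor {a : ℕ} {e : ℤ} {r : List (ℕ × ℤ)} {B : Type u} [AddCommGroup B]
    [Module k B] {F : Rpow R a ⊗[k] listObj R r →ₗ[k] B} (hF : Kills ω ((a, e) :: r) (B := B) F)
    ⦃e₁ e₂ : ℤ⦄ ⦃l : List (ℕ × ℤ)⦄ ⦃f : listObj R l →ₗ[k] listObj R r⦄ (hf : Ph ω e₁ l e₂ r f) :
    F ∘ₗ f.lTensor (Rpow R a) = 0 := by
  -- The leading exponent of `r` is immaterial for `f`, so it can be adjusted to the exponent `e`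
  -- that is prescribed after `a`.
  have := hf.shift (e - e₂)
  rw [sub_add_cancel] at this
  exact hF (.cons a 0 this)

theorem Killed.lTensor_apply {a : ℕ} {e : ℤ} {r : List (ℕ × ℤ)} {x : Rpow R a ⊗[k] listObj R r}
    (hx : Killed hp ψ ((a, e) :: r) x) ⦃e₁ e₂ : ℤ⦄ ⦃l : List (ℕ × ℤ)⦄
    ⦃f : listObj R r →ₗ[k] listObj R l⦄ (hf : Th hp ψ e₁ r e₂ l f) :
    f.lTensor (Rpow R a) x = 0 := by
  have := hf.shift (e - e₁)
  rw [sub_add_cancel] at this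
  exact hx (.cons a 0 this)

/-- There is an element that is killed by all maps in `Th`, and is not in the span of the images of
the maps in `Ph`. -/
def Good (hp : IsPerfect R d) (ψ : Module.Dual k (Rpow R d)) (ω : Rpow R d)
    (l : List (ℕ × ℤ)) : Prop :=
  ∃ (x : listObj R l) (F : listObj R l →ₗ[k] k), Killed hp ψ l x ∧ Kills ω l F ∧ F x ≠ 0

theorem good_nil : Good hp ψ ω [] := by
  refine ⟨(1 : k), LinearMap.id, ?_, ?_, one_ne_zero⟩
  · intro e e' l f hf
    cases hf
  · intro e e' l f hf
    cases hf

/-- At a junction whose exponent is neither `0` nor `-1` the new letter does not interact with the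
rest, so a tensor product of two nondegenerate pairs works. -/
theorem good_cons {a : ℕ} (had : a ≤ d) {e : ℤ} {r : List (ℕ × ℤ)} (he : e = 0 → r = [])
    (he' : e = -1 → r = []) (h : Good hp ψ ω r) : Good hp ψ ω ((a, e) :: r) := by
  obtain ⟨x, F, hx, hF, hxF⟩ := h
  obtain ⟨y, f, hy⟩ := hp.exists_dual_pair had
  refine ⟨y ⊗ₜ x, dualTensor f F, killed_of_ne he' (hx.tmul y), kills_of_ne he ?_, ?_⟩
  · intro e₁ l e₂ g hg
    refine (dualTensor_lTensor f F g).trans ?_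
    rw [hF hg]
    exact LinearMap.zero_comp _
  · have : dualTensor f F (y ⊗ₜ x) = f y * F x := by simp [dualTensor]
    exact fun h => mul_ne_zero hy hxF (this.symm.trans h)

section left

variable {A : Type u} [AddCommGroup A] [Module k A] (S : Calculus R d A)

/-- There is an element as in `Good`, which is detected by a map to `A` that starts with the
multiplication with an element of `R_1`. -/
def LeftGood (hp : IsPerfect R d) (ψ : Module.Dual k (Rpow R d)) (ω : Rpow R d) (a : ℕ) (e : ℤ)
    (r : List (ℕ × ℤ)) : Prop :=
  ∃ (a' : ℕ) (ha : a = 1 + a') (G : Rpow R a' ⊗[k] listObj R r →ₗ[k] A)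
    (x : Rpow R a ⊗[k] listObj R r), Killed hp ψ ((a, e) :: r) x ∧
      Kills ω ((a, e) :: r) (S.lead ha G) ∧ S.lead ha G x ≠ 0

variable {S}

theorem good_of_leftGood {a : ℕ} {e : ℤ} {r : List (ℕ × ℤ)} (h : LeftGood S hp ψ ω a e r) :
    Good hp ψ ω ((a, e) :: r) := by
  obtain ⟨a', ha, G, x, hx, hG, hxG⟩ := h
  obtain ⟨β, hβ⟩ := exists_dual_ne_zero (k := k) hxG
  refine ⟨x, β ∘ₗ S.lead ha G, hx, ?_, hβ⟩
  intro e₁ l e₂ f hf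
  exact (congrArg (β ∘ₗ ·) (hG hf)).trans (LinearMap.comp_zero _)

/-- Fixing the first factor of `F` at a suitable `y` keeps the pairing with `x` nonzero, and frees
the first factor for a map to `A` through its first letter. This loses control at the first
junction, hence the exclusion of exponent `0` there. -/
theorem leftGood_of_good {a : ℕ} (ha : 0 < a) {e : ℤ} {r : List (ℕ × ℤ)} (he : e = 0 → r = [])
    (h : Good hp ψ ω ((a, e) :: r)) : LeftGood S hp ψ ω a e r := by
  obtain ⟨a', ha'⟩ : ∃ a', a = 1 + a' := ⟨a - 1, by omega⟩
  obtain ⟨x, F, hx, hF, hxF⟩ : ∃ (x : Rpow R a ⊗[k] listObj R r)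
      (F : Module.Dual k (Rpow R a ⊗[k] listObj R r)), Killed hp ψ ((a, e) :: r) x ∧
      Kills ω ((a, e) :: r) (B := k) F ∧ F x ≠ 0 := h
  obtain ⟨y, hy⟩ := exists_lTensor_curry_ne_zero (P := Rpow R a) (N := listObj R r) hxF
  have hy' : TensorProduct.rid k _ ((TensorProduct.curry F y).lTensor (Rpow R a) x) ≠ 0 := fun h =>
    hy ((TensorProduct.rid k _).injective (h.trans (map_zero _).symm))
  obtain ⟨f, hf⟩ := S.exists_lead_const_ne_zero ha' hy'
  refine ⟨a', ha', S.const f ∘ₗ (TensorProduct.curry F y).lTensor _, x, hx, ?_, ?_⟩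
  · refine kills_of_ne he fun e₁ l e₂ g hg => ?_
    have h₁ : TensorProduct.curry F y ∘ₗ g = 0 :=
      LinearMap.ext fun w => LinearMap.congr_fun (hF.comp_lTensor hg) (y ⊗ₜ w)
    have h₂ : S.lead ha' (S.const f ∘ₗ (TensorProduct.curry F y).lTensor _) ∘ₗ
        g.lTensor (Rpow R a) = 0 := by
      rw [← S.lead_comp_lTensor, LinearMap.comp_assoc, ← LinearMap.lTensor_comp, h₁,
        LinearMap.lTensor_zero, LinearMap.comp_zero]
    exact h₂
  · rw [← S.lead_comp_lTensor, LinearMap.comp_apply]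
    convert hf using 2
    exact ((TensorProduct.rid k _).symm_apply_apply _).symm.trans
      (by rw [TensorProduct.rid_symm_apply])

/-- Put `y` in front of `x` and extend the map to `A` by `exists_extension`, which provides the
vanishing at the new junction. No contraction starts there, as the exponent is `0`. -/
theorem leftGood_cons (hS : ∀ {n a b : ℕ} (h : n = a + b), S.δ h = comul R h) {c : ℕ} (hc : 0 < c)
    (hcd : c ≤ d) {a : ℕ} {e e₀ : ℤ} (he₀ : e₀ = 0) {r : List (ℕ × ℤ)}
    (h : LeftGood S hp ψ ω a e r) : LeftGood S hp ψ ω c e₀ ((a, e) :: r) := by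
  obtain ⟨a', ha, G, x, hx, hG, hxG⟩ := h
  obtain ⟨c', hc', Γ, y, h₁, h₂⟩ := S.exists_extension ha hc hcd G hxG
  refine ⟨c', hc', Γ ∘ₗ (S.lead ha G).lTensor _, y ⊗ₜ x, ?_, ?_, ?_⟩
  · exact killed_of_ne (by omega) (hx.tmul y)
  · have hlead := S.lead_comp_lTensor hc' Γ (S.lead ha G)
    refine kills_cons (fun e₁ l e₂ f hf => ?_) (fun n hn => ?_)
    · have h₃ : S.lead ha G ∘ₗ f = 0 := hG hf
      refine LinearMap.ext fun t => ?_
      refine (LinearMap.congr_fun hlead.symm _).trans ?_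
      refine (congrArg (S.lead hc' Γ) (LinearMap.lTensor_comp_apply _ _ _ t).symm).trans ?_
      rw [h₃, LinearMap.lTensor_zero]
      exact map_zero _
    · have h₃ : S.phi hn (listObj R r) = phiMap R hn (listObj R r) := by
        rw [Calculus.phi, hS]
        rfl
      refine LinearMap.ext fun t => ?_
      refine (LinearMap.congr_fun hlead.symm _).trans ?_
      have h₄ := LinearMap.congr_fun (h₂ hn) t
      rw [h₃] at h₄
      exact h₄
  · exact fun h => h₁ ((LinearMap.congr_fun (S.lead_comp_lTensor hc' Γ (S.lead ha G)) _).trans h)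

end left

section right

variable {A : Type u} [AddCommGroup A] [Module k A] (T : Calculus R d A)

/-- There are elements as in `Good`, which are parametrized by functionals on an auxiliary space. -/
def RightGood (hp : IsPerfect R d) (ψ : Module.Dual k (Rpow R d)) (ω : Rpow R d) (u : ℕ) (e : ℤ)
    (r : List (ℕ × ℤ)) : Prop :=
  ∃ (c c' : ℕ) (h : d = u + c) (hc : c = 1 + c') (W : Type u) (_ : AddCommGroup W) (_ : Module k W)
    (X : Module.Dual k W →ₗ[k] listObj R r) (G : Rpow R c' ⊗[k] W →ₗ[k] A)
    (F : Module.Dual k (Rpow R u ⊗[k] listObj R r)) (m : Rpow R c ⊗[k] W),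
    Kills ω ((u, e) :: r) (B := k) F ∧ (∀ g, F (suspend h ω X g) = g m) ∧ T.lead hc G m ≠ 0 ∧
      ∀ β : Module.Dual k A, Killed hp ψ ((u, e) :: r) (suspend h ω X (β ∘ₗ T.lead hc G))

variable {T}

theorem good_of_rightGood {u : ℕ} {e : ℤ} {r : List (ℕ × ℤ)} (h : RightGood T hp ψ ω u e r) :
    Good hp ψ ω ((u, e) :: r) := by
  obtain ⟨c, c', h, hc, W, _, _, X, G, F, m, hF, hX, hm, hk⟩ := h
  obtain ⟨β, hβ⟩ := exists_dual_ne_zero (k := k) hm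
  exact ⟨_, F, hk β, hF, fun h0 => hβ ((hX _).symm.trans h0)⟩

/-- The auxiliary space is `k`. Replace `x` by pure tensors with a fixed second factor `δ₀` on which
`F` is still nonzero; the first factor then runs through the contractions of `ω`. This loses control
of contractions at the first junction, hence the exclusion of exponent `-1`. -/
theorem rightGood_of_good (hω : ψ ω = 1) {u : ℕ} (hu : u < d) {e : ℤ} {r : List (ℕ × ℤ)}
    (he : e = -1 → r = []) (hgood : Good hp ψ ω ((u, e) :: r)) : RightGood T hp ψ ω u e r := by
  obtain ⟨c, h⟩ : ∃ c, d = u + c := ⟨d - u, by omega⟩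
  obtain ⟨c', hc⟩ : ∃ c', c = 1 + c' := ⟨c - 1, by omega⟩
  obtain ⟨x, F, hx, hF, hxF⟩ : ∃ (x : Rpow R u ⊗[k] listObj R r)
      (F : Module.Dual k (Rpow R u ⊗[k] listObj R r)), Killed hp ψ ((u, e) :: r) x ∧
      Kills ω ((u, e) :: r) (B := k) F ∧ F x ≠ 0 := hgood
  -- `K` consists of the elements killed by all contractions inside `r`. It contains all left
  -- contractions of `x`, so `δ₀` can be chosen in it.
  let K : Submodule k (listObj R r) :=
    ⨅ (e₁ : ℤ) (e₂ : ℤ) (l : List (ℕ × ℤ)) (f : listObj R r →ₗ[k] listObj R l)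
      (_ : Th hp ψ e₁ r e₂ l f), LinearMap.ker f
  obtain ⟨δ₀, hδ₀, y, hy⟩ := exists_contractL_mem (P := Rpow R u) (N := listObj R r) hxF K
    (fun φ => by
      simp only [K, Submodule.mem_iInf, LinearMap.mem_ker]
      intro e₁ e₂ l f hf
      rw [← contractL_lTensor]
      rw [hx.lTensor_apply hf, map_zero])
  simp only [K, Submodule.mem_iInf, LinearMap.mem_ker] at hδ₀
  let η : Module.Dual k (Rpow R u) := (TensorProduct.curry F).flip δ₀
  have hη : η ≠ 0 := fun h0 => hy (LinearMap.congr_fun h0 y)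
  have hω0 : ω ≠ 0 := by
    rintro rfl
    simp at hω
  have hw := hp.slice_ne_zero h hω0 hη
  obtain ⟨α, hα⟩ := T.exists_lead_const_ne_zero hc hw
  let X : Module.Dual k k →ₗ[k] listObj R r :=
    LinearMap.toSpanSingleton k _ δ₀ ∘ₗ LinearMap.applyₗ (1 : k)
  have key : ∀ g, suspend h ω X g =
      (LinearMap.toSpanSingleton k (listObj R r) δ₀).lTensor _
        ((g ∘ₗ (TensorProduct.rid k _).symm.toLinearMap).lTensor (Rpow R u) (comul R h ω)) := by
    intro g
    rw [suspend_apply, ← LinearMap.lTensor_comp_apply]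
    rfl
  refine ⟨c, c', h, hc, k, _, _, X, T.const α, F, _, hF, ?_, hα, ?_⟩
  · intro g
    rw [suspend_apply, slice_apply]
    generalize comul R h ω = t
    induction t using TensorProduct.induction_on with
    | zero => simp
    | tmul p q =>
      have : F (p ⊗ₜ (g (q ⊗ₜ 1) • δ₀)) = η p * g (q ⊗ₜ 1) := by
        rw [TensorProduct.tmul_smul, map_smul, smul_eq_mul, mul_comm]
        rfl
      refine this.trans ?_
      rw [contractL_tmul, ← TensorProduct.smul_tmul', map_smul, smul_eq_mul]
    | add s t hs ht => simp only [map_add, TensorProduct.add_tmul, hs, ht]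
  · intro β
    refine killed_of_ne he fun e₁ e₂ l f hf => ?_
    have h₁ : f ∘ₗ LinearMap.toSpanSingleton k (listObj R r) δ₀ = 0 := by
      ext
      simpa using hδ₀ e₁ e₂ l f hf
    rw [key, ← LinearMap.lTensor_comp_apply, h₁, LinearMap.lTensor_zero, LinearMap.zero_apply]

/-- The functional becomes `f ⊗ F`, where `f` cuts the given `y` out of `ω`, and the elements become
double suspensions. The extension of the map to `A` vanishes on reversed inclusions, so
`thMap_suspend_suspend` deals with the new junction. No splitting ends there, as the exponent is
`-1`. -/
theorem rightGood_cons (hT : ∀ {n a b : ℕ} (h : n = a + b), T.δ h = comulOp R h) (hω : ψ ω = 1)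
    {u' : ℕ} (hu' : u' < d) (hu₀ : 0 < u') {u : ℕ} {e e₀ : ℤ} (he₀ : e₀ = -1) {r : List (ℕ × ℤ)}
    (h : RightGood T hp ψ ω u e r) : RightGood T hp ψ ω u' e₀ ((u, e) :: r) := by
  obtain ⟨c, c', h, hc, W, _, _, X, G, F, m, hF, hX, hm, hk⟩ := h
  obtain ⟨b, h'⟩ : ∃ b, d = u' + b := ⟨d - u', by omega⟩
  obtain ⟨b', hb, Γ, y, h₁, h₂⟩ := T.exists_extension hc (show 0 < b by omega) (by omega) G hm
  have hω0 : ω ≠ 0 := by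
    rintro rfl
    simp at hω
  obtain ⟨f, hf⟩ := hp.exists_slice_eq h' hω0 y
  have e₁ := T.lead_comp_lTensor hb Γ (T.lead hc G)
  refine ⟨b, b', h', hb, Rpow R c ⊗[k] W, inferInstance, inferInstance, suspend h ω X,
    Γ ∘ₗ (T.lead hc G).lTensor _, dualTensor f F, y ⊗ₜ m, ?_, ?_, ?_, ?_⟩
  · refine kills_of_ne (by omega) fun e₁ l e₂ φ hφ => ?_
    have h₃ : F ∘ₗ φ = 0 := hF hφ
    refine (dualTensor_lTensor f F φ).trans ?_
    rw [h₃]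
    exact LinearMap.zero_comp _
  · intro g
    refine (dualTensor_suspend (N := Rpow R u ⊗[k] listObj R r) h' ω (suspend h ω X) f F g).trans ?_
    rw [← slice_apply, hf, hX]
    rfl
  · rw [← e₁]
    exact h₁
  · intro β
    rw [← e₁]
    refine killed_cons (fun e₁ e₂ l φ hφ => ?_) (fun n hu hn => ?_)
    · refine (LinearMap.lTensor_comp_apply (Rpow R u') φ (suspend h ω X ∘ₗ TensorProduct.curry
        (β ∘ₗ T.lead hb Γ ∘ₗ (T.lead hc G).lTensor (Rpow R b))) (comul R h' ω)).symm.trans ?_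
      -- For a fixed `q` the inner functional is again a functional on `A` after `T.lead hc G`. This
      -- is why `RightGood` asks for the killing condition for all `β`.
      have : φ ∘ₗ suspend h ω X ∘ₗ TensorProduct.curry
          (β ∘ₗ T.lead hb Γ ∘ₗ (T.lead hc G).lTensor (Rpow R b)) = 0 :=
        LinearMap.ext fun q => hk (β ∘ₗ TensorProduct.curry (T.lead hb Γ) q) hφ
      exact (congrArg (fun Y => Y.lTensor (Rpow R u') (comul R h' ω)) this).trans
        (by rw [LinearMap.lTensor_zero, LinearMap.zero_apply])
    · refine thMap_suspend_suspend hp hω h h' hu hn rfl X _ ?_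
      have h₃ := h₂ rfl
      rw [Calculus.phi, hT] at h₃
      rw [LinearMap.comp_assoc, LinearMap.comp_assoc, h₃, LinearMap.comp_zero]

end right

/-- All three properties are carried along, because the next junction decides which one is used.
Exponent `0` uses the left form, exponent `-1` the right form and all others the plain form; in each
case the result can be converted back to the other forms. -/
theorem good_of_calculus {A : Type u} [AddCommGroup A] [Module k A] {S T : Calculus R d A}
    (hS : ∀ {n a b : ℕ} (h : n = a + b), S.δ h = comul R h)
    (hT : ∀ {n a b : ℕ} (h : n = a + b), T.δ h = comulOp R h) (hω : ψ ω = 1)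
    (l : List (ℕ × ℤ)) (hl : ∀ p ∈ l, 0 < p.1 ∧ p.1 < d) :
    Good hp ψ ω l ∧ ∀ a e r, l = (a, e) :: r →
      LeftGood S hp ψ ω a e r ∧ RightGood T hp ψ ω a e r := by
  induction l with
  | nil => exact ⟨good_nil, fun _ _ _ h => absurd h.symm (List.cons_ne_nil _ _)⟩
  | cons p r ih =>
    obtain ⟨a, e⟩ := p
    obtain ⟨ih₁, ih₂⟩ := ih fun p hp => hl p (List.mem_cons_of_mem _ hp)
    obtain ⟨ha, had⟩ := hl (a, e) List.mem_cons_self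
    suffices H : Good hp ψ ω ((a, e) :: r) ∧ LeftGood S hp ψ ω a e r ∧
        RightGood T hp ψ ω a e r by
      refine ⟨H.1, fun a' e' r' h => ?_⟩
      cases h
      exact H.2
    rcases r with _ | ⟨⟨b, e'⟩, r⟩
    · have := good_cons had.le (e := e) (fun _ => rfl) (fun _ => rfl) ih₁
      exact ⟨this, leftGood_of_good ha (fun _ => rfl) this,
        rightGood_of_good hω had (fun _ => rfl) this⟩
    · obtain ⟨hL, hR⟩ := ih₂ b e' r rfl
      by_cases h0 : e = 0
      · have h1 := leftGood_cons hS ha had.le h0 hL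
        have h2 := good_of_leftGood h1
        exact ⟨h2, h1, rightGood_of_good hω had (by omega) h2⟩
      by_cases h1 : e = -1
      · have h1 := rightGood_cons hT hω had ha h1 hR
        have h2 := good_of_rightGood h1
        exact ⟨h2, leftGood_of_good ha (by omega) h2, h1⟩
      have := good_cons had.le (fun h => absurd h h0) (fun h => absurd h h1) ih₁
      exact ⟨this, leftGood_of_good ha (fun h => absurd h h0) this,
        rightGood_of_good hω had (fun h => absurd h h1) this⟩

end good

/-! ### Normal forms of words -/

section normalize

variable {k : Type u} [Field k] {V : Type u} [AddCommGroup V] [Module k V]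
  {R : Submodule k (V ⊗[k] V)} {d : ℕ}

/-- The normal form of a word, and the isomorphism to its space. -/
inductive NF (ψ : Module.Dual k (Rpow R d)) (ω : Rpow R d) :
    ∀ (w : Word d) (_ : ℤ) (l : List (ℕ × ℤ)), (wordObj R w →ₗ[k] listObj R l) → Prop
  | nil : NF ψ ω [] 0 [] LinearMap.id
  | inv {w : Word d} {e : ℤ} {l : List (ℕ × ℤ)} {f : wordObj R w →ₗ[k] listObj R l}
      (h : NF ψ ω w e l f) :
      NF ψ ω (.inv :: w) (e - 1) l (f ∘ₗ contractL _ (Module.Dual.eval k (Rpow R d) ω))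
  | unit {w : Word d} {e : ℤ} {l : List (ℕ × ℤ)} {f : wordObj R w →ₗ[k] listObj R l}
      (h : NF ψ ω w e l f) :
      NF ψ ω (.r 0 d.zero_le :: w) e l (f ∘ₗ (unitEquiv R (wordObj R w)).toLinearMap)
  | top {w : Word d} {e : ℤ} {l : List (ℕ × ℤ)} {f : wordObj R w →ₗ[k] listObj R l}
      (h : NF ψ ω w e l f) : NF ψ ω (.r d le_rfl :: w) (e + 1) l (f ∘ₗ contractL _ ψ)
  | mid {a : ℕ} (ha : 0 < a) (ha' : a < d) {w : Word d} {e : ℤ} {l : List (ℕ × ℤ)}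
      {f : wordObj R w →ₗ[k] listObj R l} (h : NF ψ ω w e l f) :
      NF ψ ω (.r a ha'.le :: w) 0 ((a, e) :: l) (f.lTensor (Rpow R a))

variable {ψ : Module.Dual k (Rpow R d)} {ω : Rpow R d}

theorem NF.exists (w : Word d) : ∃ e l f, NF ψ ω w e l f := by
  induction w with
  | nil => exact ⟨_, _, _, .nil⟩
  | cons x w ih =>
    obtain ⟨e, l, f, h⟩ := ih
    rcases x with ⟨a, ha⟩ | _
    · rcases Nat.eq_zero_or_pos a with rfl | h0
      · exact ⟨_, _, _, h.unit⟩
      · rcases ha.eq_or_lt with rfl | h1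
        · exact ⟨_, _, _, h.top⟩
        · exact ⟨_, _, _, h.mid h0 h1⟩
    · exact ⟨_, _, _, h.inv⟩

theorem NF.unique (hd : 0 < d) {w : Word d} {e : ℤ} {l : List (ℕ × ℤ)}
    {f : wordObj R w →ₗ[k] listObj R l} (h : NF ψ ω w e l f) : ∀ {e' : ℤ} {l' : List (ℕ × ℤ)}
    {f' : wordObj R w →ₗ[k] listObj R l'} (_ : NF ψ ω w e' l' f'),
    (⟨e, l, f⟩ : Σ (_ : ℤ) (l : List (ℕ × ℤ)), wordObj R w →ₗ[k] listObj R l) = ⟨e', l', f'⟩ := by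
  induction h with
  | nil =>
    intro e' l' f' h'
    cases h'
    rfl
  | inv _ ih =>
    intro e' l' f' h'
    cases h' with
    | inv h' => cases ih h'; rfl
  | unit _ ih =>
    intro e' l' f' h'
    cases h' with
    | unit h' => cases ih h'; rfl
    | top => omega
    | mid => omega
  | top _ ih =>
    intro e' l' f' h'
    cases h' with
    | unit => omega
    | top h' => cases ih h'; rfl
    | mid => omega
  | mid _ _ _ ih =>
    intro e' l' f' h'
    cases h' with
    | unit => omega
    | top => omega
    | mid _ _ h' => cases ih h'; rfl

theorem NF.mem {w : Word d} {e : ℤ} {l : List (ℕ × ℤ)}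
    {f : wordObj R w →ₗ[k] listObj R l} (h : NF ψ ω w e l f) : ∀ p ∈ l, 0 < p.1 ∧ p.1 < d := by
  induction h with
  | nil => simp
  | inv _ ih => exact ih
  | unit _ ih => exact ih
  | top _ ih => exact ih
  | mid ha ha' _ ih =>
    intro p hp
    rcases List.mem_cons.1 hp with rfl | hp
    · exact ⟨ha, ha'⟩
    · exact ih p hp

section scalars

theorem eq_smul_top (hp : IsPerfect R d) (hω : ψ ω = 1) (x : Rpow R d) : x = ψ x • ω := by
  have := smul_comm_of_perfect hp ψ LinearMap.id ω x
  rwa [hω, one_smul] at this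

theorem eq_smul_dual (hp : IsPerfect R d) (hω : ψ ω = 1) (χ : Module.Dual k (Rpow R d)) :
    χ = χ ω • ψ := by
  ext x
  have := smul_comm_of_perfect hp ψ χ ω x
  rw [hω, one_smul] at this
  rw [this, LinearMap.smul_apply, smul_eq_mul, smul_eq_mul, mul_comm]

theorem dual_apply_eq (hp : IsPerfect R d) (hω : ψ ω = 1) (χ : Module.Dual k (Rpow R d))
    (x : Rpow R d) : χ x = χ ω * ψ x :=
  LinearMap.congr_fun (eq_smul_dual hp hω χ) x

theorem contractL_bijective {X : Type u} [AddCommGroup X] [Module k X] {s : X →ₗ[k] k}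
    (hs : Function.Bijective s) (W : Type u) [AddCommGroup W] [Module k W] :
    Function.Bijective (contractL W s) :=
  (LinearEquiv.rTensor W (LinearEquiv.ofBijective s hs) ≪≫ₗ TensorProduct.lid k W).bijective

theorem bijective_top (hp : IsPerfect R d) (hω : ψ ω = 1) : Function.Bijective ψ := by
  refine ⟨fun x y h => ?_, fun c => ⟨c • ω, by simp [hω]⟩⟩
  rw [eq_smul_top hp hω x, h, ← eq_smul_top hp hω y]

theorem bijective_eval (hp : IsPerfect R d) (hω : ψ ω = 1) :
    Function.Bijective (Module.Dual.eval k (Rpow R d) ω) := by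
  refine ⟨fun x y h => ?_, fun c => ⟨c • ψ, by simp [hω]⟩⟩
  rw [eq_smul_dual hp hω x, eq_smul_dual hp hω y]
  exact congrArg (· • ψ) h

end scalars

theorem NF.bijective (hp : IsPerfect R d) (hω : ψ ω = 1) {w : Word d} {e : ℤ}
    {l : List (ℕ × ℤ)} {f : wordObj R w →ₗ[k] listObj R l} (h : NF ψ ω w e l f) :
    Function.Bijective f := by
  induction h with
  | nil => exact Function.bijective_id
  | inv _ ih => exact ih.comp (contractL_bijective (bijective_eval hp hω) _)
  | unit _ ih => exact ih.comp (unitEquiv R _).bijective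
  | top _ ih => exact ih.comp (contractL_bijective (bijective_top hp hω) _)
  | @mid a _ _ _ _ _ f _ ih =>
    exact (LinearEquiv.lTensor (Rpow R a) (LinearEquiv.ofBijective f ih)).bijective

section length

/-- The number of letters `r_a` with `0 < a < d`. -/
def lengthHom (d : ℕ) : Lam d →* Multiplicative ℕ :=
  PresentedMonoid.lift
    (fun x => Multiplicative.ofAdd (match x with
      | .r a _ => if 0 < a ∧ a < d then 1 else 0
      | .inv => 0)) (by
    rintro _ _ (_ | _ | _) <;> simp)

theorem lengthHom_r {a : ℕ} (ha : a ≤ d) :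
    lengthHom d (Lam.r a ha) = Multiplicative.ofAdd (if 0 < a ∧ a < d then 1 else 0) :=
  PresentedMonoid.lift_of ..

theorem lengthHom_inv : lengthHom d (Lam.inv d) = 1 :=
  PresentedMonoid.lift_of ..

theorem toLam_cons (x : Letter d) (w : Word d) :
    Word.toLam (x :: w) = PresentedMonoid.of _ x * Word.toLam w := by
  exact map_mul (PresentedMonoid.mk (MonoidRel d)) (FreeMonoid.of x) (FreeMonoid.ofList w)

/-- Here `a` and `b` lie strictly between `0` and `d`. A splitting replaces at most one such letter
by two, and a pair adds two. -/
theorem Lam.Basic.lengthHom_lt {x y : Lam d} (h : Lam.Basic d x y) :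
    (lengthHom d x).toAdd < (lengthHom d y).toAdd := by
  cases h with
  | split u v a b ha hb h =>
    simp only [map_mul, lengthHom_r, toAdd_mul, toAdd_ofAdd]
    split_ifs <;> omega
  | pair u v a b ha hb h =>
    simp only [map_mul, lengthHom_r, lengthHom_inv, toAdd_mul, toAdd_ofAdd, toAdd_one]
    split_ifs <;> omega

theorem Lam.Lt.lengthHom_lt {x y : Lam d} (h : Lam.Lt x y) :
    (lengthHom d x).toAdd < (lengthHom d y).toAdd := by
  induction h with
  | single h => exact h.lengthHom_lt
  | tail _ h ih => exact ih.trans h.lengthHom_lt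

theorem NF.length_eq {w : Word d} {e : ℤ} {l : List (ℕ × ℤ)}
    {f : wordObj R w →ₗ[k] listObj R l} (h : NF ψ ω w e l f) :
    (lengthHom d w.toLam).toAdd = l.length := by
  induction h with
  | nil => exact congrArg Multiplicative.toAdd (map_one (lengthHom d))
  | inv _ ih =>
    rw [toLam_cons, map_mul, toAdd_mul, ih]
    exact Nat.zero_add _
  | unit _ ih =>
    rw [toLam_cons, map_mul, toAdd_mul, ih]
    refine (congrArg (· + _) (congrArg Multiplicative.toAdd (lengthHom_r _))).trans ?_
    simp
  | top _ ih =>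
    rw [toLam_cons, map_mul, toAdd_mul, ih]
    refine (congrArg (· + _) (congrArg Multiplicative.toAdd (lengthHom_r _))).trans ?_
    simp
  | mid ha ha' _ ih =>
    rw [toLam_cons, map_mul, toAdd_mul, ih]
    refine (congrArg (· + _) (congrArg Multiplicative.toAdd (lengthHom_r _))).trans ?_
    simp [ha, ha', Nat.add_comm]

end length

end normalize

/-! ### Morphisms of `𝒰` in terms of normal forms -/

section steps

variable {k : Type u} [Field k] {V : Type u} [AddCommGroup V] [Module k V]
  {R : Submodule k (V ⊗[k] V)} {d : ℕ} {hp : IsPerfect R d} {ψ : Module.Dual k (Rpow R d)}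
  {ω : Rpow R d}

/-- The identities and the maps in `Th` and `Ph`. -/
def StepRel (hp : IsPerfect R d) (ψ : Module.Dual k (Rpow R d)) (ω : Rpow R d) : MapRel R :=
  fun e l e' l' f => (Th hp ψ).Refl e l e' l' f ∨ (Ph ω).Refl e l e' l' f

theorem StepRel.refl {e e' : ℤ} (h : e = e') (l : List (ℕ × ℤ)) :
    StepRel hp ψ ω e l e' l LinearMap.id := by
  subst h
  exact .inl (.refl _ _)

theorem StepRel.shift {e e' : ℤ} {l l' : List (ℕ × ℤ)} {f : listObj R l →ₗ[k] listObj R l'}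
    (h : StepRel hp ψ ω e l e' l' f) (s : ℤ) : StepRel hp ψ ω (e + s) l (e' + s) l' f := by
  rw [add_comm e, add_comm e']
  rcases h with h | h
  · cases h with
    | refl => exact .refl rfl _
    | of h => exact .inl (.of (h.shift s))
  · cases h with
    | refl => exact .refl rfl _
    | of h => exact .inr (.of (h.shift s))

theorem StepRel.cons (a : ℕ) (e₀ : ℤ) {e e' : ℤ} {l l' : List (ℕ × ℤ)}
    {f : listObj R l →ₗ[k] listObj R l'} (h : StepRel hp ψ ω e l e' l' f) :
    StepRel hp ψ ω e₀ ((a, e) :: l) e₀ ((a, e') :: l') (f.lTensor (Rpow R a)) :=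
  h.imp (Th.refl_cons a e₀) (Ph.refl_cons a e₀)

/-- The map `f`, which starts at a normal form, is a map in `StepRel` in terms of a normal form of
its target. -/
def Normalizes (hp : IsPerfect R d) (ψ : Module.Dual k (Rpow R d)) (ω : Rpow R d) {u v : Word d}
    (s : wordObj R u →ₗ[k] wordObj R v) (e : ℤ) (l : List (ℕ × ℤ))
    (f : wordObj R u →ₗ[k] listObj R l) : Prop :=
  ∃ e' l' f' g, NF ψ ω v e' l' f' ∧ StepRel hp ψ ω e l e' l' g ∧ f' ∘ₗ s = g ∘ₗ f

section
variable {W W' : Type u} [AddCommGroup W] [Module k W] [AddCommGroup W'] [Module k W']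

theorem contractL_nat {X : Type u} [AddCommGroup X] [Module k X] (s : Module.Dual k X)
    (f : W →ₗ[k] W') : f ∘ₗ contractL W s = contractL W' s ∘ₗ f.lTensor X := by
  ext x w
  simp

theorem thetaLin_smul (hω : ψ ω = 1) {a b c : ℕ} (ha : a ≤ d) (h : a + b = d + c) (x : Rpow R a)
    (χ : Module.Dual k (Rpow R d)) (y : Rpow R b) :
    thetaLin hp ha h x χ y = χ ω • thetaLin hp ha h x ψ y := by
  conv_lhs => rw [eq_smul_dual hp hω χ]
  rw [map_smul, LinearMap.smul_apply]

/-- `R_d^{-1}` is spanned by `ψ`, so a contraction with a variable element of it is the one with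
`ψ`, times the value at `ω`. -/
theorem triMap_eq_thMap (hω : ψ ω = 1) {a b c : ℕ} (ha : a ≤ d) (h : a + b = d + c)
    (f : W →ₗ[k] W') :
    f.lTensor (Rpow R c) ∘ₗ triMap (thetaLin hp ha h) W =
      thMap hp ψ ha h W' ∘ₗ ((f.lTensor (Rpow R b)) ∘ₗ
        contractL _ (Module.Dual.eval k (Rpow R d) ω)).lTensor (Rpow R a) := by
  ext x χ y w
  simp [thetaLin_smul hω ha h x χ y, TensorProduct.smul_tmul, TensorProduct.tmul_smul]

theorem phiMap_eq_top (hp : IsPerfect R d) (hω : ψ ω = 1) {a b : ℕ} (h : d = a + b)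
    (f : W →ₗ[k] W') :
    (f.lTensor (Rpow R b)).lTensor (Rpow R a) ∘ₗ phiMap R h W =
      (phiMap R h W' ∘ₗ TensorProduct.mk k (Rpow R d) W' ω) ∘ₗ f ∘ₗ contractL W ψ := by
  rw [phiMap_nat]
  ext x w
  have := eq_smul_top hp hω x
  conv_lhs => rw [TensorProduct.AlgebraTensorModule.curry_apply, TensorProduct.curry_apply, this]
  simp [TensorProduct.smul_tmul']

theorem contractL_contractL_top (hp : IsPerfect R d) (hω : ψ ω = 1) :
    contractL W (Module.Dual.eval k (Rpow R d) ω) ∘ₗ contractL _ ψ =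
      (cancelEquiv (TensorProduct.comm k _ _ ≪≫ₗ evalEquiv hp) W).toLinearMap := by
  ext x χ w
  simp [dual_apply_eq hp hω χ x, mul_smul, smul_comm (ψ x)]

theorem contractL_contractL_inv (hp : IsPerfect R d) (hω : ψ ω = 1) :
    contractL W ψ ∘ₗ contractL _ (Module.Dual.eval k (Rpow R d) ω) =
      (cancelEquiv (evalEquiv hp) W).toLinearMap := by
  ext χ x w
  simp [dual_apply_eq hp hω χ x, mul_smul]

end

/-- For `a = 0` or `b = 0` the morphism becomes an identity. Otherwise it is an elementary
splitting, which inserts `ω` if `n = d`. -/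
theorem normalizes_phi (hω : ψ ω = 1) {n a b : ℕ} (hn : n ≤ d) (ha : a ≤ d)
    (hb : b ≤ d) (h : n = a + b) (w : Word d) {e : ℤ} {l : List (ℕ × ℤ)}
    {f : wordObj R (.r n hn :: w) →ₗ[k] listObj R l} (hf : NF ψ ω (.r n hn :: w) e l f) :
    Normalizes hp ψ ω (stepMap hp (.phi hn ha hb h w)) e l f := by
  rcases Nat.eq_zero_or_pos a with rfl | ha₀
  · obtain rfl : n = b := by omega
    refine ⟨_, _, _, _, hf.unit, .refl rfl _, ?_⟩
    rw [stepMap, phiMap_zero_left]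
    exact LinearMap.ext fun t => congrArg f ((unitEquiv R _).apply_symm_apply t)
  rcases Nat.eq_zero_or_pos b with rfl | hb₀
  · obtain rfl : n = a := by omega
    have key : ∀ {W : Type u} [AddCommGroup W] [Module k W] (s : Module.Dual k (Rpow R n)),
        (unitEquiv R W).toLinearMap ∘ₗ contractL _ s ∘ₗ phiMap R h W = contractL _ s := by
      intro W _ _ s
      rw [phiMap_zero_right]
      ext x w
      simp
    cases hf with
    | unit => omega
    | @top _ e l f hf =>
      refine ⟨_, _, _, _, hf.unit.top, .refl rfl _, ?_⟩
      exact congrArg (f ∘ₗ ·) (key ψ)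
    | @mid _ _ _ _ e l f hf =>
      refine ⟨_, _, _, _, hf.unit.mid ha₀ (by omega), .refl rfl _, ?_⟩
      rw [stepMap, phiMap_zero_right]
      have h₁ : (f ∘ₗ (unitEquiv R (wordObj R w)).toLinearMap) ∘ₗ
          (unitEquiv R (wordObj R w)).symm.toLinearMap = f :=
        LinearMap.ext fun t => congrArg f ((unitEquiv R _).apply_symm_apply t)
      exact (LinearMap.lTensor_comp _ _ _).symm.trans (congrArg (LinearMap.lTensor (Rpow R n)) h₁)
  have had : a < d := by omega
  have hbd : b < d := by omega
  cases hf with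
  | unit => omega
  | @top _ e l f hf =>
    exact ⟨_, _, _, _, (hf.mid hb₀ hbd).mid ha₀ had,
      .inr (.of (.top h ha₀ hb₀ _ _ _ _ rfl (by ring) _)), phiMap_eq_top hp hω h f⟩
  | @mid _ _ hnd _ e l f hf =>
    exact ⟨_, _, _, _, (hf.mid hb₀ hbd).mid ha₀ had,
      .inr (.of (.split h ha₀ hb₀ hnd _ _ _ rfl _)), phiMap_nat _ _ h f⟩

theorem normalizes_mulInv (hω : ψ ω = 1) (hd : 0 < d) (w : Word d) {e : ℤ} {l : List (ℕ × ℤ)}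
    {f : wordObj R (.r d le_rfl :: .inv :: w) →ₗ[k] listObj R l}
    (hf : NF ψ ω (.r d le_rfl :: .inv :: w) e l f) :
    ∃ f', NF ψ ω w e l f' ∧
      f = f' ∘ₗ (cancelEquiv (TensorProduct.comm k _ _ ≪≫ₗ evalEquiv hp)
        (wordObj R w)).toLinearMap := by
  obtain ⟨e', l', f', h⟩ := NF.exists (ψ := ψ) (ω := ω) w
  cases NF.unique hd h.inv.top hf
  refine ⟨f', by rwa [sub_add_cancel], ?_⟩
  rw [← contractL_contractL_top hp hω]
  rfl

theorem normalizes_invMul (hω : ψ ω = 1) (hd : 0 < d) (w : Word d) {e : ℤ} {l : List (ℕ × ℤ)}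
    {f : wordObj R (.inv :: .r d le_rfl :: w) →ₗ[k] listObj R l}
    (hf : NF ψ ω (.inv :: .r d le_rfl :: w) e l f) :
    ∃ f', NF ψ ω w e l f' ∧
      f = f' ∘ₗ (cancelEquiv (evalEquiv hp) (wordObj R w)).toLinearMap := by
  obtain ⟨e', l', f', h⟩ := NF.exists (ψ := ψ) (ω := ω) w
  cases NF.unique hd h.top.inv hf
  refine ⟨f', by rwa [add_sub_cancel_right], ?_⟩
  rw [← contractL_contractL_inv hp hω]
  rfl

theorem unitEquiv_triMap_top {W : Type u} [AddCommGroup W] [Module k W] (hp : IsPerfect R d)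
    (h₀ : 0 ≤ d) (h : 0 + d = d + 0) :
    (unitEquiv R W).toLinearMap ∘ₗ triMap (thetaLin hp h₀ h) W =
      (cancelEquiv (evalEquiv hp) W).toLinearMap ∘ₗ
        (unitEquiv R (Module.Dual k (Rpow R d) ⊗[k] (Rpow R d ⊗[k] W))).toLinearMap := by
  rw [triMap_top_right]
  ext x χ y w
  simp [unitEquiv]
  exact smul_comm _ _ _

/-- For `a = d` or `b = d` the morphism becomes an identity. Otherwise it is an elementary
contraction, which removes both letters if `c = 0`. -/
theorem normalizes_theta (hω : ψ ω = 1) (hd : 0 < d) {a b c : ℕ} (ha : a ≤ d) (hb : b ≤ d)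
    (hc : c ≤ d) (h : a + b = d + c) (w : Word d) {e : ℤ} {l : List (ℕ × ℤ)}
    {f : wordObj R (.r a ha :: .inv :: .r b hb :: w) →ₗ[k] listObj R l}
    (hf : NF ψ ω (.r a ha :: .inv :: .r b hb :: w) e l f) :
    Normalizes hp ψ ω (stepMap hp (.theta ha hb hc h w)) e l f := by
  rcases ha.eq_or_lt with rfl | had
  · obtain rfl : b = c := by omega
    obtain ⟨f', h', rfl⟩ := normalizes_mulInv (hp := hp) hω hd _ hf
    refine ⟨_, _, _, _, h', .refl rfl _, ?_⟩
    rw [stepMap, triMap_top_left]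
    rfl
  rcases hb.eq_or_lt with rfl | hbd
  · obtain rfl : a = c := by omega
    cases hf with
    | unit hf =>
      obtain ⟨f', h', rfl⟩ := normalizes_invMul (hp := hp) hω hd _ hf
      refine ⟨_, _, _, _, h'.unit, .refl rfl _, ?_⟩
      exact LinearMap.ext fun t =>
        congrArg f' (LinearMap.congr_fun (unitEquiv_triMap_top (W := wordObj R w) hp ha h) t)
    | top => exact absurd had (lt_irrefl _)
    | mid ha₀ _ hf =>
      obtain ⟨f', h', rfl⟩ := normalizes_invMul (hp := hp) hω hd _ hf
      refine ⟨_, _, _, _, h'.mid ha₀ had, .refl rfl _, ?_⟩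
      rw [stepMap, triMap_top_right]
      exact (LinearMap.lTensor_comp _ _ _).symm
  cases hf with
  | unit => omega
  | top => omega
  | mid ha₀ _ hf =>
    cases hf with
    | inv hf =>
      cases hf with
      | unit => omega
      | top => omega
      | @mid _ hb₀ _ _ e l f hf =>
        rcases Nat.eq_zero_or_pos c with rfl | hc₀
        · refine ⟨_, _, _, _, hf.unit,
            .inl (.of (.cancel h had hbd _ _ _ _ (by norm_num) (by ring) _)), ?_⟩
          refine LinearMap.ext fun t => ?_
          have h₁ := LinearMap.congr_fun (unitEquiv_nat (R := R) _ _ f)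
            (triMap (thetaLin hp ha h) (wordObj R w) t)
          have h₂ := LinearMap.congr_fun (triMap_eq_thMap (hp := hp) hω ha h f) t
          exact h₁.trans (congrArg (unitEquiv R _) h₂)
        · exact ⟨_, _, _, _, hf.mid hc₀ (by omega),
            .inl (.of (.contr h had hbd hc₀ _ _ _ (by norm_num) _)),
            triMap_eq_thMap hω ha h f⟩

/-- The canonical isomorphisms of `𝒰` become identities because of `ψ ω = 1`; only `φ` and `θ`
contribute. -/
theorem normalizes_step (hω : ψ ω = 1) (hd : 0 < d) {u v : Word d} (s : Step d u v) :
    ∀ {e : ℤ} {l : List (ℕ × ℤ)} {f : wordObj R u →ₗ[k] listObj R l} (_ : NF ψ ω u e l f),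
      Normalizes hp ψ ω (stepMap hp s) e l f := by
  induction s with
  | phi hn ha hb h w => exact normalizes_phi hω hn ha hb h w
  | theta ha hb hc h w => exact normalizes_theta hω hd ha hb hc h w
  | unit w =>
    intro e l f hf
    cases hf with
    | unit hf => exact ⟨_, _, _, _, hf, .refl rfl _, rfl⟩
    | top => omega
    | mid ha => omega
  | unitInv w =>
    intro e l f hf
    exact ⟨_, _, _, _, hf.unit, .refl rfl _,
      LinearMap.ext fun t => congrArg f ((unitEquiv R _).apply_symm_apply t)⟩
  | mulInv w =>
    intro e l f hf
    obtain ⟨f', h', rfl⟩ := normalizes_mulInv (hp := hp) hω hd _ hf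
    exact ⟨_, _, _, _, h', .refl rfl _, rfl⟩
  | mulInvInv w =>
    intro e l f hf
    refine ⟨_, _, _, _, hf.inv.top, .refl (by ring) _, ?_⟩
    refine LinearMap.ext fun t => congrArg f ?_
    refine (LinearMap.congr_fun (contractL_contractL_top (W := wordObj R w) hp hω) _).trans ?_
    exact LinearEquiv.apply_symm_apply _ t
  | invMul w =>
    intro e l f hf
    obtain ⟨f', h', rfl⟩ := normalizes_invMul (hp := hp) hω hd _ hf
    exact ⟨_, _, _, _, h', .refl rfl _, rfl⟩
  | invMulInv w =>
    intro e l f hf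
    refine ⟨_, _, _, _, hf.top.inv, .refl (by ring) _, ?_⟩
    refine LinearMap.ext fun t => congrArg f ?_
    refine (LinearMap.congr_fun (contractL_contractL_inv (W := wordObj R w) hp hω) _).trans ?_
    exact LinearEquiv.apply_symm_apply _ t
  | cons x s ih =>
    intro e l f hf
    cases hf with
    -- A letter `r_d^{±1}` in front only shifts the leading exponent.
    | inv hf =>
      obtain ⟨e', l', f', g, h₁, h₂, h₃⟩ := ih hf
      refine ⟨_, _, _, g, h₁.inv, h₂.shift (-1), ?_⟩
      refine LinearMap.ext fun t => ?_
      refine (congrArg f' (LinearMap.congr_fun (contractL_nat _ (stepMap hp s)) t).symm).trans ?_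
      exact LinearMap.congr_fun h₃ _
    | unit hf =>
      obtain ⟨e', l', f', g, h₁, h₂, h₃⟩ := ih hf
      refine ⟨_, _, _, g, h₁.unit, h₂, ?_⟩
      refine LinearMap.ext fun t => ?_
      refine (congrArg f' (LinearMap.congr_fun
        (unitEquiv_nat (R := R) _ _ (stepMap hp s)) t).symm).trans ?_
      exact LinearMap.congr_fun h₃ _
    | top hf =>
      obtain ⟨e', l', f', g, h₁, h₂, h₃⟩ := ih hf
      refine ⟨_, _, _, g, h₁.top, h₂.shift 1, ?_⟩
      refine LinearMap.ext fun t => ?_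
      refine (congrArg f' (LinearMap.congr_fun (contractL_nat _ (stepMap hp s)) t).symm).trans ?_
      exact LinearMap.congr_fun h₃ _
    | mid ha ha' hf =>
      obtain ⟨e', l', f', g, h₁, h₂, h₃⟩ := ih hf
      refine ⟨_, _, _, _, h₁.mid ha ha', h₂.cons _ _, ?_⟩
      exact (LinearMap.lTensor_comp _ _ _).symm.trans
        ((congrArg (LinearMap.lTensor _) h₃).trans (LinearMap.lTensor_comp _ _ _))

theorem normalizes_path (hω : ψ ω = 1) (hd : 0 < d) {u v : Paths (Word d)} (p : u ⟶ v)
    {e : ℤ} {l : List (ℕ × ℤ)} {f : wordObj R u →ₗ[k] listObj R l} (hf : NF ψ ω u e l f) :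
    ∃ e' l' f' g, NF ψ ω v e' l' f' ∧ FactorsStar hp ψ ω e l e' l' g ∧
      f' ∘ₗ ((pathFunctor hp).map p).hom = g ∘ₗ f := by
  induction p using Paths.induction with
  | id =>
    refine ⟨e, l, f, LinearMap.id, hf, ⟨_, _, _, _, .refl _ _, .refl _ _, rfl⟩, ?_⟩
    exact congrArg (f ∘ₗ ModuleCat.Hom.hom ·) ((pathFunctor hp).map_id _)
  | comp p s ih =>
    obtain ⟨e', l', f', g, h₁, h₂, h₃⟩ := ih hf
    obtain ⟨e'', l'', f'', g', h₁', h₂', h₃'⟩ := normalizes_step (hp := hp) hω hd s h₁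
    refine ⟨e'', l'', f'', g' ∘ₗ g, h₁', ?_, ?_⟩
    · exact h₂'.elim (fun h => h₂.comp_Th hω h) (fun h => h₂.comp_Ph h)
    · have h₄ : (pathFunctor hp).map (p ≫ (Paths.of _).map s) =
          (pathFunctor hp).map p ≫ ModuleCat.ofHom (stepMap hp s) := Paths.lift_cons _ p s
      rw [h₄]
      refine LinearMap.ext fun t => ?_
      refine (LinearMap.congr_fun h₃' _).trans ?_
      exact congrArg g' (LinearMap.congr_fun h₃ t)

/-- Every morphism of `𝒰` is represented by a path, and uniqueness of normal forms allows the one of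
the target to be prescribed. -/
theorem normalizes_map (hω : ψ ω = 1) (hd : 0 < d) {X Y : U d} (p : X ⟶ Y)
    {e : ℤ} {l : List (ℕ × ℤ)} {f : wordObj R X.as →ₗ[k] listObj R l} (hf : NF ψ ω X.as e l f)
    {e' : ℤ} {l' : List (ℕ × ℤ)} {f' : wordObj R Y.as →ₗ[k] listObj R l'}
    (hf' : NF ψ ω Y.as e' l' f') :
    ∃ g, FactorsStar hp ψ ω e l e' l' g ∧ ∀ x, f' (((M hp).map p).hom x) = g (f x) := by
  obtain ⟨q, rfl⟩ := (CategoryTheory.Quotient.functor (URel d)).map_surjective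
    (X := X.as) (Y := Y.as) p
  obtain ⟨e₁, l₁, f₁, g, h₁, h₂, h₃⟩ := normalizes_path (hp := hp) hω hd q hf
  cases NF.unique hd hf' h₁
  exact ⟨g, h₂, fun x => LinearMap.congr_fun h₃ x⟩

end steps

/-! ### Conclusion for `Δ(λ) → ∇(λ)` -/

section standard

variable {k : Type u} [Field k] {V : Type u} [AddCommGroup V] [Module k V]
  {R : Submodule k (V ⊗[k] V)} {d : ℕ}

theorem mem_delta_of_forall {hp : IsPerfect R d} {X : U d} {x : (M hp).obj X}
    (h : ∀ (Y : U d) (p : X ⟶ Y), Lam.Lt Y.toLam X.toLam → ((M hp).map p).hom x = 0) :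
    x ∈ Delta hp X :=
  (Submodule.mem_iInf _).2 fun Y => (Submodule.mem_iInf _).2 fun p =>
    (Submodule.mem_iInf _).2 fun hlt => h Y p hlt

theorem nablaKer_le_of_forall {hp : IsPerfect R d} {X : U d} {N : Submodule k ((M hp).obj X)}
    (h : ∀ (Y : U d) (p : Y ⟶ X), Lam.Lt Y.toLam X.toLam → ∀ z, ((M hp).map p).hom z ∈ N) :
    nablaKer hp X ≤ N :=
  iSup_le fun Y => iSup_le fun p => iSup_le fun hlt => by
    rintro _ ⟨z, rfl⟩
    exact h Y p hlt z

/-- It suffices to find one element of `Δ(λ)` that does not vanish in `∇(λ)`. -/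
theorem nontrivial_of_mem_delta (hp : IsPerfect R d) (X : U d) {x : (M hp).obj X}
    (hx : x ∈ Delta hp X) (hx' : x ∉ nablaKer hp X) :
    deltaToNabla hp X ≠ 0 ∧ Nontrivial (Delta hp X) ∧ Nontrivial (Nabla hp X) ∧
      Nontrivial (L hp X) := by
  have h : deltaToNabla hp X ⟨x, hx⟩ ≠ 0 := fun h =>
    hx' ((Submodule.Quotient.mk_eq_zero _).1 h)
  refine ⟨fun h0 => h (LinearMap.congr_fun h0 _), ⟨⟨x, hx⟩, 0, fun h0 => h (by rw [h0, map_zero])⟩,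
    ⟨_, 0, h⟩, ⟨⟨_, LinearMap.mem_range_self _ ⟨x, hx⟩⟩, 0, fun h0 => h (congrArg Subtype.val h0)⟩⟩

/-- If `μ < λ` then `μ` has fewer letters than `λ`. So every morphism `λ → μ` involves a
contraction, which kills `x`, and every morphism `μ → λ` ends with a splitting, whose image is
killed by `F`. -/
theorem nontrivial_of_good {hp : IsPerfect R d} {ψ : Module.Dual k (Rpow R d)} {ω : Rpow R d}
    (hω : ψ ω = 1) (hd : 0 < d)
    (H : ∀ l : List (ℕ × ℤ), (∀ p ∈ l, 0 < p.1 ∧ p.1 < d) → Good hp ψ ω l) (X : U d) :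
    deltaToNabla hp X ≠ 0 ∧ Nontrivial (Delta hp X) ∧ Nontrivial (Nabla hp X) ∧
      Nontrivial (L hp X) := by
  obtain ⟨e, l, f, hf⟩ := NF.exists (ψ := ψ) (ω := ω) X.as
  obtain ⟨x, F, hx, hF, hxF⟩ := H l hf.mem
  obtain ⟨y, rfl⟩ := (hf.bijective hp hω).2 x
  refine nontrivial_of_mem_delta hp X (x := y) ?_ fun h => hxF ?_
  · refine mem_delta_of_forall fun Y p hlt => ?_
    obtain ⟨e', l', f', hf'⟩ := NF.exists (ψ := ψ) (ω := ω) Y.as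
    obtain ⟨g, hg, hfg⟩ := normalizes_map (hp := hp) hω hd p hf hf'
    refine (hf'.bijective hp hω).1
      (((hfg y).trans (hg.apply_eq_zero ?_ hx)).trans (map_zero f').symm)
    rw [← hf.length_eq, ← hf'.length_eq]
    exact hlt.lengthHom_lt
  · refine nablaKer_le_of_forall (N := LinearMap.ker (F ∘ₗ f)) (fun Y p hlt z => ?_) h
    obtain ⟨e', l', f', hf'⟩ := NF.exists (ψ := ψ) (ω := ω) Y.as
    obtain ⟨g, hg, hfg⟩ := normalizes_map (hp := hp) hω hd p hf' hf
    refine LinearMap.mem_ker.2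
      ((congrArg F (hfg z)).trans (LinearMap.congr_fun (hg.comp_eq_zero ?_ hF) (f' z)))
    rw [← hf.length_eq, ← hf'.length_eq]
    exact hlt.lengthHom_lt

theorem finrank_wordObj_zero (R : Submodule k (V ⊗[k] V)) (w : Word 0) :
    Module.finrank k (wordObj R w) = 1 := by
  have h₀ : Module.finrank k (Rpow R 0) = 1 :=
    (rZero R).symm.finrank_eq.trans (Module.finrank_self k)
  induction w with
  | nil => exact Module.finrank_self k
  | cons x w ih =>
    have hx : Module.finrank k (letterObj R x) = 1 := by
      rcases x with ⟨a, ha⟩ | _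
      · obtain rfl : a = 0 := by omega
        exact h₀
      · exact Subspace.dual_finrank_eq.trans h₀
    refine (Module.finrank_tensorProduct (R := k) (S := k) (M := letterObj R x)
      (M' := wordObj R w)).trans ?_
    rw [hx, ih]

/-- For `d = 0` the generating relations of the order are void, since they need `a, b ≥ 1` and `a +
b ≤ 0`. So `Δ(λ)` and `∇(λ)` are both the line `M(λ)`. -/
theorem nontrivial_of_dimension_zero (hp : IsPerfect R 0) (X : U 0) :
    deltaToNabla hp X ≠ 0 ∧ Nontrivial (Delta hp X) ∧ Nontrivial (Nabla hp X) ∧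
      Nontrivial (L hp X) := by
  have hlt : ∀ x y : Lam 0, ¬ Lam.Lt x y := by
    intro x y h
    obtain ⟨z, hz⟩ : ∃ z, Lam.Basic 0 z y := by
      cases h with
      | single h => exact ⟨_, h⟩
      | tail _ h => exact ⟨_, h⟩
    cases hz <;> omega
  have hX : Nontrivial (wordObj R X.as) :=
    Module.nontrivial_of_finrank_eq_succ (finrank_wordObj_zero R X.as)
  obtain ⟨x, hx⟩ := exists_ne (0 : wordObj R X.as)
  refine nontrivial_of_mem_delta hp X (x := x) ?_ ?_
  · exact mem_delta_of_forall fun Y f h => absurd h (hlt _ _)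
  · exact fun h => hx ((Submodule.mem_bot k).1
      (nablaKer_le_of_forall (N := ⊥) (fun Y f h => absurd h (hlt _ _)) h))

end standard

end KoszulASRegular

end

theorem proposition6p1p7 {k : Type u} [Field k] [IsAlgClosed k]
    {V : Type u} [AddCommGroup V] [Module k V] [FiniteDimensional k V]
    (R : Submodule k (V ⊗[k] V)) (d : ℕ)
    (hKoszul : KoszulASRegular.IsKoszul R) (hRegular : KoszulASRegular.IsASRegular R d) :
    ∃ hp : KoszulASRegular.IsPerfect R d,
      ∀ (l : KoszulASRegular.Lam d) (X : KoszulASRegular.U d), X.toLam = l →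
        KoszulASRegular.deltaToNabla hp X ≠ 0 ∧
        Nontrivial (KoszulASRegular.Delta hp X) ∧
        Nontrivial (KoszulASRegular.Nabla hp X) ∧
        Nontrivial (KoszulASRegular.L hp X) := by
  obtain ⟨P⟩ := hKoszul.nonempty_linearResolution
  refine ⟨KoszulASRegular.isPerfect_of_linearResolution P hRegular, fun _ X _ => ?_⟩
  rcases Nat.eq_zero_or_pos d with rfl | hd
  · exact KoszulASRegular.nontrivial_of_dimension_zero _ X
  obtain ⟨A, _, _, S, T, hS, hT⟩ := KoszulASRegular.exists_calculus hd hKoszul hRegular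
  obtain ⟨ω, hω⟩ := (KoszulASRegular.isPerfect_of_linearResolution P hRegular).exists_ne_zero
  obtain ⟨ψ, hψ⟩ := KoszulASRegular.exists_dual_ne_zero (k := k) hω
  -- The functional is rescaled to take the value `1` at `ω`.
  refine KoszulASRegular.nontrivial_of_good (ψ := (ψ ω)⁻¹ • ψ) (ω := ω) ?_ hd (fun l hl => ?_) X
  · simp [hψ]
  · exact (KoszulASRegular.good_of_calculus hS hT (by simp [hψ]) l hl).1
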